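/- **Setting.** There are $N\ge1$ clusters, cluster $i$ having $n_i\ge 1$ agents; $n=\sum_i n_i$, and the agents $(i,j)$, $1\le j\le n_i$, are also labelled $p\in\{1,\dots,n\}$, cluster after cluster. Agent $(i,j)$ has a decision $x^i_j\in\mathbb R$ and a local cost $J^i_j:\mathbb R^n\to\mathbb R$; $\mathbf x^i=(x^i_j)_j$, $\mathbf x=(\mathbf x^i)_i$, and $J^i=\frac1{n_i}\sum_jJ^i_j$. A Nash equilibrium (NE) is an $\mathbf x^*$ with $J^i(\mathbf x^{i*},\mathbf x^{-i*})\le J^i(\mathbf x^i,\mathbf x^{-i*})$ for all $i$ and all $\mathbf x^i\in\mathbb R^{n_i}$. The game mapping is $\boldsymbol F(\mathbf x)=(\nabla_{\mathbf x^i}J^i(\mathbf x))_{i}$. **Assumptions.** (1) For each $i$, $A^i=[a^i_{jk}]$ is an adjacency matrix of a strongly connected digraph with all self-loops on the agents of cluster $i$ ($a^i_{jk}>0$ if $(k,j)$ is an edge, $a^i_{jk}=0$ otherwise), and it is column stochastic. (2) $\bar A=[\bar a_{pq}]$ is an adjacency matrix, in the same sense, of a strongly connected digraph with all self-loops on all $n$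 agents, and it is row stochastic. (3) Each $J^i_j$ is convex and continuously differentiable in $\mathbf x^i$ and jointly continuous, and for all $k$ the partial derivative $\nabla_{x^i_k}J^i_j$ is $\mathcal L$-Lipschitz in $\mathbf x\in\mathbb R^n$ (Euclidean norm). (4) $\langle\boldsymbol F(\mathbf x)-\boldsymbol F(\mathbf x'),\mathbf x-\mathbf x'\rangle\ge\chi\|\mathbf x-\mathbf x'\|_2^2$ for all $\mathbf x,\mathbf x'$, with $\chi>0$. (5) The gains satisfy $\delta_p>0$ and $\delta_p\bar a_{pq}<2\bar a_{pp}$ for all $p,q$. **Algorithm.** With step-sizes $\gamma^i_j>0$, arbitrary $x^i_{j,0}$ and $\mathbf y^p_0\in\mathbb R^n$, and $g^i_{jk,0}=\nabla_{x^i_k}J^i_j(\mathbf y^{(i,j)}_0)$, $$y^p_{q,t+1}=\sum_{l}\bar a_{pl}y^l_{q,t}+\delta_p\bar a_{pq}(x_{q,t}-y^p_{q,t}),\qquad x^i_{j,t+1}=x^i_{j,t}-\gamma^i_jg^i_{jj,t},$$ $$g^i_{jk,t+1}=\sum_la^i_{jl}g^i_{lk,t}+\nabla_{x^i_k}J^i_j(\mathbf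 y^{(i,j)}_{t+1})-\nabla_{x^i_k}J^i_j(\mathbf y^{(i,j)}_t).$$ Let $\gamma_M$ and $\bar\gamma$ be the largest and the average step-size, and $\epsilon_\gamma=\|\boldsymbol\gamma-\bar\gamma\mathbf 1_n\|_2/\|\bar\gamma\mathbf 1_n\|_2$, where $\boldsymbol\gamma$ is the vector of all step-sizes. **Notation.** $\pi^i$ is the vector with $A^i\pi^i=\pi^i$, $\mathbf 1^\top\pi^i=1$; $\boldsymbol\pi^i=n_i\pi^i$, $\boldsymbol\pi=(\boldsymbol\pi^i)_i$, with smallest and largest entries $\underline{\pi},\overline{\pi}$; $\iota=\max_i\|\pi^i\|_2$; $A^i_\infty=\lim_k(A^i)^k$. For a positive vector $w$, $\|v\|_w=\|\mathrm{diag}(\sqrt w)^{-1}v\|_2$ and $\|M\|_w=\|\mathrm{diag}(\sqrt w)^{-1}M\,\mathrm{diag}(\sqrt w)\|_2$. $\tilde A_q$ is $\bar A$ with diagonal entries replaced by $|\bar a_{pp}-\delta_p\bar a_{pq}|$. $\|\cdot\|_E$ is a submultiplicative matrix norm with $\|\tilde A_q\|_E<1$ for all $q$, $\|\cdot\|_e$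 is a vector norm with $\|Mv\|_e\le\|M\|_E\|v\|_e$, and $\underline C,\overline C>0$ satisfy $\underline C\|v\|_2\le\|v\|_e\le\overline C\|v\|_2$ for all $v$. Put $\sigma_i=\|A^i-A^i_\infty\|_{\boldsymbol\pi^i}$, $\tilde\sigma_q=\|\tilde A_q\|_E$, $\bar\sigma_1=\max_i\sigma_i$, $\bar\sigma_2=\max_q\tilde\sigma_q$, $\varsigma_1=\max_i\frac{1+\sigma_i^2}{1-\sigma_i^2}$, $\varsigma_2=\max_q\frac{1+\tilde\sigma_q^2}{1-\tilde\sigma_q^2}$, $S=\sum_in_i^3$, $\kappa=1+n\varsigma_2\overline C^2$, and $k_1=\underline\pi\chi$, $k_2=\frac{3\overline\pi\iota^2\mathcal L^2}{\underline\pi}S$, $k_3=2\overline\pi\sqrt n\mathcal L$, $k_4=\frac{3\overline\pi}{\underline\pi}$, $k_5=\frac{3}{\underline\pi\chi}$, $k_6=\frac{3n^2\iota^2\mathcal L^2}{\underline\pi\,\underline C^2}$, $k_7=\frac{3\overline\pi n\mathcal L^2}{\underline\pi\,\underline C^2\chi}$, $k_8=\frac{9\overline\pi n^2\varsigma_1\kappa\iota^2\mathcal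 L^4}{\underline\pi}S$, $k_9=\frac{9\overline\pi n^2\varsigma_1\kappa\mathcal L^2}{\underline\pi}S$, $k_{10}=\frac{1-\bar\sigma_1^2}2$, $k_{11}=\frac{3n\varsigma_1(3+\bar\sigma_2^2)\mathcal L^2}{2\underline\pi\,\underline C^2}$, $k_{12}=\frac{9n^4\varsigma_1\kappa\iota^2\mathcal L^4}{\underline\pi\,\underline C^2}$, $k_{13}=3\overline\pi n^2\varsigma_2\overline C^2\iota^2\mathcal L^2S$, $k_{14}=3\overline\pi n^2\varsigma_2\overline C^2$, $k_{15}=\frac{3n^4\varsigma_2\overline C^2\iota^2\mathcal L^2}{\underline C^2}$, $k_{16}=\frac{1-\bar\sigma_2^2}2$, $$\mathbf T=\begin{bmatrix}1-k_1\bar\gamma+k_2\gamma_M^2+k_3\epsilon_\gamma\bar\gamma & k_4\gamma_M^2+k_5\gamma_M^2/\bar\gamma & k_6\gamma_M^2+k_7\gamma_M^2/\bar\gamma\\ k_8\gamma_M^2&1-k_{10}+k_9\gamma_M^2&k_{11}+k_{12}\gamma_M^2\\ k_{13}\gamma_M^2&k_{14}\gamma_M^2&1-k_{16}+k_{15}\gamma_M^2\end{bmatrix}.$$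 With $d=k_1-k_3\epsilon_\gamma$ and $r=k_5k_{11}+k_7k_{10}$ let $$\gamma_1^*=\frac{k_7k_{10}d}{2n^2k_2r+(2k_4k_{11}+k_6k_{10})d},\quad \gamma_2^*=\sqrt{\frac{k_{10}k_{11}d}{2n^2k_8r+(2k_9k_{11}+k_{10}k_{12})d}},\quad \gamma_3^*=\sqrt{\frac{k_{10}k_{16}d}{2n^2k_{13}r+(2k_{11}k_{14}+k_{10}k_{15})d}}.$$ **Theorem 1.** Under assumptions (1)–(5), the vectors $\pi^i$ and the NE $\mathbf x^*$ exist and are unique, and a matrix norm $\|\cdot\|_E$ with a compatible vector norm as above exists. For every choice of such norms and of $\underline C,\overline C$, if the step-sizes satisfy $$\epsilon_\gamma<\frac{k_1}{k_3},\qquad \gamma_M<\min\Big\{\frac1{k_1},\gamma_1^*,\gamma_2^*,\gamma_3^*\Big\},$$ then $\rho(\mathbf T)<1$, and for all initial values each of $$\sup_{\ell\ge t}\|\mathbf x_\ell-\mathbf x^*\|_{\boldsymbol\pi}^2,\qquad \sup_{\ell\ge t}\sum_{i=1}^N\sum_{k=1}^{n_i}\|\mathbf g^i_{k,\ell}-A^i_\infty\mathbf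 g^i_{k,\ell}\|_{\boldsymbol\pi^i}^2,\qquad \sup_{\ell\ge t}\sum_{q=1}^n\|\mathbf 1_nx_{q,\ell}-\mathbf y_{q,\ell}\|_e^2$$ is finite and converges to $0$ linearly at rate $\rho(\mathbf T)$, i.e. is at most $C\rho(\mathbf T)^t$ for all $t\ge0$ with a constant $C$ independent of $t$. Here $\mathbf g^i_{k}=(g^i_{1k},\dots,g^i_{n_ik})^\top$ and $\mathbf y_q=(y^1_q,\dots,y^n_q)^\top$. -/

import Mathlib

open Filter Topology

noncomputable section

namespace ClusterGame

/-! ## Vector and matrix norms -/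

/-- Euclidean norm of a real vector. -/
def norm2 {ι : Type} [Fintype ι] (v : ι → ℝ) : ℝ := ‖WithLp.toLp 2 v‖

/-- Weighted Euclidean norm of `v`: the Euclidean norm of `diag(√w)⁻¹ v`. -/
def wnorm {ι : Type} [Fintype ι] (w v : ι → ℝ) : ℝ :=
  norm2 (fun a => (Real.sqrt (w a))⁻¹ * v a)

/-- Spectral norm (largest singular value) of a real square matrix. -/
def specNorm {ι : Type} [Fintype ι] [DecidableEq ι] (M : Matrix ι ι ℝ) : ℝ :=
  ‖Matrix.toEuclideanCLM (n := ι) (𝕜 := ℝ) M‖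

/-- Matrix norm induced by the weighted Euclidean norm. -/
def wmatNorm {ι : Type} [Fintype ι] [DecidableEq ι] (w : ι → ℝ) (M : Matrix ι ι ℝ) : ℝ :=
  specNorm (Matrix.diagonal (fun a => (Real.sqrt (w a))⁻¹) * M *
    Matrix.diagonal (fun a => Real.sqrt (w a)))

/-- The infinite power `lim_k M ^ k`. -/
def infPower {ι : Type} [Fintype ι] [DecidableEq ι] (M : Matrix ι ι ℝ) : Matrix ι ι ℝ :=
  limUnder atTop (fun k : ℕ => M ^ k)

/-- Spectral radius of a real matrix: the largest modulus of its complex eigenvalues. -/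
def specRadius {ι : Type} [Fintype ι] [DecidableEq ι] (M : Matrix ι ι ℝ) : ENNReal :=
  spectralRadius ℂ (M.map (fun r : ℝ => (r : ℂ)))

/-- A norm `mat` on square matrices (submultiplicative), together with a norm `vec` on vectors
that is compatible with it. -/
structure CompatibleNorms (ι : Type) [Fintype ι] where
  vec : Seminorm ℝ (ι → ℝ)
  mat : Seminorm ℝ (Matrix ι ι ℝ)
  vec_definite : ∀ v, vec v = 0 → v = 0
  mat_definite : ∀ M, mat M = 0 → M = 0
  mat_mul_le : ∀ M M', mat (M * M') ≤ mat M * mat M'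
  compatible : ∀ M v, vec (Matrix.mulVec M v) ≤ mat M * vec v

/-- `sup_{ℓ ≥ t} a ℓ` is finite and converges to `0` linearly (geometrically) at rate `r`. -/
def SupConvergesLinearly (a : ℕ → ℝ) (r : ℝ) : Prop :=
  BddAbove (Set.range a) ∧
  Tendsto (fun t : ℕ => ⨆ l : Set.Ici t, a l) atTop (𝓝 0) ∧
  ∃ C : ℝ, ∀ t : ℕ, |⨆ l : Set.Ici t, a l| ≤ C * r ^ t

/-! ## Networks -/

/-- Every vertex can be reached from every vertex along a directed path. -/
def StronglyConnected {V : Type} (G : Digraph V) : Prop :=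
  ∀ u v, Relation.ReflTransGen G.Adj u v

/-- `M` is an adjacency matrix of the digraph `G`, all of whose vertices carry a self-loop:
`M j k > 0` if `(k, j)` is an edge and `M j k = 0` otherwise. -/
structure IsAdjacencyMatrix {V : Type} (G : Digraph V) (M : Matrix V V ℝ) : Prop where
  loop : ∀ k, G.Adj k k
  pos : ∀ j k, G.Adj k j → 0 < M j k
  zero : ∀ j k, ¬ G.Adj k j → M j k = 0

/-- `v` is the right eigenvector of `M` for the eigenvalue `1` with entries summing to `1`. -/
def IsPerronVector {V : Type} [Fintype V] (M : Matrix V V ℝ) (v : V → ℝ) : Prop :=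
  Matrix.mulVec M v = v ∧ ∑ j, v j = 1

/-! ## The game -/

/-- Agents of all clusters: `⟨i, j⟩` is agent `j` of cluster `i`. This is also the vertex set
of the inter-cluster network. -/
abbrev Agent {N : ℕ} (n : Fin N → ℕ) : Type := Σ i : Fin N, Fin (n i)

/-- Decision profiles: `x i j` is the scalar decision of agent `j` of cluster `i`. -/
abbrev Profile {N : ℕ} (n : Fin N → ℕ) : Type := (i : Fin N) → Fin (n i) → ℝ

section

variable {N : ℕ} {n : Fin N → ℕ}

/-- A profile as one vector indexed by all agents. -/
def flat (x : Profile n) : Agent n → ℝ := fun a => x a.1 a.2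

/-- Partial derivative of `f` at `x` with respect to the decision of agent `k` of cluster `i`. -/
def partialGrad (i : Fin N) (k : Fin (n i)) (f : Profile n → ℝ) (x : Profile n) : ℝ :=
  deriv (fun s : ℝ => f (Function.update x i (Function.update (x i) k s))) (x i k)

/-- Cluster-level cost: the average of the local costs of the cluster. -/
def clusterCost (J : (i : Fin N) → Fin (n i) → Profile n → ℝ) (i : Fin N) (x : Profile n) : ℝ :=
  (1 / (n i : ℝ)) * ∑ j, J i j x

/-- Nash equilibrium of the cluster game: no cluster can lower its cost by changing its own
decision vector. -/
def IsNash (J : (i : Fin N) → Fin (n i) → Profile n → ℝ) (x : Profile n) : Prop :=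
  ∀ (i : Fin N) (z : Fin (n i) → ℝ), clusterCost J i x ≤ clusterCost J i (Function.update x i z)

/-- Game mapping: the stacked partial gradients of the cluster costs. -/
def gameMap (J : (i : Fin N) → Fin (n i) → Profile n → ℝ) (x : Profile n) : Profile n :=
  fun i k => partialGrad i k (clusterCost J i) x

/-- The local costs are convex and continuously differentiable in the decision vector of the own
cluster, jointly continuous, and their partial gradients with respect to the decisions in
the own cluster are `L`-Lipschitz in the whole profile. -/
structure RegularCosts (J : (i : Fin N) → Fin (n i) → Profile n → ℝ) (L : ℝ) : Prop where
  convex : ∀ i j x, ConvexOn ℝ Set.univ (fun z : Fin (n i) → ℝ => J i j (Function.update x i z))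
  contDiff : ∀ i j x, ContDiff ℝ 1 (fun z : Fin (n i) → ℝ => J i j (Function.update x i z))
  continuous : ∀ i j, Continuous (J i j)
  lipschitz : ∀ i j k (x x' : Profile n),
    |partialGrad i k (J i j) x - partialGrad i k (J i j) x'| ≤ L * norm2 (flat x - flat x')

/-- The game mapping is strongly monotone with constant `χ`. -/
def StronglyMonotone (J : (i : Fin N) → Fin (n i) → Profile n → ℝ) (χ : ℝ) : Prop :=
  ∀ x x' : Profile n,
    χ * norm2 (flat x - flat x') ^ 2 ≤
      ∑ i, ∑ k, (gameMap J x i k - gameMap J x' i k) * (x i k - x' i k)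

/-! ## The algorithm -/

/-- The sequences `x` (decisions), `g` (gradient trackers, `g t i j k` is held by agent `j` of
cluster `i` for agent `k`) and `y` (estimates, `y t p` is the profile estimated by agent `p`)
are generated by the leader-following / gradient-tracking algorithm. -/
structure IsRun (J : (i : Fin N) → Fin (n i) → Profile n → ℝ)
    (A : (i : Fin N) → Matrix (Fin (n i)) (Fin (n i)) ℝ) (Abar : Matrix (Agent n) (Agent n) ℝ)
    (δ : Agent n → ℝ) (γ : Profile n)
    (x : ℕ → Profile n) (g : ℕ → (i : Fin N) → Fin (n i) → Fin (n i) → ℝ)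
    (y : ℕ → Agent n → Profile n) : Prop where
  init : ∀ i j k, g 0 i j k = partialGrad i k (J i j) (y 0 ⟨i, j⟩)
  estimate : ∀ t (p q : Agent n),
    flat (y (t + 1) p) q = ∑ l, Abar p l * flat (y t l) q
      + δ p * Abar p q * (flat (x t) q - flat (y t p) q)
  decision : ∀ t i j, x (t + 1) i j = x t i j - γ i j * g t i j j
  tracker : ∀ t i j k,
    g (t + 1) i j k = ∑ l, A i j l * g t i l k
      + partialGrad i k (J i j) (y (t + 1) ⟨i, j⟩) - partialGrad i k (J i j) (y t ⟨i, j⟩)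

/-- The matrix `Ã_q`: `Abar` with diagonal entries replaced by `|ā_pp - δ_p ā_pq|`. -/
def estMatrix (Abar : Matrix (Agent n) (Agent n) ℝ) (δ : Agent n → ℝ) (q : Agent n) :
    Matrix (Agent n) (Agent n) ℝ :=
  fun p m => if p = m then |Abar p p - δ p * Abar p q| else Abar p m

/-- Largest step-size. -/
def stepMax (γ : Profile n) : ℝ := ⨆ a : Agent n, flat γ a

/-- Average step-size. -/
def stepAvg (γ : Profile n) : ℝ := (1 / (Fintype.card (Agent n) : ℝ)) * ∑ a, flat γ a

/-- Heterogeneity of the step-sizes. -/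
def stepHet (γ : Profile n) : ℝ :=
  norm2 (fun a : Agent n => flat γ a - stepAvg γ) / norm2 (fun _ : Agent n => stepAvg γ)

/-- The rescaled Perron vectors `n_i π^i`. -/
def scaledPerron (π : Profile n) : Profile n := fun i j => (n i : ℝ) * π i j

/-! ## The three errors -/

/-- Weighted squared distance of the decisions to `xs`. -/
def nashGap (π xs x : Profile n) : ℝ :=
  wnorm (flat (scaledPerron π)) (flat x - flat xs) ^ 2

/-- Total gradient tracking error. -/
def trackingError (π : Profile n) (A : (i : Fin N) → Matrix (Fin (n i)) (Fin (n i)) ℝ)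
    (g : (i : Fin N) → Fin (n i) → Fin (n i) → ℝ) : ℝ :=
  ∑ i, ∑ k, wnorm (scaledPerron π i)
    ((fun j => g i j k) - Matrix.mulVec (infPower (A i)) (fun j => g i j k)) ^ 2

/-- Total decision estimation error, in the vector norm of `ν`. -/
def estimationError (ν : CompatibleNorms (Agent n)) (x : Profile n) (y : Agent n → Profile n) : ℝ :=
  ∑ q, ν.vec (fun p => flat (y p) q - flat x q) ^ 2

end

/-! ## The constants and the comparison matrix -/

/-- The numbers from which the constants `k₁, …, k₁₆` are formed. -/
structure Param where
  /-- total number of agents -/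
  n : ℝ
  /-- sum of the cubes of the cluster sizes -/
  S : ℝ
  /-- smallest entry of the rescaled Perron vectors -/
  pmin : ℝ
  /-- largest entry of the rescaled Perron vectors -/
  pmax : ℝ
  /-- largest Euclidean norm of a Perron vector -/
  iota : ℝ
  /-- Lipschitz constant -/
  L : ℝ
  /-- strong monotonicity constant -/
  chi : ℝ
  /-- norm equivalence constants -/
  Clow : ℝ
  Cup : ℝ
  sigma1 : ℝ
  vs1 : ℝ
  sigma2 : ℝ
  vs2 : ℝ

/-- The parameters of the problem. -/
def param {N : ℕ} {n : Fin N → ℕ} (A : (i : Fin N) → Matrix (Fin (n i)) (Fin (n i)) ℝ)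
    (Abar : Matrix (Agent n) (Agent n) ℝ) (δ : Agent n → ℝ) (π : Profile n)
    (ν : CompatibleNorms (Agent n)) (L χ Clow Cup : ℝ) : Param :=
  let sA : Fin N → ℝ := fun i => wmatNorm (scaledPerron π i) (A i - infPower (A i))
  let sE : Agent n → ℝ := fun q => ν.mat (estMatrix Abar δ q)
  { n := Fintype.card (Agent n)
    S := ∑ i, (n i : ℝ) ^ 3
    pmin := ⨅ a : Agent n, flat (scaledPerron π) a
    pmax := ⨆ a : Agent n, flat (scaledPerron π) a
    iota := ⨆ i, norm2 (π i)
    L := L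
    chi := χ
    Clow := Clow
    Cup := Cup
    sigma1 := ⨆ i, sA i
    vs1 := ⨆ i, (1 + sA i ^ 2) / (1 - sA i ^ 2)
    sigma2 := ⨆ q, sE q
    vs2 := ⨆ q, (1 + sE q ^ 2) / (1 - sE q ^ 2) }

namespace Param

variable (c : Param)

def k1 : ℝ := c.pmin * c.chi
def k2 : ℝ := 3 * c.pmax * c.iota ^ 2 * c.L ^ 2 / c.pmin * c.S
def k3 : ℝ := 2 * c.pmax * Real.sqrt c.n * c.L
def k4 : ℝ := 3 * c.pmax / c.pmin
def k5 : ℝ := 3 / (c.pmin * c.chi)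
def k6 : ℝ := 3 * c.n ^ 2 * c.iota ^ 2 * c.L ^ 2 / (c.pmin * c.Clow ^ 2)
def k7 : ℝ := 3 * c.pmax * c.n * c.L ^ 2 / (c.pmin * c.Clow ^ 2 * c.chi)
def k8 : ℝ :=
  9 * c.pmax * c.n ^ 2 * c.vs1 * (1 + c.n * c.vs2 * c.Cup ^ 2) * c.iota ^ 2 * c.L ^ 4 / c.pmin * c.S
def k9 : ℝ :=
  9 * c.pmax * c.n ^ 2 * c.vs1 * (1 + c.n * c.vs2 * c.Cup ^ 2) * c.L ^ 2 / c.pmin * c.S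
def k10 : ℝ := (1 - c.sigma1 ^ 2) / 2
def k11 : ℝ := 3 * c.n * c.vs1 * (3 + c.sigma2 ^ 2) * c.L ^ 2 / (2 * c.pmin * c.Clow ^ 2)
def k12 : ℝ :=
  9 * c.n ^ 4 * c.vs1 * (1 + c.n * c.vs2 * c.Cup ^ 2) * c.iota ^ 2 * c.L ^ 4 / (c.pmin * c.Clow ^ 2)
def k13 : ℝ := 3 * c.pmax * c.n ^ 2 * c.vs2 * c.Cup ^ 2 * c.iota ^ 2 * c.L ^ 2 * c.S
def k14 : ℝ := 3 * c.pmax * c.n ^ 2 * c.vs2 * c.Cup ^ 2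
def k15 : ℝ := 3 * c.n ^ 4 * c.vs2 * c.Cup ^ 2 * c.iota ^ 2 * c.L ^ 2 / c.Clow ^ 2
def k16 : ℝ := (1 - c.sigma2 ^ 2) / 2

/-- Denominators of the step-size thresholds, for heterogeneity `ε`. -/
def q1 (ε : ℝ) : ℝ :=
  2 * c.n ^ 2 * c.k2 * (c.k5 * c.k11 + c.k7 * c.k10)
    + (2 * c.k4 * c.k11 + c.k6 * c.k10) * (c.k1 - c.k3 * ε)
def q2 (ε : ℝ) : ℝ :=
  2 * c.n ^ 2 * c.k8 * (c.k5 * c.k11 + c.k7 * c.k10)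
    + (2 * c.k9 * c.k11 + c.k10 * c.k12) * (c.k1 - c.k3 * ε)
def q3 (ε : ℝ) : ℝ :=
  2 * c.n ^ 2 * c.k13 * (c.k5 * c.k11 + c.k7 * c.k10)
    + (2 * c.k11 * c.k14 + c.k10 * c.k15) * (c.k1 - c.k3 * ε)

/-- The step-size thresholds, for heterogeneity `ε`. -/
def gamma1 (ε : ℝ) : ℝ := c.k7 * c.k10 * (c.k1 - c.k3 * ε) / c.q1 ε
def gamma2 (ε : ℝ) : ℝ := Real.sqrt (c.k10 * c.k11 * (c.k1 - c.k3 * ε) / c.q2 ε)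
def gamma3 (ε : ℝ) : ℝ := Real.sqrt (c.k10 * c.k16 * (c.k1 - c.k3 * ε) / c.q3 ε)

/-- The comparison matrix, for largest step-size `γM`, average `γa` and heterogeneity `ε`. -/
def T (γM γa ε : ℝ) : Matrix (Fin 3) (Fin 3) ℝ :=
  !![1 - c.k1 * γa + c.k2 * γM ^ 2 + c.k3 * ε * γa,
      c.k4 * γM ^ 2 + c.k5 * γM ^ 2 / γa, c.k6 * γM ^ 2 + c.k7 * γM ^ 2 / γa;
    c.k8 * γM ^ 2, 1 - c.k10 + c.k9 * γM ^ 2, c.k11 + c.k12 * γM ^ 2;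
    c.k13 * γM ^ 2, c.k14 * γM ^ 2, 1 - c.k16 + c.k15 * γM ^ 2]

end Param

end ClusterGame

end

open ClusterGame

/-!
The proof reduces the algorithm to a linear recursive inequality `v (t + 1) ≤ T v t` between
nonnegative vectors of three errors: the weighted distance `X` of the decisions to the equilibrium,
the tracking error `G`, and the estimation error `E`.

*Existence.* The Perron vectors come from the singularity of `A i - 1` and the fact that the
entrywise absolute value of a fixed vector is fixed (`existsUnique_perronVector`). A profile is a
Nash equilibrium iff the game mapping `F` vanishes there (`isNash_iff`), and `F` has exactly one zero
because `x ↦ x - a F x` is a contraction for small `a` (`existsUnique_isNash`). For the estimation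
matrices `Ã_q` a single norm has to contract all of them: each has row sums at most one, and along
any product of them the set of rows with sum below one grows until it is everything, so all products
of length `card (Agent n)` contract the sup norm strictly; a weighted sum over shorter products is a
norm as required (`wordNorm_lt_one`, `exists_compatibleNorms_lt_one`).

*Recursion.* The sum of the trackers of a cluster is the sum of the local gradients, so the step
direction of agent `a` is its tracking error plus `w_a` times the gradient of its cluster cost, up to
the error made by evaluating it at the estimates; here `w` is the rescaled Perron vector. The `X`-row
(`decision_step`) is strong monotonicity plus Young's inequality. The `G`-row (`tracking_step`) uses
that `A i - A∞` is a strict contraction of the `w`-weighted norm (`wmatNorm_sub_rankOne_lt_one`), by a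
variance identity, and that the estimates move by `(M_q - 1) e_q`, where `e_q` is the vector of errors
of the estimates of decision `q`. The `E`-row uses `e_q(t+1) = M_q e_q(t) + const`.

The matrix `M_q = estDynamics Abar δ q` may have negative diagonal entries, and only its entrywise
absolute value `Ã_q` is known to be contracted by the given norm, which need not be monotone.
Therefore the recursion is run with other gauges `W_q`, one for each decision, which have the same
equivalence constants to the Euclidean norm and which `M_q` contracts by the factor `ν.mat Ã_q`
(`exists_monotone_gauge`). So the constants of `T` do not change, and the error in the given norm is
at most a constant times the error in these gauges.

*Rate.* All entries of `T` are positive, so `T` has a positive eigenvector `u` whose eigenvalue `r` is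
the spectral radius (`exists_pos_eigenvector`, `specRadius_eq_of_pos_eigenvector`). The step-size
conditions provide a positive vector `w` with `T w < w` (`Param.Admissible.exists_T_mulVec_lt`), hence
`r < 1`; and `v 0 ≤ C u` propagates to `v t ≤ C r ^ t u`.
-/

namespace ClusterGame

/-! ### Euclidean and weighted Euclidean norms -/

section Norms

variable {ι : Type} [Fintype ι]

lemma norm2_nonneg (v : ι → ℝ) : 0 ≤ norm2 v := norm_nonneg _

lemma norm2_sq (v : ι → ℝ) : norm2 v ^ 2 = ∑ a, v a ^ 2 := by
  simp [norm2, EuclideanSpace.norm_sq_eq]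

lemma norm2_add_le (v w : ι → ℝ) : norm2 (v + w) ≤ norm2 v + norm2 w := by
  simpa [norm2] using norm_add_le (WithLp.toLp 2 v) (WithLp.toLp 2 w)

lemma norm2_le_of_sq_le {v w : ι → ℝ} (h : ∑ a, v a ^ 2 ≤ ∑ a, w a ^ 2) : norm2 v ≤ norm2 w := by
  rw [← norm2_sq, ← norm2_sq] at h
  exact (sq_le_sq₀ (norm2_nonneg _) (norm2_nonneg _)).1 h

lemma norm2_mono {v w : ι → ℝ} (h : ∀ a, |v a| ≤ |w a|) : norm2 v ≤ norm2 w :=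
  norm2_le_of_sq_le (Finset.sum_le_sum fun a _ => sq_le_sq.2 (h a))

lemma norm2_neg (v : ι → ℝ) : norm2 (-v) = norm2 v := by simp [norm2]

lemma norm2_abs (v : ι → ℝ) : norm2 (fun a => |v a|) = norm2 v :=
  le_antisymm (norm2_mono fun a => by simp) (norm2_mono fun a => by simp)

lemma wnorm_sq {w : ι → ℝ} (hw : ∀ a, 0 < w a) (v : ι → ℝ) :
    wnorm w v ^ 2 = ∑ a, v a ^ 2 / w a := by
  rw [wnorm, norm2_sq]
  refine Finset.sum_congr rfl fun a _ => ?_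
  rw [mul_pow, inv_pow, Real.sq_sqrt (hw a).le]
  ring

lemma wnorm_nonneg (w v : ι → ℝ) : 0 ≤ wnorm w v := norm2_nonneg _

variable [DecidableEq ι]

lemma norm2_mulVec_le (M : Matrix ι ι ℝ) (v : ι → ℝ) :
    norm2 (M.mulVec v) ≤ specNorm M * norm2 v := by
  have := (Matrix.toEuclideanCLM (n := ι) (𝕜 := ℝ) M).le_opNorm (WithLp.toLp 2 v)
  simpa [norm2, specNorm] using this

lemma conj_mulVec {w : ι → ℝ} (hw : ∀ a, 0 < w a) (M : Matrix ι ι ℝ) (v : ι → ℝ) :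
    (Matrix.diagonal (fun a => (Real.sqrt (w a))⁻¹) * M *
      Matrix.diagonal (fun a => Real.sqrt (w a))).mulVec (fun a => (Real.sqrt (w a))⁻¹ * v a) =
    fun a => (Real.sqrt (w a))⁻¹ * M.mulVec v a := by
  have h : (Matrix.diagonal (fun a => Real.sqrt (w a))).mulVec
      (fun a => (Real.sqrt (w a))⁻¹ * v a) = v := by
    ext a
    have := (Real.sqrt_pos.2 (hw a)).ne'
    simp [Matrix.mulVec_diagonal, this]
  rw [← Matrix.mulVec_mulVec, h, ← Matrix.mulVec_mulVec]
  ext a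
  simp [Matrix.mulVec_diagonal]

lemma wnorm_mulVec_le {w : ι → ℝ} (hw : ∀ a, 0 < w a) (M : Matrix ι ι ℝ) (v : ι → ℝ) :
    wnorm w (M.mulVec v) ≤ wmatNorm w M * wnorm w v := by
  have := norm2_mulVec_le (Matrix.diagonal (fun a => (Real.sqrt (w a))⁻¹) * M *
      Matrix.diagonal (fun a => Real.sqrt (w a))) (fun a => (Real.sqrt (w a))⁻¹ * v a)
  rwa [conj_mulVec hw] at this

lemma wmatNorm_nonneg (w : ι → ℝ) (M : Matrix ι ι ℝ) : 0 ≤ wmatNorm w M := norm_nonneg _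

/-- In finite dimension a strict contraction has operator norm below one, by compactness of the
unit ball. -/
lemma opNorm_lt_one_of_strict {E : Type} [NormedAddCommGroup E] [NormedSpace ℝ E]
    [FiniteDimensional ℝ E] (f : E →L[ℝ] E) (h : ∀ v, v ≠ 0 → ‖f v‖ < ‖v‖) : ‖f‖ < 1 := by
  have : ProperSpace E := FiniteDimensional.proper ℝ E
  obtain ⟨v, hv, hmax⟩ := (isCompact_closedBall (0 : E) 1).exists_isMaxOn ⟨0, by simp⟩
    (f := fun v => ‖f v‖) (by fun_prop)
  have hv1 : ‖v‖ ≤ 1 := by simpa using hv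
  have hlt : ‖f v‖ < 1 := by
    by_cases h0 : v = 0
    · simp [h0]
    · exact (h v h0).trans_le hv1
  refine lt_of_le_of_lt (ContinuousLinearMap.opNorm_le_of_unit_norm (norm_nonneg _) ?_) hlt
  intro x hx
  exact hmax (by simp [hx])

lemma wmatNorm_lt_one {w : ι → ℝ} (hw : ∀ a, 0 < w a) (M : Matrix ι ι ℝ)
    (h : ∀ v, v ≠ 0 → ∑ a, M.mulVec v a ^ 2 / w a < ∑ a, v a ^ 2 / w a) : wmatNorm w M < 1 := by
  refine opNorm_lt_one_of_strict _ fun v hv => ?_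
  have hs : ∀ a, Real.sqrt (w a) ≠ 0 := fun a => (Real.sqrt_pos.2 (hw a)).ne'
  set u : ι → ℝ := fun a => Real.sqrt (w a) * v a with hu
  have hvu : v = WithLp.toLp 2 (fun a => (Real.sqrt (w a))⁻¹ * u a) := by
    ext a; simp [hu, hs a]
  have hu0 : u ≠ 0 := by
    intro h0; apply hv; rw [hvu, h0]; ext a; simp
  have := h u hu0
  rw [← wnorm_sq hw, ← wnorm_sq hw] at this
  have := lt_of_pow_lt_pow_left₀ 2 (wnorm_nonneg _ _) this
  have e : (Matrix.toEuclideanCLM (n := ι) (𝕜 := ℝ)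
      (Matrix.diagonal (fun a => (Real.sqrt (w a))⁻¹) * M *
        Matrix.diagonal (fun a => Real.sqrt (w a)))) v =
      WithLp.toLp 2 (fun a => (Real.sqrt (w a))⁻¹ * M.mulVec u a) := by
    rw [← conj_mulVec hw, hvu]; simp [mul_assoc]
  rw [e]
  conv_rhs => rw [hvu]
  exact this

end Norms

/-! ### Perron vectors of column-stochastic matrices -/

section Perron

variable {V : Type} {G : Digraph V} {M : Matrix V V ℝ}

lemma IsAdjacencyMatrix.nonneg (hM : IsAdjacencyMatrix G M) (j k : V) : 0 ≤ M j k := by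
  by_cases h : G.Adj k j
  · exact (hM.pos j k h).le
  · exact (hM.zero j k h).ge

lemma IsAdjacencyMatrix.diag_pos (hM : IsAdjacencyMatrix G M) (j : V) : 0 < M j j :=
  hM.pos j j (hM.loop j)

variable [Fintype V]

/-- A nonnegative fixed vector of an irreducible nonnegative matrix that is positive somewhere is
positive everywhere: positivity is transported along the edges. -/
lemma pos_of_fixed (hM : IsAdjacencyMatrix G M) (hG : StronglyConnected G) {v : V → ℝ}
    (hv : ∀ j, 0 ≤ v j) (hfix : M.mulVec v = v) {k : V} (hk : 0 < v k) (j : V) : 0 < v j := by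
  have step : ∀ a b, G.Adj a b → 0 < v a → 0 < v b := by
    intro a b hab ha
    rw [← hfix]
    exact Finset.sum_pos' (fun l _ => mul_nonneg (hM.nonneg b l) (hv l))
      ⟨a, Finset.mem_univ _, mul_pos (hM.pos b a hab) ha⟩
  induction hG k j with
  | refl => exact hk
  | tail _ hab ih => exact step _ _ hab ih

lemma sum_mulVec_of_col (hcol : ∀ k, ∑ j, M j k = 1) (v : V → ℝ) :
    ∑ j, M.mulVec v j = ∑ j, v j := by
  simp only [Matrix.mulVec, dotProduct]
  rw [Finset.sum_comm]
  refine Finset.sum_congr rfl fun k _ => ?_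
  rw [← Finset.sum_mul, hcol, one_mul]

/-- The entrywise absolute value of a fixed vector of a column-stochastic matrix is fixed. -/
lemma abs_fixed (hM : IsAdjacencyMatrix G M) (hcol : ∀ k, ∑ j, M j k = 1) {v : V → ℝ}
    (hfix : M.mulVec v = v) : M.mulVec (fun k => |v k|) = fun k => |v k| := by
  have hle : ∀ j, |v j| ≤ M.mulVec (fun k => |v k|) j := by
    intro j
    conv_lhs => rw [← hfix]
    refine (Finset.abs_sum_le_sum_abs _ _).trans (le_of_eq ?_)
    refine Finset.sum_congr rfl fun k _ => ?_
    rw [abs_mul, abs_of_nonneg (hM.nonneg j k)]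
  have hsum := sum_mulVec_of_col hcol (fun k => |v k|)
  have := (Finset.sum_eq_sum_iff_of_le (fun j _ => hle j)).1 hsum.symm
  ext j
  exact (this j (Finset.mem_univ _)).symm

/-- A fixed vector of zero sum vanishes: its positive part is fixed, hence zero or positive
everywhere, and so is its negative part. -/
lemma fixed_eq_zero (hM : IsAdjacencyMatrix G M) (hG : StronglyConnected G)
    (hcol : ∀ k, ∑ j, M j k = 1) {v : V → ℝ} (hfix : M.mulVec v = v) (hs : ∑ j, v j = 0) :
    v = 0 := by
  have habs := abs_fixed hM hcol hfix
  have key : ∀ w : V → ℝ, M.mulVec w = w → ∑ j, w j = 0 → ∀ j, w j ≤ 0 := by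
    intro w hw hws j
    by_contra hj
    push Not at hj
    have hp : M.mulVec ((fun k => |w k|) + w) = (fun k => |w k|) + w := by
      rw [Matrix.mulVec_add, abs_fixed hM hcol hw, hw]
    have hpos := pos_of_fixed hM hG (v := (fun k => |w k|) + w)
      (fun k => by have := neg_abs_le (w k); simp; linarith) hp (k := j)
      (by have := abs_nonneg (w j); simp; linarith)
    have hall : ∀ k, 0 < w k := by
      intro k
      by_contra hk
      push Not at hk
      have := hpos k
      simp [abs_of_nonpos hk] at this
    have : 0 < ∑ k, w k := Finset.sum_pos (fun k _ => hall k) ⟨j, Finset.mem_univ _⟩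
    linarith
  ext j
  have h1 := key v hfix hs j
  have h2 := key (-v) (by rw [Matrix.mulVec_neg, hfix]) (by simp [hs]) j
  simp at h2
  exact le_antisymm h1 h2

lemma existsUnique_perronVector [DecidableEq V] [Nonempty V] (hM : IsAdjacencyMatrix G M)
    (hG : StronglyConnected G) (hcol : ∀ k, ∑ j, M j k = 1) : ∃! v, IsPerronVector M v := by
  have hdet : (M - 1).det = 0 := by
    rw [← Matrix.exists_vecMul_eq_zero_iff]
    refine ⟨fun _ => 1, fun h => one_ne_zero (congrFun h (Classical.arbitrary V)), ?_⟩
    ext k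
    simp [Matrix.vecMul, dotProduct, Matrix.sub_apply, hcol, Matrix.one_apply]
  obtain ⟨v, hv0, hv⟩ := Matrix.exists_mulVec_eq_zero_iff.2 hdet
  have hfix : M.mulVec v = v := by
    rw [Matrix.sub_mulVec, Matrix.one_mulVec, sub_eq_zero] at hv
    exact hv
  have habs := abs_fixed hM hcol hfix
  have hS : 0 < ∑ j, |v j| := by
    obtain ⟨j, hj⟩ := Function.ne_iff.1 hv0
    exact Finset.sum_pos' (fun _ _ => abs_nonneg _) ⟨j, Finset.mem_univ _, abs_pos.2 hj⟩
  refine ⟨(∑ j, |v j|)⁻¹ • fun k => |v k|, ⟨?_, ?_⟩, ?_⟩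
  · rw [Matrix.mulVec_smul, habs]
  · simp only [Pi.smul_apply, smul_eq_mul]
    rw [← Finset.mul_sum, inv_mul_cancel₀ hS.ne']
  · intro w hw
    rw [← sub_eq_zero]
    refine fixed_eq_zero hM hG hcol ?_ ?_
    · rw [Matrix.mulVec_sub, hw.1, Matrix.mulVec_smul, habs]
    · simp only [Pi.sub_apply, Finset.sum_sub_distrib, hw.2, Pi.smul_apply, smul_eq_mul]
      rw [← Finset.mul_sum, inv_mul_cancel₀ hS.ne', sub_self]

lemma IsPerronVector.pos (hM : IsAdjacencyMatrix G M) (hG : StronglyConnected G)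
    (hcol : ∀ k, ∑ j, M j k = 1) {π : V → ℝ} (hπ : IsPerronVector M π) (j : V) : 0 < π j := by
  have h1 : ∀ k, π k = |π k| := by
    -- `|π| - (∑ |π|) π` is fixed with zero sum, so `|π|` is a multiple of `π`
    have h0 : (fun k => |π k|) - (∑ k, |π k|) • π = 0 := by
      refine fixed_eq_zero hM hG hcol ?_ ?_
      · rw [Matrix.mulVec_sub, abs_fixed hM hcol hπ.1, Matrix.mulVec_smul, hπ.1]
      · simp [Finset.sum_sub_distrib, ← Finset.mul_sum, hπ.2]
    intro k
    have hk := congrFun h0 k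
    simp [sub_eq_zero] at hk
    have hS : 0 ≤ ∑ k, |π k| := Finset.sum_nonneg fun _ _ => abs_nonneg _
    rcases le_or_gt 0 (π k) with h | h
    · rw [abs_of_nonneg h]
    · rw [abs_of_neg h] at hk
      nlinarith
  have hnn : ∀ k, 0 ≤ π k := fun k => by rw [h1 k]; exact abs_nonneg _
  obtain ⟨k, hk⟩ : ∃ k, 0 < π k := by
    by_contra hcon
    push Not at hcon
    have := Finset.sum_nonpos (s := Finset.univ) (fun k _ => hcon k)
    linarith [hπ.2]
  exact pos_of_fixed hM hG hnn hπ.1 hk j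

/-- The variance identity behind the contraction of `M` in the `π`-weighted norm. -/
lemma sum_sq_div_mulVec (hcol : ∀ k, ∑ j, M j k = 1) {π : V → ℝ} (hfix : M.mulVec π = π)
    (hpos : ∀ j, 0 < π j) (u : V → ℝ) :
    ∑ j, M.mulVec u j ^ 2 / π j = ∑ k, u k ^ 2 / π k
      - ∑ j, ∑ k, M j k * π k * (u k / π k - M.mulVec u j / π j) ^ 2 := by
  have h1 : ∑ k, u k ^ 2 / π k = ∑ j, ∑ k, M j k * (u k ^ 2 / π k) := by
    rw [Finset.sum_comm]
    refine Finset.sum_congr rfl fun k _ => ?_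
    rw [← Finset.sum_mul, hcol, one_mul]
  rw [h1, ← Finset.sum_sub_distrib]
  refine Finset.sum_congr rfl fun j _ => ?_
  have hj : ∑ k, M j k * π k = π j := congrFun hfix j
  have hm : ∑ k, M j k * u k = M.mulVec u j := rfl
  set m := M.mulVec u j
  have e : ∀ k, M j k * π k * (u k / π k - m / π j) ^ 2 =
      M j k * (u k ^ 2 / π k) - 2 * (m / π j) * (M j k * u k) + (m / π j) ^ 2 * (M j k * π k) := by
    intro k
    have := (hpos k).ne'
    have := (hpos j).ne'
    field_simp
    ring
  simp only [e, Finset.sum_add_distrib, Finset.sum_sub_distrib, ← Finset.mul_sum, hj, hm]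
  have := (hpos j).ne'
  field_simp
  ring

/-- On vectors of zero sum, a column-stochastic matrix of a strongly connected network with
self-loops strictly decreases the `π`-weighted norm. -/
lemma sum_sq_div_mulVec_lt (hM : IsAdjacencyMatrix G M) (hG : StronglyConnected G)
    (hcol : ∀ k, ∑ j, M j k = 1) {π : V → ℝ} (hπ : IsPerronVector M π) {u : V → ℝ}
    (hu : u ≠ 0) (hs : ∑ j, u j = 0) :
    ∑ j, M.mulVec u j ^ 2 / π j < ∑ k, u k ^ 2 / π k := by
  have hpos := fun j => hπ.pos hM hG hcol j
  rw [sum_sq_div_mulVec hcol hπ.1 hpos]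
  have hnn : ∀ j k, 0 ≤ M j k * π k * (u k / π k - M.mulVec u j / π j) ^ 2 := fun j k =>
    mul_nonneg (mul_nonneg (hM.nonneg j k) (hpos k).le) (sq_nonneg _)
  by_contra hcon
  have hz : ∑ j, ∑ k, M j k * π k * (u k / π k - M.mulVec u j / π j) ^ 2 = 0 :=
    le_antisymm (by linarith) (Finset.sum_nonneg fun j _ => Finset.sum_nonneg fun k _ => hnn j k)
  have hz' : ∀ j k, M j k * π k * (u k / π k - M.mulVec u j / π j) ^ 2 = 0 := by
    intro j k
    have h1 := (Finset.sum_eq_zero_iff_of_nonneg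
      (fun j _ => Finset.sum_nonneg fun k _ => hnn j k)).1 hz j (Finset.mem_univ _)
    exact (Finset.sum_eq_zero_iff_of_nonneg (fun k _ => hnn j k)).1 h1 k (Finset.mem_univ _)
  have hedge : ∀ k j, G.Adj k j → u k / π k = M.mulVec u j / π j := by
    intro k j hkj
    have h0 := hz' j k
    have hne : M j k * π k ≠ 0 := (mul_pos (hM.pos j k hkj) (hpos k)).ne'
    have := (mul_eq_zero.1 h0).resolve_left hne
    exact sub_eq_zero.1 (pow_eq_zero_iff (two_ne_zero) |>.1 this)
  have hconst : ∀ a b, u a / π a = u b / π b := by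
    intro a b
    induction hG a b with
    | refl => rfl
    | tail _ hab ih => rw [ih, hedge _ _ hab, hedge _ _ (hM.loop _)]
  apply hu
  ext a
  have hub : ∀ b, u b = u a / π a * π b := by
    intro b
    rw [hconst a b, div_mul_cancel₀ _ (hpos b).ne']
  have : ∑ b, u b = u a / π a := by
    rw [Finset.sum_congr rfl fun b _ => hub b, ← Finset.mul_sum, hπ.2, mul_one]
  rw [hs] at this
  have h0 := hub a
  rw [← this] at h0
  simpa using h0

lemma sum_sq_div_sub_smul {π : V → ℝ} (hpos : ∀ j, 0 < π j) (hsum : ∑ j, π j = 1) (u : V → ℝ) :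
    ∑ j, (u j - (∑ k, u k) * π j) ^ 2 / π j = ∑ j, u j ^ 2 / π j - (∑ k, u k) ^ 2 := by
  set s := ∑ k, u k with hs
  have e : ∀ j, (u j - s * π j) ^ 2 / π j = u j ^ 2 / π j - 2 * s * u j + s ^ 2 * π j := by
    intro j
    have := (hpos j).ne'
    field_simp
    ring
  simp only [e, Finset.sum_add_distrib, Finset.sum_sub_distrib, ← Finset.mul_sum, hsum, ← hs]
  ring

lemma rankOne_mulVec (π u : V → ℝ) :
    (Matrix.of fun j (_ : V) => π j).mulVec u = fun j => (∑ k, u k) * π j := by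
  ext j
  simp [Matrix.mulVec, dotProduct, ← Finset.mul_sum, mul_comm]

variable [DecidableEq V]

lemma wmatNorm_sub_rankOne_lt_one (hM : IsAdjacencyMatrix G M) (hG : StronglyConnected G)
    (hcol : ∀ k, ∑ j, M j k = 1) {π : V → ℝ} (hπ : IsPerronVector M π) {c : ℝ} (hc : 0 < c) :
    wmatNorm (fun j => c * π j) (M - Matrix.of fun j _ => π j) < 1 := by
  have hpos := fun j => hπ.pos hM hG hcol j
  refine wmatNorm_lt_one (fun j => mul_pos hc (hpos j)) _ fun u hu => ?_
  have e : ∀ f : V → ℝ, ∑ j, f j ^ 2 / (c * π j) = c⁻¹ * ∑ j, f j ^ 2 / π j := by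
    intro f
    rw [Finset.mul_sum]
    refine Finset.sum_congr rfl fun j _ => ?_
    field_simp
  rw [e, e]
  refine mul_lt_mul_of_pos_left ?_ (inv_pos.2 hc)
  -- `u'` is the component of `u` orthogonal to `π` in the weighted inner product
  set u' : V → ℝ := u - (∑ k, u k) • π with hu'
  have hMu : (M - Matrix.of fun j _ => π j).mulVec u = M.mulVec u' := by
    rw [Matrix.sub_mulVec, rankOne_mulVec, hu', Matrix.mulVec_sub, Matrix.mulVec_smul, hπ.1]
    rfl
  have hle : ∑ j, u' j ^ 2 / π j = ∑ j, u j ^ 2 / π j - (∑ k, u k) ^ 2 :=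
    sum_sq_div_sub_smul hpos hπ.2 u
  rw [hMu]
  by_cases h0 : u' = 0
  · rw [h0]
    obtain ⟨j, hj⟩ := Function.ne_iff.1 hu
    have : 0 < ∑ j, u j ^ 2 / π j :=
      Finset.sum_pos' (fun j _ => div_nonneg (sq_nonneg _) (hpos j).le)
        ⟨j, Finset.mem_univ _, div_pos (by simpa using sq_pos_of_ne_zero hj) (hpos j)⟩
    simpa using this
  · have hs : ∑ j, u' j = 0 := by
      simp [hu', Finset.sum_sub_distrib, ← Finset.mul_sum, hπ.2]
    have := sum_sq_div_mulVec_lt hM hG hcol hπ h0 hs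
    nlinarith [sq_nonneg (∑ k, u k)]

/-- The powers of `M` converge to the rank-one matrix `π 1ᵀ`. -/
lemma infPower_eq (hM : IsAdjacencyMatrix G M) (hG : StronglyConnected G)
    (hcol : ∀ k, ∑ j, M j k = 1) {π : V → ℝ} (hπ : IsPerronVector M π) :
    infPower M = Matrix.of fun j _ => π j := by
  have hpos := fun j => hπ.pos hM hG hcol j
  set P : Matrix V V ℝ := Matrix.of fun j _ => π j with hP
  set r := wmatNorm (fun j => 1 * π j) (M - P) with hr
  have hr1 : r < 1 := wmatNorm_sub_rankOne_lt_one hM hG hcol hπ one_pos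
  have hMP : M * P = P := by
    ext j k
    exact congrFun hπ.1 j
  have hPM : P * M = P := by
    ext j k
    simp [Matrix.mul_apply, hP, ← Finset.mul_sum, hcol]
  have hPP : P * P = P := by
    ext j k
    simp [Matrix.mul_apply, hP, ← Finset.mul_sum, hπ.2]
  have hpow : ∀ k : ℕ, (M - P) ^ (k + 1) = M ^ (k + 1) - P := by
    intro k
    have hMkP : ∀ k : ℕ, M ^ k * P = P := by
      intro k
      induction k with
      | zero => simp
      | succ k ih => rw [pow_succ, mul_assoc, hMP, ih]
    induction k with
    | zero => simp
    | succ k ih =>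
      rw [pow_succ, ih, sub_mul, mul_sub, mul_sub, hMkP, hPM, hPP, ← pow_succ]
      abel
  have hw : ∀ a, 0 < (fun j => 1 * π j) a := fun a => by simpa using hpos a
  have hb : ∀ (k : ℕ) (v : V → ℝ), wnorm (fun j => 1 * π j) (((M - P) ^ k).mulVec v) ≤
      r ^ k * wnorm (fun j => 1 * π j) v := by
    intro k v
    induction k with
    | zero => simp
    | succ k ih =>
      rw [pow_succ', ← Matrix.mulVec_mulVec, pow_succ', mul_assoc]
      exact (wnorm_mulVec_le hw _ _).trans
        (mul_le_mul_of_nonneg_left ih (wmatNorm_nonneg _ _))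
  have hent : ∀ j l, Tendsto (fun k : ℕ => ((M - P) ^ k) j l) atTop (𝓝 0) := by
    intro j l
    set s := Real.sqrt (1 * π j)
    have hs : 0 < s := Real.sqrt_pos.2 (hw j)
    set w0 := wnorm (fun j => 1 * π j) (Pi.single l 1) with hw0
    have hbound : ∀ k : ℕ, |((M - P) ^ k) j l| ≤ s * (r ^ k * w0) := by
      intro k
      have h1 := hb k (Pi.single l 1)
      have h2 : (s⁻¹ * ((M - P) ^ k) j l) ^ 2 ≤
          wnorm (fun j => 1 * π j) (((M - P) ^ k).mulVec (Pi.single l 1)) ^ 2 := by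
        rw [wnorm, norm2_sq]
        refine le_trans (le_of_eq ?_) (Finset.single_le_sum (f := fun a =>
          ((Real.sqrt (1 * π a))⁻¹ * (((M - P) ^ k).mulVec (Pi.single l 1)) a) ^ 2)
          (fun a _ => sq_nonneg _) (Finset.mem_univ j))
        simp [s]
      have h3 := abs_le_of_sq_le_sq h2 (wnorm_nonneg _ _)
      have h4 : |s⁻¹ * ((M - P) ^ k) j l| ≤ r ^ k * w0 := h3.trans h1
      rw [abs_mul, abs_of_pos (inv_pos.2 hs), inv_mul_le_iff₀ hs] at h4
      exact h4
    refine squeeze_zero_norm hbound ?_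
    have := (tendsto_pow_atTop_nhds_zero_of_lt_one (wmatNorm_nonneg _ _) hr1)
    have h5 := (this.mul_const w0).const_mul s
    rwa [zero_mul, mul_zero] at h5
  refine Tendsto.limUnder_eq ?_
  refine tendsto_pi_nhds.2 fun j => tendsto_pi_nhds.2 fun l => ?_
  rw [← tendsto_add_atTop_iff_nat 1]
  have := ((tendsto_add_atTop_iff_nat 1).2 (hent j l)).add_const (P j l)
  simp only [hpow, zero_add] at this
  simpa using this

end Perron

/-! ### Positive matrices: Perron eigenvector and linear recursive inequalities -/

section PositiveMatrix

variable {ι : Type} [Fintype ι]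

lemma mulVec_mono {T : Matrix ι ι ℝ} (hT : ∀ i j, 0 ≤ T i j) {u v : ι → ℝ} (h : ∀ i, u i ≤ v i)
    (i : ι) : T.mulVec u i ≤ T.mulVec v i :=
  Finset.sum_le_sum fun j _ => mul_le_mul_of_nonneg_left (h j) (hT i j)

lemma mulVec_pos_of_pos {T : Matrix ι ι ℝ} (hT : ∀ i j, 0 < T i j) {u : ι → ℝ} (h : ∀ i, 0 ≤ u i)
    (h0 : u ≠ 0) (i : ι) : 0 < T.mulVec u i := by
  obtain ⟨j, hj⟩ := Function.ne_iff.1 h0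
  exact Finset.sum_pos' (fun k _ => mul_nonneg (hT i k).le (h k))
    ⟨j, Finset.mem_univ _, mul_pos (hT i j) (lt_of_le_of_ne (h j) (Ne.symm hj))⟩

lemma exists_pos_forall_mul_le [Nonempty ι] {a b : ι → ℝ} (ha : ∀ i, 0 < a i) (hb : ∀ i, 0 < b i) :
    ∃ ε > 0, ∀ i, ε * a i ≤ b i := by
  obtain ⟨i0, -, h⟩ := Finset.exists_min_image Finset.univ (fun i => b i / a i)
    Finset.univ_nonempty
  refine ⟨b i0 / a i0, div_pos (hb _) (ha _), fun i => ?_⟩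
  exact (le_div_iff₀ (ha i)).1 (h i (Finset.mem_univ _))

/-- Perron's theorem for positive matrices, by maximizing the Collatz–Wielandt ratio over the
standard simplex. -/
lemma exists_pos_eigenvector [Nonempty ι] {T : Matrix ι ι ℝ} (hT : ∀ i j, 0 < T i j) :
    ∃ r : ℝ, 0 < r ∧ ∃ u : ι → ℝ, (∀ i, 0 < u i) ∧ T.mulVec u = r • u := by
  classical
  set B := ∑ i, ∑ j, T i j with hB
  have hB0 : 0 ≤ B := Finset.sum_nonneg fun i _ => Finset.sum_nonneg fun j _ => (hT i j).le
  have hbound : ∀ (α : ℝ) (u : ι → ℝ), u ∈ stdSimplex ℝ ι → (∀ i, α * u i ≤ T.mulVec u i) →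
      α ≤ B := by
    intro α u hu h
    have h1 : ∑ i, α * u i ≤ ∑ i, T.mulVec u i := Finset.sum_le_sum fun i _ => h i
    rw [← Finset.mul_sum, hu.2, mul_one] at h1
    refine h1.trans (Finset.sum_le_sum fun i _ => Finset.sum_le_sum fun j _ => ?_)
    have : u j ≤ 1 := by
      rw [← hu.2]
      exact Finset.single_le_sum (f := u) (fun k _ => hu.1 k) (Finset.mem_univ j)
    nlinarith [hT i j]
  set K : Set (ℝ × (ι → ℝ)) := (Set.Icc 0 B ×ˢ stdSimplex ℝ ι) ∩
    {p | ∀ i, p.1 * p.2 i ≤ T.mulVec p.2 i} with hK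
  have hKc : IsCompact K := by
    refine (isCompact_Icc.prod (isCompact_stdSimplex ℝ ι)).inter_right ?_
    have : {p : ℝ × (ι → ℝ) | ∀ i, p.1 * p.2 i ≤ T.mulVec p.2 i} =
      ⋂ i, {p | p.1 * p.2 i ≤ T.mulVec p.2 i} := by ext; simp
    rw [this]
    refine isClosed_iInter fun i => isClosed_le (by fun_prop) ?_
    unfold Matrix.mulVec dotProduct
    fun_prop
  have hKne : K.Nonempty := by
    obtain ⟨i⟩ := ‹Nonempty ι›
    refine ⟨(0, Pi.single i 1), ⟨⟨le_refl _, hB0⟩, single_mem_stdSimplex ℝ i⟩, fun j => ?_⟩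
    simpa using (hT j i).le
  obtain ⟨⟨r, u⟩, ⟨⟨⟨hr0, _⟩, hu⟩, hle⟩, hmax⟩ := hKc.exists_isMaxOn hKne continuous_fst.continuousOn
  dsimp only at hr0 hu hle
  have hu0 : u ≠ 0 := by
    rintro rfl
    simpa using hu.2
  have hTu := mulVec_pos_of_pos hT hu.1 hu0
  have heq : T.mulVec u = r • u := by
    by_contra hne
    have hv := mulVec_pos_of_pos hT (u := T.mulVec u - r • u)
      (fun i => by have := hle i; simpa using this) (sub_ne_zero.2 hne)
    obtain ⟨ε, hε, hε'⟩ := exists_pos_forall_mul_le hTu hv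
    set s := ∑ i, T.mulVec u i with hs
    have hs0 : 0 < s := Finset.sum_pos (fun i _ => hTu i) Finset.univ_nonempty
    set w := s⁻¹ • T.mulVec u with hw
    have hwS : w ∈ stdSimplex ℝ ι := by
      refine ⟨fun i => mul_nonneg (inv_pos.2 hs0).le (hTu i).le, ?_⟩
      simp only [hw, Pi.smul_apply, smul_eq_mul, ← Finset.mul_sum]
      exact inv_mul_cancel₀ hs0.ne'
    have hwle : ∀ i, (r + ε) * w i ≤ T.mulVec w i := by
      intro i
      have h1 := hε' i
      rw [Matrix.mulVec_sub, Matrix.mulVec_smul] at h1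
      rw [hw, Matrix.mulVec_smul]
      simp only [Pi.smul_apply, Pi.sub_apply, smul_eq_mul] at h1 ⊢
      have := mul_le_mul_of_nonneg_left h1 (inv_pos.2 hs0).le
      linarith
    have hmem : (r + ε, w) ∈ K :=
      ⟨⟨⟨by positivity, hbound _ _ hwS hwle⟩, hwS⟩, hwle⟩
    have : r + ε ≤ r := hmax hmem
    linarith
  have hru : ∀ i, 0 < r * u i := fun i => by
    have := hTu i
    rwa [heq] at this
  obtain ⟨i⟩ := ‹Nonempty ι›
  have hr : 0 < r := lt_of_le_of_ne hr0 (by rintro rfl; simpa using hru i)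
  exact ⟨r, hr, u, fun i => pos_of_mul_pos_right (hru i) hr.le, heq⟩

lemma exists_forall_le_mul [Nonempty ι] {u : ι → ℝ} (hu : ∀ i, 0 < u i) (z : ι → ℝ) :
    ∃ c : ℝ, (∀ i, z i ≤ c * u i) ∧ ∃ i, z i = c * u i := by
  obtain ⟨i0, -, h⟩ := Finset.exists_max_image Finset.univ (fun i => z i / u i)
    Finset.univ_nonempty
  refine ⟨z i0 / u i0, fun i => ?_, i0, ?_⟩
  · exact (div_le_iff₀ (hu i)).1 (h i (Finset.mem_univ _))
  · rw [div_mul_cancel₀ _ (hu i0).ne']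

lemma specRadius_eq_of_pos_eigenvector [Nonempty ι] [DecidableEq ι] {T : Matrix ι ι ℝ}
    (hT : ∀ i j, 0 ≤ T i j) {r : ℝ} (hr : 0 ≤ r) {u : ι → ℝ} (hu : ∀ i, 0 < u i)
    (h : T.mulVec u = r • u) : specRadius T = ENNReal.ofReal r := by
  have hspec : ∀ z : ℂ, z ∈ spectrum ℂ (T.map (fun r : ℝ => (r : ℂ))) ↔
      ∃ v : ι → ℂ, v ≠ 0 ∧ (T.map (fun r : ℝ => (r : ℂ))).mulVec v = z • v := by
    intro z
    rw [spectrum.mem_iff, Matrix.isUnit_iff_isUnit_det, isUnit_iff_ne_zero, not_not,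
      ← Matrix.exists_mulVec_eq_zero_iff]
    refine exists_congr fun v => and_congr_right fun _ => ?_
    rw [Matrix.sub_mulVec, sub_eq_zero, Algebra.algebraMap_eq_smul_one, Matrix.smul_mulVec,
      Matrix.one_mulVec, eq_comm]
  refine le_antisymm ?_ ?_
  · refine iSup₂_le fun z hz => ?_
    obtain ⟨v, hv0, hv⟩ := (hspec z).1 hz
    -- compare `|v|` with the Perron eigenvector at an index where the ratio is largest
    obtain ⟨c, hc, i, hi⟩ := exists_forall_le_mul hu (fun i => ‖v i‖)
    have h1 : ‖z‖ * ‖v i‖ ≤ r * ‖v i‖ := by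
      calc ‖z‖ * ‖v i‖ = ‖(T.map (fun r : ℝ => (r : ℂ))).mulVec v i‖ := by
            rw [hv]; simp
        _ ≤ ∑ j, T i j * ‖v j‖ := by
            refine (norm_sum_le _ _).trans (le_of_eq (Finset.sum_congr rfl fun j _ => ?_))
            simp [abs_of_nonneg (hT i j)]
        _ ≤ ∑ j, T i j * (c * u j) :=
            Finset.sum_le_sum fun j _ => mul_le_mul_of_nonneg_left (hc j) (hT i j)
        _ = c * (T.mulVec u i) := by
            simp only [Matrix.mulVec, dotProduct, Finset.mul_sum]
            exact Finset.sum_congr rfl fun j _ => by ring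
        _ = r * ‖v i‖ := by
            rw [h, hi, Pi.smul_apply, smul_eq_mul]; ring
    have hvi : 0 < ‖v i‖ := by
      rw [hi]
      obtain ⟨j, hj⟩ := Function.ne_iff.1 hv0
      have : 0 < ‖v j‖ := norm_pos_iff.2 hj
      exact mul_pos (pos_of_mul_pos_left (this.trans_le (hc j)) (hu j).le) (hu i)
    have h2 : ‖z‖ ≤ r := le_of_mul_le_mul_right h1 hvi
    exact (ofReal_norm z).symm.le.trans (ENNReal.ofReal_le_ofReal h2)
  · have hmem : (r : ℂ) ∈ spectrum ℂ (T.map (fun r : ℝ => (r : ℂ))) := by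
      refine (hspec _).2 ⟨fun i => (u i : ℂ), ?_, ?_⟩
      · intro h0
        obtain ⟨i⟩ := ‹Nonempty ι›
        have := congrFun h0 i
        exact (hu i).ne' (by simpa using this)
      · ext i
        have := congrFun h i
        simp only [Matrix.mulVec, dotProduct, Pi.smul_apply, smul_eq_mul] at this
        simp only [Matrix.mulVec, dotProduct, Matrix.map_apply, Pi.smul_apply, smul_eq_mul]
        exact_mod_cast this
    refine le_trans (le_of_eq ?_) (le_iSup₂ (f := fun (k : ℂ) (_ : k ∈ spectrum ℂ
      (T.map (fun r : ℝ => (r : ℂ)))) => (‖k‖₊ : ENNReal)) (r : ℂ) hmem)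
    have h1 := ofReal_norm (r : ℂ)
    rw [Complex.norm_real, Real.norm_of_nonneg hr] at h1
    exact h1

/-- A positive matrix with `T w < w` for some positive `w` has spectral radius below one. -/
lemma eigenvalue_lt_one [Nonempty ι] {T : Matrix ι ι ℝ} (hT : ∀ i j, 0 ≤ T i j) {r : ℝ}
    {u : ι → ℝ} (hu : ∀ i, 0 < u i) (h : T.mulVec u = r • u) {w : ι → ℝ} (hw : ∀ i, 0 < w i)
    (hTw : ∀ i, T.mulVec w i < w i) : r < 1 := by
  obtain ⟨c, hc, i, hi⟩ := exists_forall_le_mul hw u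
  have hc0 : 0 < c := by
    have := hu i
    rw [hi] at this
    exact pos_of_mul_pos_left this (hw i).le
  have h1 : r * u i < u i := by
    calc r * u i = T.mulVec u i := by rw [h]; rfl
      _ ≤ T.mulVec (c • w) i := mulVec_mono hT hc i
      _ = c * T.mulVec w i := by rw [Matrix.mulVec_smul]; rfl
      _ < c * w i := mul_lt_mul_of_pos_left (hTw i) hc0
      _ = u i := hi.symm
  have := hu i
  by_contra hr
  nlinarith

lemma exists_forall_le_mul_pow [Nonempty ι] {T : Matrix ι ι ℝ} (hT : ∀ i j, 0 ≤ T i j) {r : ℝ}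
    {u : ι → ℝ} (hu : ∀ i, 0 < u i) (h : T.mulVec u = r • u) {v : ℕ → ι → ℝ}
    (hv : ∀ t i, v (t + 1) i ≤ T.mulVec (v t) i) (i : ι) :
    ∃ C : ℝ, ∀ t, v t i ≤ C * r ^ t := by
  obtain ⟨c, hc, -⟩ := exists_forall_le_mul hu (v 0)
  have key : ∀ t i, v t i ≤ c * r ^ t * u i := by
    intro t
    induction t with
    | zero => simpa using hc
    | succ t ih =>
      intro i
      refine (hv t i).trans ((mulVec_mono hT (v := (c * r ^ t) • u) ih i).trans (le_of_eq ?_))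
      rw [Matrix.mulVec_smul, h]
      simp only [Pi.smul_apply, smul_eq_mul]
      ring
  exact ⟨c * u i, fun t => (key t i).trans (le_of_eq (by ring))⟩

lemma supConvergesLinearly_of_le {a : ℕ → ℝ} {C r : ℝ} (ha : ∀ t, 0 ≤ a t) (hr0 : 0 ≤ r)
    (hr1 : r < 1) (h : ∀ t, a t ≤ C * r ^ t) : SupConvergesLinearly a r := by
  have hC : 0 ≤ C := by simpa using (ha 0).trans (h 0)
  have hsup : ∀ t : ℕ, (⨆ l : Set.Ici t, a l) ≤ C * r ^ t := fun t =>
    ciSup_le fun l => (h l).trans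
      (mul_le_mul_of_nonneg_left (pow_le_pow_of_le_one hr0 hr1.le l.2) hC)
  have hnn : ∀ t : ℕ, 0 ≤ ⨆ l : Set.Ici t, a l := fun t => Real.iSup_nonneg fun l => ha l
  refine ⟨⟨C, ?_⟩, ?_, C, fun t => ?_⟩
  · rintro _ ⟨t, rfl⟩
    exact (h t).trans (mul_le_of_le_one_right hC (pow_le_one₀ hr0 hr1.le))
  · refine squeeze_zero hnn hsup ?_
    simpa using (tendsto_pow_atTop_nhds_zero_of_lt_one hr0 hr1).const_mul C
  · rw [abs_of_nonneg (hnn t)]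
    exact hsup t

end PositiveMatrix

/-! ### A monotone companion of a compatible norm -/

section MonotoneNorm

variable {ι : Type} [Fintype ι]

lemma abs_mulVec_le (M : Matrix ι ι ℝ) (v : ι → ℝ) (p : ι) :
    |M.mulVec v p| ≤ (Matrix.of fun i j => |M i j|).mulVec (fun j => |v j|) p :=
  (Finset.abs_sum_le_sum_abs _ _).trans
    (le_of_eq (Finset.sum_congr rfl fun j _ => by simp [abs_mul]))

variable [DecidableEq ι]

/-- The norm `ν.vec` need not be monotone, and `M` may have negative entries, so that a bound on
`ν.mat |M|` says nothing on `ν.mat M`. Nevertheless there is a gauge `W`, with the same equivalence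
constants, that `M` contracts by the factor `ν.mat |M|`: namely
`W v = Clow * sup_t (ν.mat |M|)⁻ᵗ ‖|M|ᵗ |v|‖₂`. -/
lemma exists_monotone_gauge (ν : CompatibleNorms ι) {M Q : Matrix ι ι ℝ}
    (hMQ : ∀ i j, |M i j| = Q i j) {Clow Cup : ℝ} (hlow : 0 < Clow)
    (hν : ∀ v, Clow * norm2 v ≤ ν.vec v ∧ ν.vec v ≤ Cup * norm2 v) :
    ∃ W : (ι → ℝ) → ℝ, (∀ v, Clow * norm2 v ≤ W v) ∧ (∀ v, W v ≤ Cup * norm2 v) ∧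
      (∀ v w, W (v + w) ≤ W v + W w) ∧ ∀ v, W (M.mulVec v) ≤ ν.mat Q * W v := by
  set σ := ν.mat Q with hσ
  have hσ0 : 0 ≤ σ := apply_nonneg _ _
  have hQ : ∀ i j, 0 ≤ Q i j := fun i j => by rw [← hMQ]; exact abs_nonneg _
  have hQt : ∀ (t : ℕ) i j, 0 ≤ (Q ^ t) i j := by
    intro t
    induction t with
    | zero => intro i j; rw [pow_zero, Matrix.one_apply]; split_ifs <;> simp
    | succ t ih =>
      intro i j
      rw [pow_succ, Matrix.mul_apply]
      exact Finset.sum_nonneg fun k _ => mul_nonneg (ih i k) (hQ k j)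
  have hQv : ∀ (t : ℕ) (v : ι → ℝ), (∀ i, 0 ≤ v i) → ∀ i, 0 ≤ (Q ^ t).mulVec v i := fun t v hv i =>
    Finset.sum_nonneg fun k _ => mul_nonneg (hQt t i k) (hv k)
  have hmono : ∀ (t : ℕ) (v w : ι → ℝ), (∀ i, 0 ≤ v i) → (∀ i, v i ≤ w i) →
      norm2 ((Q ^ t).mulVec v) ≤ norm2 ((Q ^ t).mulVec w) := by
    intro t v w hv hvw
    refine norm2_mono fun i => ?_
    rw [abs_of_nonneg (hQv t v hv i), abs_of_nonneg (hQv t w (fun i => (hv i).trans (hvw i)) i)]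
    exact mulVec_mono (hQt t) hvw i
  have hpow : ∀ (t : ℕ) (v : ι → ℝ), ν.vec ((Q ^ t).mulVec v) ≤ σ ^ t * ν.vec v := by
    intro t v
    induction t with
    | zero => simp
    | succ t ih =>
      rw [pow_succ', ← Matrix.mulVec_mulVec, pow_succ', mul_assoc]
      exact (ν.compatible _ _).trans (mul_le_mul_of_nonneg_left ih hσ0)
  set a : (ι → ℝ) → ℕ → ℝ := fun v t => σ⁻¹ ^ t * norm2 ((Q ^ t).mulVec fun i => |v i|) with ha
  have ha_le : ∀ v t, Clow * a v t ≤ Cup * norm2 v := by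
    intro v t
    have h1 : Clow * norm2 ((Q ^ t).mulVec fun i => |v i|) ≤ σ ^ t * (Cup * norm2 v) := by
      refine (hν _).1.trans ((hpow t _).trans (mul_le_mul_of_nonneg_left ?_ (pow_nonneg hσ0 t)))
      rw [← norm2_abs v]
      exact (hν _).2
    have h0 : 0 ≤ Cup * norm2 v :=
      (mul_nonneg hlow.le (norm2_nonneg v)).trans ((hν v).1.trans (hν v).2)
    calc Clow * a v t = σ⁻¹ ^ t * (Clow * norm2 ((Q ^ t).mulVec fun i => |v i|)) := by
          simp only [ha]; ring
      _ ≤ σ⁻¹ ^ t * (σ ^ t * (Cup * norm2 v)) :=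
          mul_le_mul_of_nonneg_left h1 (pow_nonneg (inv_nonneg.2 hσ0) t)
      _ = (σ⁻¹ * σ) ^ t * (Cup * norm2 v) := by rw [mul_pow]; ring
      _ ≤ 1 * (Cup * norm2 v) := by
          refine mul_le_mul_of_nonneg_right (pow_le_one₀ ?_ ?_) h0
          · positivity
          · by_cases h : σ = 0 <;> simp [h]
      _ = Cup * norm2 v := one_mul _
  have hbdd : ∀ v, BddAbove (Set.range (a v)) := by
    intro v
    refine ⟨Cup * norm2 v / Clow, ?_⟩
    rintro _ ⟨t, rfl⟩
    rw [le_div_iff₀ hlow, mul_comm]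
    exact ha_le v t
  refine ⟨fun v => Clow * ⨆ t, a v t, fun v => ?_, fun v => ?_, fun v w => ?_, fun v => ?_⟩
  · refine mul_le_mul_of_nonneg_left (le_trans (le_of_eq ?_) (le_ciSup (hbdd v) 0)) hlow.le
    simp [ha, norm2_abs]
  · dsimp only
    rw [Real.mul_iSup_of_nonneg hlow.le]
    exact ciSup_le fun t => ha_le v t
  · rw [← mul_add]
    refine mul_le_mul_of_nonneg_left (ciSup_le fun t => ?_) hlow.le
    refine le_trans ?_ (add_le_add (le_ciSup (hbdd v) t) (le_ciSup (hbdd w) t))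
    simp only [ha]
    rw [← mul_add]
    refine mul_le_mul_of_nonneg_left ?_ (pow_nonneg (inv_nonneg.2 hσ0) t)
    refine (hmono t _ ((fun i => |v i|) + fun i => |w i|) (fun i => abs_nonneg _)
      fun i => abs_add_le _ _).trans ?_
    rw [Matrix.mulVec_add]
    exact norm2_add_le _ _
  · rw [mul_left_comm]
    refine mul_le_mul_of_nonneg_left (ciSup_le fun t => ?_) hlow.le
    have h1 : norm2 ((Q ^ t).mulVec fun i => |M.mulVec v i|) ≤
        norm2 ((Q ^ (t + 1)).mulVec fun i => |v i|) := by
      rw [pow_succ, ← Matrix.mulVec_mulVec]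
      refine hmono t _ _ (fun i => abs_nonneg _) fun i => ?_
      have hM : (Matrix.of fun i j => |M i j|) = Q := by ext i j; exact hMQ i j
      rw [← hM]
      exact abs_mulVec_le M v i
    by_cases h0 : σ = 0
    · have hQ0 : Q = 0 := ν.mat_definite _ h0
      rw [pow_succ, hQ0, mul_zero, Matrix.zero_mulVec] at h1
      have h2 : norm2 ((Q ^ t).mulVec fun i => |M.mulVec v i|) = 0 :=
        le_antisymm (by simpa [norm2, hQ0] using h1) (norm2_nonneg _)
      simp [ha, h0, h2]
    · calc a (M.mulVec v) t ≤ σ⁻¹ ^ t * norm2 ((Q ^ (t + 1)).mulVec fun i => |v i|) :=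
            mul_le_mul_of_nonneg_left h1 (pow_nonneg (inv_nonneg.2 hσ0) t)
        _ = σ * a v (t + 1) := by
            simp only [ha]
            rw [pow_succ σ⁻¹]
            field_simp
        _ ≤ σ * ⨆ t, a v t := mul_le_mul_of_nonneg_left (le_ciSup (hbdd v) (t + 1)) hσ0

end MonotoneNorm

/-! ### A common contracting norm for the estimation matrices -/

section CommonNorm

variable {ι : Type} [Fintype ι]

/-- A vector norm that dominates the sup norm, together with its operator norm. -/
lemma exists_compatibleNorms_of_seminorm (V : Seminorm ℝ (ι → ℝ)) (hV : ∀ v, ‖v‖ ≤ V v) :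
    ∃ ν : CompatibleNorms ι, ∀ (M : Matrix ι ι ℝ) (θ : ℝ), 0 ≤ θ →
      (∀ v, V (M.mulVec v) ≤ θ * V v) → ν.mat M ≤ θ := by
  classical
  have hdef : ∀ v, V v = 0 → v = 0 := fun v h =>
    norm_eq_zero.1 (le_antisymm ((hV v).trans h.le) (norm_nonneg _))
  have hcol : ∀ (M : Matrix ι ι ℝ) v, V (M.mulVec v) ≤ (∑ j, V (M.mulVec (Pi.single j 1))) * V v := by
    intro M v
    have hv : M.mulVec v = ∑ j, v j • M.mulVec (Pi.single j 1) := by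
      ext i
      simp [Matrix.mulVec, dotProduct, Finset.sum_apply, mul_comm]
    rw [hv, Finset.sum_mul]
    refine (Finset.le_sum_of_subadditive V (map_zero V).le (map_add_le_add V) _ _).trans
      (Finset.sum_le_sum fun j _ => ?_)
    rw [map_smul_eq_mul, mul_comm]
    exact mul_le_mul_of_nonneg_left ((norm_le_pi_norm v j).trans (hV v)) (apply_nonneg _ _)
  set m : Matrix ι ι ℝ → ℝ := fun M => ⨆ v, V (M.mulVec v) / V v with hm
  have hbdd : ∀ M : Matrix ι ι ℝ, BddAbove (Set.range fun v => V (M.mulVec v) / V v) := by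
    intro M
    refine ⟨∑ j, V (M.mulVec (Pi.single j 1)), ?_⟩
    rintro _ ⟨v, rfl⟩
    exact div_le_of_le_mul₀ (apply_nonneg _ _) (Finset.sum_nonneg fun _ _ => apply_nonneg _ _)
      (hcol M v)
  have hcomp : ∀ M v, V (M.mulVec v) ≤ m M * V v := by
    intro M v
    by_cases h0 : V v = 0
    · rw [hdef v h0]; simp
    · have h1 : V (M.mulVec v) / V v ≤ m M := le_ciSup (hbdd M) v
      exact (div_le_iff₀ (lt_of_le_of_ne (apply_nonneg _ _) (Ne.symm h0))).1 h1
  have hle : ∀ (M : Matrix ι ι ℝ) (θ : ℝ), 0 ≤ θ → (∀ v, V (M.mulVec v) ≤ θ * V v) → m M ≤ θ :=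
    fun M θ hθ h => ciSup_le fun v => div_le_of_le_mul₀ (apply_nonneg _ _) hθ (h v)
  have hm0 : ∀ M, 0 ≤ m M := fun M => Real.iSup_nonneg fun v =>
    div_nonneg (apply_nonneg _ _) (apply_nonneg _ _)
  refine ⟨⟨V, Seminorm.of m ?_ ?_, hdef, ?_, ?_, hcomp⟩, hle⟩
  · intro M M'
    refine hle _ _ (add_nonneg (hm0 _) (hm0 _)) fun v => ?_
    rw [Matrix.add_mulVec, add_mul]
    exact (map_add_le_add V _ _).trans (add_le_add (hcomp _ _) (hcomp _ _))
  · intro r M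
    simp only [hm]
    rw [Real.mul_iSup_of_nonneg (norm_nonneg r)]
    refine iSup_congr fun v => ?_
    rw [Matrix.smul_mulVec, map_smul_eq_mul, mul_div_assoc]
  · intro M h
    have h0 : ∀ v, M.mulVec v = 0 := by
      intro v
      refine hdef _ (le_antisymm ((hcomp M v).trans (le_of_eq ?_)) (apply_nonneg _ _))
      have : m M = 0 := h
      rw [this, zero_mul]
    ext i j
    have := congrFun (h0 (Pi.single j 1)) i
    simpa using this
  · intro M M'
    refine hle _ _ (mul_nonneg (hm0 _) (hm0 _)) fun v => ?_
    rw [← Matrix.mulVec_mulVec, mul_assoc]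
    exact (hcomp _ _).trans (mul_le_mul_of_nonneg_left (hcomp _ _) (hm0 _))

/-- `wordNorm Q k v` is the largest sup norm of `Q_{q_k} ⋯ Q_{q_1} v` over all words of
length `k`. -/
noncomputable def wordNorm (Q : ι → Matrix ι ι ℝ) : ℕ → Seminorm ℝ (ι → ℝ)
  | 0 => normSeminorm ℝ (ι → ℝ)
  | k + 1 => Finset.univ.sup fun q => (wordNorm Q k).comp (Q q).mulVecLin

lemma wordNorm_mulVec_le (Q : ι → Matrix ι ι ℝ) (k : ℕ) (q : ι) (v : ι → ℝ) :
    wordNorm Q k ((Q q).mulVec v) ≤ wordNorm Q (k + 1) v :=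
  Seminorm.le_finset_sup_apply (p := fun q => (wordNorm Q k).comp (Q q).mulVecLin)
    (Finset.mem_univ q)

lemma wordNorm_mono {Q : ι → Matrix ι ι ℝ} (hQ : ∀ q p m, 0 ≤ Q q p m) (k : ℕ) {u v : ι → ℝ}
    (h : ∀ i, |v i| ≤ u i) : wordNorm Q k v ≤ wordNorm Q k u := by
  induction k generalizing u v with
  | zero =>
    refine (pi_norm_le_iff_of_nonneg (norm_nonneg u)).2 fun i => ?_
    exact (h i).trans ((le_abs_self _).trans (norm_le_pi_norm u i))
  | succ k ih =>
    refine Seminorm.finset_sup_apply_le (apply_nonneg _ _) fun q _ => ?_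
    refine le_trans (ih fun i => ?_) (wordNorm_mulVec_le Q k q u)
    refine (Finset.abs_sum_le_sum_abs _ _).trans (Finset.sum_le_sum fun j _ => ?_)
    rw [abs_mul, abs_of_nonneg (hQ q i j)]
    exact mul_le_mul_of_nonneg_left (h j) (hQ q i j)

/-- If the deficient set `{p | u p < 1}` of a vector `0 ≤ u ≤ 1` misses at most `k` indices, then
every word of length `k` brings `u` strictly below one: each factor preserves deficiency and spreads
it to at least one new index, by strong connectivity. -/
lemma wordNorm_lt_one [Nonempty ι] {G : Digraph ι} (hG : StronglyConnected G)
    {Q : ι → Matrix ι ι ℝ} (hQ : ∀ q p m, 0 ≤ Q q p m)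
    (hsum : ∀ q p, ∑ m, Q q p m ≤ 1) (hedge : ∀ q p m, p ≠ m → G.Adj m p → 0 < Q q p m)
    (hdiag : ∀ q p, 0 < Q q p p ∨ ∑ m, Q q p m < 1) (hself : ∀ q, ∑ m, Q q q m < 1)
    (k : ℕ) {u : ι → ℝ} (hu0 : ∀ i, 0 ≤ u i) (hu1 : ∀ i, u i ≤ 1)
    (hk : Fintype.card ι ≤ (Finset.univ.filter fun p => u p < 1).card + k) :
    wordNorm Q k u < 1 := by
  classical
  induction k generalizing u with
  | zero =>
    have hall : (Finset.univ.filter fun p => u p < 1) = Finset.univ := by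
      refine (Finset.card_eq_iff_eq_univ _).1 (le_antisymm (Finset.card_le_univ _) (by simpa using hk))
    refine (pi_norm_lt_iff one_pos).2 fun i => ?_
    have : i ∈ Finset.univ.filter fun p => u p < 1 := by rw [hall]; exact Finset.mem_univ _
    rw [Real.norm_of_nonneg (hu0 i)]
    simpa using this
  | succ k ih =>
    refine Seminorm.finset_sup_apply_lt one_pos fun q _ => ih (u := (Q q).mulVec u) ?_ ?_ ?_
    · exact fun i => Finset.sum_nonneg fun j _ => mul_nonneg (hQ q i j) (hu0 j)
    · intro i
      refine le_trans (Finset.sum_le_sum fun j _ => ?_) (hsum q i)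
      exact mul_le_of_le_one_right (hQ q i j) (hu1 j)
    · have hrow : ∀ p, ∑ m, Q q p m < 1 → (Q q).mulVec u p < 1 := fun p hp =>
        lt_of_le_of_lt (Finset.sum_le_sum fun j _ => mul_le_of_le_one_right (hQ q p j) (hu1 j)) hp
      have hlt : ∀ p m, 0 < Q q p m → u m < 1 → (Q q).mulVec u p < 1 := by
        intro p m h1 h2
        refine lt_of_lt_of_le (Finset.sum_lt_sum (fun j _ =>
          mul_le_of_le_one_right (hQ q p j) (hu1 j)) ⟨m, Finset.mem_univ _, ?_⟩) (hsum q p)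
        exact mul_lt_of_lt_one_right h1 h2
      have hsub : (Finset.univ.filter fun p => u p < 1) ⊆
          Finset.univ.filter fun p => (Q q).mulVec u p < 1 := by
        intro p hp
        simp only [Finset.mem_filter, Finset.mem_univ, true_and] at hp ⊢
        rcases hdiag q p with h | h
        · exact hlt p p h hp
        · exact hrow p h
      by_cases hall : ∀ p, u p < 1
      · have : (Finset.univ.filter fun p => (Q q).mulVec u p < 1) = Finset.univ := by
          refine Finset.eq_univ_of_forall fun p => hsub ?_
          simpa using hall p
        rw [this, Finset.card_univ]
        omega
      · push Not at hall
        obtain ⟨p0, hp0⟩ := hall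
        -- some index outside the deficient set becomes deficient
        have hnew : ∃ p, ¬ u p < 1 ∧ (Q q).mulVec u p < 1 := by
          by_cases hne : ∃ m, u m < 1
          · obtain ⟨m, hm⟩ := hne
            by_contra hcon
            push Not at hcon
            have : ∀ p, u p < 1 := by
              intro p
              induction hG m p with
              | refl => exact hm
              | @tail a b _ hab iha =>
                by_contra hb
                have hab' : b ≠ a := by rintro rfl; exact hb iha
                exact absurd (hlt b a (hedge q b a hab' hab) iha)
                  (not_lt.2 (hcon b (not_lt.1 hb)))
            exact absurd (this p0) (not_lt.2 hp0)
          · push Not at hne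
            exact ⟨q, not_lt.2 (hne q), hrow q (hself q)⟩
        obtain ⟨p, hp, hp'⟩ := hnew
        have : (Finset.univ.filter fun p => u p < 1).card <
            (Finset.univ.filter fun p => (Q q).mulVec u p < 1).card := by
          refine Finset.card_lt_card ((Finset.ssubset_iff_of_subset hsub).2 ⟨p, ?_, ?_⟩)
          · simpa using hp'
          · simpa using hp
        omega

lemma exists_compatibleNorms_lt_one [Nonempty ι] {G : Digraph ι} (hG : StronglyConnected G)
    {Q : ι → Matrix ι ι ℝ} (hQ : ∀ q p m, 0 ≤ Q q p m)
    (hsum : ∀ q p, ∑ m, Q q p m ≤ 1) (hedge : ∀ q p m, p ≠ m → G.Adj m p → 0 < Q q p m)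
    (hdiag : ∀ q p, 0 < Q q p p ∨ ∑ m, Q q p m < 1) (hself : ∀ q, ∑ m, Q q q m < 1) :
    ∃ ν : CompatibleNorms ι, ∀ q, ν.mat (Q q) < 1 := by
  set n := Fintype.card ι with hn
  have hn0 : n ≠ 0 := Fintype.card_ne_zero
  have hlt : wordNorm Q n (fun _ => 1) < 1 :=
    wordNorm_lt_one hG hQ hsum hedge hdiag hself n (fun _ => zero_le_one) (fun _ => le_rfl)
      (by omega)
  set β := max (wordNorm Q n (fun _ => 1)) (1 / 2) with hβ
  have hβ0 : 0 < β := lt_of_lt_of_le (by norm_num) (le_max_right _ _)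
  have hβ1 : β < 1 := max_lt hlt (by norm_num)
  set θ := β ^ ((n : ℝ)⁻¹) with hθ
  have hθ0 : 0 < θ := Real.rpow_pos_of_pos hβ0 _
  have hθn : θ ^ n = β := Real.rpow_inv_natCast_pow hβ0.le hn0
  have hθ1 : θ < 1 := Real.rpow_lt_one hβ0.le hβ1 (by positivity)
  have hN : ∀ v, wordNorm Q n v ≤ θ ^ n * wordNorm Q 0 v := by
    intro v
    have h1 : wordNorm Q n v ≤ wordNorm Q n (‖v‖ • fun _ => (1 : ℝ)) :=
      wordNorm_mono hQ n fun i => by simpa using norm_le_pi_norm v i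
    rw [map_smul_eq_mul, norm_norm] at h1
    calc wordNorm Q n v ≤ ‖v‖ * β := h1.trans
          (mul_le_mul_of_nonneg_left (le_max_left _ _) (norm_nonneg _))
      _ = θ ^ n * wordNorm Q 0 v := by rw [hθn, mul_comm]; rfl
  -- the weights `θ⁻ᵏ` make the sum over word lengths below `n` contract by the factor `θ`
  set V : Seminorm ℝ (ι → ℝ) := Seminorm.of
    (fun v => ∑ k ∈ Finset.range n, θ⁻¹ ^ k * wordNorm Q k v)
    (fun v w => by
      rw [← Finset.sum_add_distrib]
      refine Finset.sum_le_sum fun k _ => ?_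
      rw [← mul_add]
      exact mul_le_mul_of_nonneg_left (map_add_le_add _ _ _) (by positivity))
    (fun r v => by
      rw [Finset.mul_sum]
      refine Finset.sum_congr rfl fun k _ => ?_
      rw [map_smul_eq_mul]
      ring) with hVdef
  have hV : ∀ v, V v = ∑ k ∈ Finset.range n, θ⁻¹ ^ k * wordNorm Q k v := fun v => rfl
  have hVnorm : ∀ v, ‖v‖ ≤ V v := by
    intro v
    rw [hV]
    have := Finset.single_le_sum (f := fun k => θ⁻¹ ^ k * wordNorm Q k v)
      (fun k _ => mul_nonneg (by positivity) (apply_nonneg _ _))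
      (Finset.mem_range.2 (Nat.pos_of_ne_zero hn0))
    rw [pow_zero, one_mul] at this
    exact this
  obtain ⟨ν, hν⟩ := exists_compatibleNorms_of_seminorm V hVnorm
  refine ⟨ν, fun q => lt_of_le_of_lt (hν (Q q) θ hθ0.le fun v => ?_) hθ1⟩
  rw [hV, hV]
  calc ∑ k ∈ Finset.range n, θ⁻¹ ^ k * wordNorm Q k ((Q q).mulVec v)
      ≤ ∑ k ∈ Finset.range n, θ⁻¹ ^ k * wordNorm Q (k + 1) v :=
        Finset.sum_le_sum fun k _ => mul_le_mul_of_nonneg_left (wordNorm_mulVec_le Q k q v)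
          (by positivity)
    _ = θ * ∑ k ∈ Finset.range n, θ⁻¹ ^ (k + 1) * wordNorm Q (k + 1) v := by
        rw [Finset.mul_sum]
        refine Finset.sum_congr rfl fun k _ => ?_
        rw [pow_succ]
        field_simp
    _ ≤ θ * ∑ k ∈ Finset.range n, θ⁻¹ ^ k * wordNorm Q k v := by
        refine mul_le_mul_of_nonneg_left ?_ hθ0.le
        have h1 := Finset.sum_range_succ (fun k => θ⁻¹ ^ k * wordNorm Q k v) n
        have h2 := Finset.sum_range_succ' (fun k => θ⁻¹ ^ k * wordNorm Q k v) n
        have h3 : θ⁻¹ ^ n * wordNorm Q n v ≤ θ⁻¹ ^ 0 * wordNorm Q 0 v := by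
          rw [pow_zero, one_mul, inv_pow, inv_mul_le_iff₀ (by positivity)]
          exact hN v
        linarith

end CommonNorm

section EstMatrix

variable {N : ℕ} {n : Fin N → ℕ}

/-- The matrix of the estimation dynamics for the decision of agent `q`. -/
def estDynamics (Abar : Matrix (Agent n) (Agent n) ℝ) (δ : Agent n → ℝ) (q : Agent n) :
    Matrix (Agent n) (Agent n) ℝ :=
  fun p m => if p = m then Abar p p - δ p * Abar p q else Abar p m

lemma abs_estDynamics {Gbar : Digraph (Agent n)} {Abar : Matrix (Agent n) (Agent n) ℝ}
    (hAbar : IsAdjacencyMatrix Gbar Abar) (δ : Agent n → ℝ) (q p m : Agent n) :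
    |estDynamics Abar δ q p m| = estMatrix Abar δ q p m := by
  unfold estDynamics estMatrix
  split_ifs
  · rfl
  · exact abs_of_nonneg (hAbar.nonneg p m)

lemma estDynamics_mulVec (Abar : Matrix (Agent n) (Agent n) ℝ) (δ : Agent n → ℝ) (q : Agent n)
    (v : Agent n → ℝ) (p : Agent n) :
    (estDynamics Abar δ q).mulVec v p = ∑ l, Abar p l * v l - δ p * Abar p q * v p := by
  have : ∀ m, estDynamics Abar δ q p m * v m =
      Abar p m * v m - if m = p then δ p * Abar p q * v p else 0 := by
    intro m
    unfold estDynamics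
    by_cases h : p = m
    · subst h; simp; ring
    · simp [h, Ne.symm h]
  simp only [Matrix.mulVec, dotProduct, this, Finset.sum_sub_distrib]
  simp

lemma sum_estMatrix {Abar : Matrix (Agent n) (Agent n) ℝ} (hrow : ∀ p, ∑ q, Abar p q = 1)
    (δ : Agent n → ℝ) (q p : Agent n) :
    ∑ m, estMatrix Abar δ q p m = 1 - Abar p p + |Abar p p - δ p * Abar p q| := by
  have : ∀ m, estMatrix Abar δ q p m =
      Abar p m + if m = p then |Abar p p - δ p * Abar p q| - Abar p p else 0 := by
    intro m
    unfold estMatrix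
    by_cases h : p = m
    · subst h; simp
    · simp [h, Ne.symm h]
  simp only [this, Finset.sum_add_distrib, hrow]
  simp
  ring

lemma exists_compatibleNorms_estMatrix [Nonempty (Agent n)] {Gbar : Digraph (Agent n)}
    {Abar : Matrix (Agent n) (Agent n) ℝ} (hAbar : IsAdjacencyMatrix Gbar Abar)
    (hGbar : StronglyConnected Gbar) (hrow : ∀ p, ∑ q, Abar p q = 1) {δ : Agent n → ℝ}
    (hδ : ∀ p, 0 < δ p) (hδ' : ∀ p q, δ p * Abar p q < 2 * Abar p p) :
    ∃ ν : CompatibleNorms (Agent n), ∀ q, ν.mat (estMatrix Abar δ q) < 1 := by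
  have hnn : ∀ p q, 0 ≤ δ p * Abar p q := fun p q => mul_nonneg (hδ p).le (hAbar.nonneg p q)
  have habs : ∀ p q, |Abar p p - δ p * Abar p q| ≤ Abar p p := fun p q =>
    abs_le.2 ⟨by linarith [hδ' p q], by linarith [hnn p q]⟩
  have habs' : ∀ p q, 0 < Abar p q → |Abar p p - δ p * Abar p q| < Abar p p := fun p q h =>
    abs_lt.2 ⟨by linarith [hδ' p q], by linarith [mul_pos (hδ p) h]⟩
  refine exists_compatibleNorms_lt_one hGbar ?_ ?_ ?_ ?_ ?_
  · intro q p m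
    rw [← abs_estDynamics hAbar]
    exact abs_nonneg _
  · intro q p
    rw [sum_estMatrix hrow]
    linarith [habs p q]
  · intro q p m hpm h
    simp only [estMatrix, if_neg hpm]
    exact hAbar.pos p m h
  · intro q p
    rw [sum_estMatrix hrow]
    rcases (hAbar.nonneg p q).eq_or_lt with h | h
    · left
      simp [estMatrix, ← h, (hAbar.diag_pos p).ne']
    · right
      linarith [habs' p q h]
  · intro q
    rw [sum_estMatrix hrow]
    linarith [habs' q q (hAbar.diag_pos q)]

end EstMatrix

/-! ### The game mapping and the Nash equilibrium -/

section Game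

variable {N : ℕ} {n : Fin N → ℕ} {J : (i : Fin N) → Fin (n i) → Profile n → ℝ} {L χ : ℝ}

/-- The profile whose flattening is `v`. -/
def unflat (v : Agent n → ℝ) : Profile n := fun i j => v ⟨i, j⟩

@[simp] lemma flat_unflat (v : Agent n → ℝ) : flat (unflat v) = v := rfl

lemma RegularCosts.hasFDerivAt_update (hJ : RegularCosts J L) (i : Fin N) (j : Fin (n i))
    (x : Profile n) : HasFDerivAt (fun z : Fin (n i) → ℝ => J i j (Function.update x i z))
      (fderiv ℝ (fun z : Fin (n i) → ℝ => J i j (Function.update x i z)) (x i)) (x i) :=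
  ((hJ.contDiff i j x).differentiable one_ne_zero).differentiableAt.hasFDerivAt

lemma partialGrad_eq {f : Profile n → ℝ} {i : Fin N} {x : Profile n}
    {f' : (Fin (n i) → ℝ) →L[ℝ] ℝ}
    (h : HasFDerivAt (fun z : Fin (n i) → ℝ => f (Function.update x i z)) f' (x i))
    (k : Fin (n i)) : partialGrad i k f x = f' (Pi.single k 1) := by
  have h1 := hasDerivAt_update (𝕜 := ℝ) (x i) k (x i k)
  have h' : HasFDerivAt (fun z : Fin (n i) → ℝ => f (Function.update x i z)) f'
      (Function.update (x i) k (x i k)) := by rwa [Function.update_eq_self]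
  exact (h'.comp_hasDerivAt _ h1).deriv

lemma hasFDerivAt_clusterCost (hJ : RegularCosts J L) (i : Fin N) (x : Profile n) :
    HasFDerivAt (fun z : Fin (n i) → ℝ => clusterCost J i (Function.update x i z))
      ((1 / (n i : ℝ)) • ∑ j, fderiv ℝ (fun z : Fin (n i) → ℝ => J i j (Function.update x i z))
        (x i)) (x i) :=
  (HasFDerivAt.fun_sum fun j _ => hJ.hasFDerivAt_update i j x).const_mul _

lemma gameMap_eq (hJ : RegularCosts J L) (x : Profile n) (i : Fin N) (k : Fin (n i)) :
    gameMap J x i k = (1 / (n i : ℝ)) * ∑ j, partialGrad i k (J i j) x := by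
  unfold gameMap
  rw [partialGrad_eq (hasFDerivAt_clusterCost hJ i x)]
  simp only [smul_apply, sum_apply, smul_eq_mul]
  congr 1
  exact Finset.sum_congr rfl fun j _ => (partialGrad_eq (hJ.hasFDerivAt_update i j x) k).symm

lemma convexOn_clusterCost (hJ : RegularCosts J L) (i : Fin N) (x : Profile n) :
    ConvexOn ℝ Set.univ (fun z : Fin (n i) → ℝ => clusterCost J i (Function.update x i z)) := by
  have : ∀ s : Finset (Fin (n i)), ConvexOn ℝ Set.univ
      (fun z : Fin (n i) → ℝ => ∑ j ∈ s, J i j (Function.update x i z)) := by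
    classical
    intro s
    induction s using Finset.induction_on with
    | empty => simpa using convexOn_const (0 : ℝ) convex_univ
    | insert a s ha ih =>
      simp only [Finset.sum_insert ha]
      exact (hJ.convex i a x).add ih
  exact (this Finset.univ).smul (by positivity)

/-- A convex function has a global minimum at a point where its derivative vanishes. -/
lemma le_of_convexOn_of_hasFDerivAt_zero {E : Type*} [NormedAddCommGroup E] [NormedSpace ℝ E]
    {f : E → ℝ} (hf : ConvexOn ℝ Set.univ f) {a : E} (h : HasFDerivAt f (0 : E →L[ℝ] ℝ) a) (z : E) :
    f a ≤ f z := by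
  have hl : HasDerivAt (fun s : ℝ => AffineMap.lineMap a z s) (z - a) (0 : ℝ) := by
    simpa using AffineMap.hasDerivAt_lineMap (a := a) (b := z) (x := (0 : ℝ))
  have h' : HasFDerivAt f (0 : E →L[ℝ] ℝ) (AffineMap.lineMap a z (0 : ℝ)) := by simpa using h
  have hd : HasDerivAt (fun s : ℝ => f (AffineMap.lineMap a z s)) 0 0 := by
    have h2 := h'.comp_hasDerivAt (0 : ℝ) hl
    rwa [zero_apply] at h2
  have hc : ConvexOn ℝ Set.univ (fun s : ℝ => f (AffineMap.lineMap a z s)) := by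
    exact hf.comp_affineMap (AffineMap.lineMap (k := ℝ) a z)
  have := hc.le_slope_of_hasDerivAt (Set.mem_univ 0) (Set.mem_univ 1) one_pos hd
  simpa [slope_def_field] using this

lemma isNash_iff (hJ : RegularCosts J L) (x : Profile n) : IsNash J x ↔ gameMap J x = 0 := by
  constructor
  · intro h
    ext i k
    refine IsLocalMin.deriv_eq_zero (Eventually.of_forall fun s => ?_)
    have := h i (Function.update (x i) k s)
    simpa using this
  · intro h i z
    have h0 : ((1 / (n i : ℝ)) • ∑ j, fderiv ℝ
        (fun z : Fin (n i) → ℝ => J i j (Function.update x i z)) (x i)) = 0 := by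
      refine ContinuousLinearMap.coe_injective (LinearMap.pi_ext' fun k => LinearMap.ext_ring ?_)
      have h1 := congrFun (congrFun h i) k
      unfold gameMap at h1
      rw [partialGrad_eq (hasFDerivAt_clusterCost hJ i x)] at h1
      simpa using h1
    have h1 := hasFDerivAt_clusterCost hJ i x
    rw [h0] at h1
    have := le_of_convexOn_of_hasFDerivAt_zero (convexOn_clusterCost hJ i x) h1 z
    simpa using this

lemma gameMap_lipschitz (hn : ∀ i, 0 < n i) (hJ : RegularCosts J L) (x x' : Profile n)
    (i : Fin N) (k : Fin (n i)) :
    |gameMap J x i k - gameMap J x' i k| ≤ L * norm2 (flat x - flat x') := by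
  have hni : (0 : ℝ) < n i := by exact_mod_cast hn i
  rw [gameMap_eq hJ, gameMap_eq hJ, ← mul_sub, ← Finset.sum_sub_distrib, abs_mul,
    abs_of_pos (by positivity), one_div, inv_mul_le_iff₀ hni]
  refine (Finset.abs_sum_le_sum_abs _ _).trans
    ((Finset.sum_le_sum fun j _ => hJ.lipschitz i j k x x').trans ?_)
  simp

lemma StronglyMonotone.lipschitz_pos [Nonempty (Agent n)] (hn : ∀ i, 0 < n i)
    (hJ : RegularCosts J L) (hχ : 0 < χ) (hF : StronglyMonotone J χ) : 0 < L := by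
  by_contra hL
  push Not at hL
  have h := hF (unflat fun _ => 1) (unflat fun _ => 0)
  have hz : ∀ i k, gameMap J (unflat fun _ => 1) i k - gameMap J (unflat fun _ => 0) i k = 0 := by
    intro i k
    refine abs_nonpos_iff.1 ((gameMap_lipschitz hn hJ _ _ i k).trans ?_)
    exact mul_nonpos_of_nonpos_of_nonneg hL (norm2_nonneg _)
  simp only [hz, zero_mul, Finset.sum_const_zero, norm2_sq, flat_unflat, Pi.sub_apply] at h
  have hcard : (0 : ℝ) < Fintype.card (Agent n) := by exact_mod_cast Fintype.card_pos
  simp only [sub_zero, one_pow, Finset.sum_const, Finset.card_univ, nsmul_eq_mul, mul_one] at h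
  nlinarith

/-- The zero of the game mapping is the fixed point of the contraction `x ↦ x - a F(x)` with
`a = χ / (card * L²)`. -/
lemma exists_gameMap_eq_zero [Nonempty (Agent n)] (hn : ∀ i, 0 < n i)
    (hJ : RegularCosts J L) (hχ : 0 < χ) (hF : StronglyMonotone J χ) :
    ∃ x : Profile n, gameMap J x = 0 := by
  have hL := hF.lipschitz_pos hn hJ hχ
  set m : ℝ := ((Fintype.card (Agent n) : ℕ) : ℝ) with hm
  have hm0 : 0 < m := Nat.cast_pos.2 Fintype.card_pos
  set a := χ / (m * L ^ 2) with ha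
  have ha0 : 0 < a := by positivity
  set Ψ : EuclideanSpace ℝ (Agent n) → EuclideanSpace ℝ (Agent n) :=
    fun v => WithLp.toLp 2 fun b => v b - a * flat (gameMap J (unflat v)) b with hΨ
  set q : ℝ := max (1 - χ ^ 2 / (m * L ^ 2)) 0 with hq
  have hq1 : q < 1 := max_lt (by
    have : 0 < χ ^ 2 / (m * L ^ 2) := by positivity
    linarith) one_pos
  have key : ∀ v w, ‖Ψ v - Ψ w‖ ^ 2 ≤ q * ‖v - w‖ ^ 2 := by
    intro v w
    set D := ‖v - w‖ ^ 2 with hD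
    have hDn : norm2 (flat (unflat v) - flat (unflat w)) ^ 2 = D := rfl
    have hmon := hF (unflat v) (unflat w)
    set d : Agent n → ℝ := fun b => v b - w b with hd
    set φ : Agent n → ℝ := fun b => flat (gameMap J (unflat v)) b - flat (gameMap J (unflat w)) b
      with hφ
    have hDs : D = ∑ b, d b ^ 2 := by rw [← hDn, norm2_sq]; rfl
    have hmon' : χ * D ≤ ∑ b, φ b * d b := by
      rw [hDn] at hmon
      rw [Fintype.sum_sigma]
      exact hmon
    have hφ2 : ∑ b, φ b ^ 2 ≤ m * (L ^ 2 * D) := by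
      have : ∀ b, φ b ^ 2 ≤ L ^ 2 * D := by
        intro b
        have := gameMap_lipschitz hn hJ (unflat v) (unflat w) b.1 b.2
        calc φ b ^ 2 = |φ b| ^ 2 := (sq_abs _).symm
          _ ≤ (L * norm2 (flat (unflat v) - flat (unflat w))) ^ 2 :=
              pow_le_pow_left₀ (abs_nonneg _) this 2
          _ = L ^ 2 * D := by rw [mul_pow, hDn]
      calc ∑ b, φ b ^ 2 ≤ ∑ _b : Agent n, L ^ 2 * D := Finset.sum_le_sum fun b _ => this b
        _ = m * (L ^ 2 * D) := by simp [hm]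
    have hexp : ‖Ψ v - Ψ w‖ ^ 2 = D - 2 * a * ∑ b, φ b * d b + a ^ 2 * ∑ b, φ b ^ 2 := by
      rw [EuclideanSpace.norm_sq_eq, hDs, Finset.mul_sum, Finset.mul_sum, ← Finset.sum_sub_distrib,
        ← Finset.sum_add_distrib]
      refine Finset.sum_congr rfl fun b _ => ?_
      simp only [hΨ, hφ, hd, PiLp.sub_apply, Real.norm_eq_abs, sq_abs]
      ring
    have hD0 : 0 ≤ D := sq_nonneg _
    calc ‖Ψ v - Ψ w‖ ^ 2 ≤ D - 2 * a * (χ * D) + a ^ 2 * (m * (L ^ 2 * D)) := by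
          rw [hexp]
          have h1 := mul_le_mul_of_nonneg_left hmon' (by positivity : 0 ≤ 2 * a)
          have h2 := mul_le_mul_of_nonneg_left hφ2 (sq_nonneg a)
          linarith
      _ = (1 - χ ^ 2 / (m * L ^ 2)) * D := by
          rw [ha]; field_simp; ring
      _ ≤ q * D := mul_le_mul_of_nonneg_right (le_max_left _ _) hD0
  have hq0 : 0 ≤ q := le_max_right _ _
  have hcontr : ContractingWith (Real.toNNReal (Real.sqrt q)) Ψ := by
    refine ⟨?_, LipschitzWith.of_dist_le_mul fun v w => ?_⟩
    · rw [Real.toNNReal_lt_one, Real.sqrt_lt' one_pos]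
      simpa using hq1
    · rw [Real.coe_toNNReal _ (Real.sqrt_nonneg q), dist_eq_norm, dist_eq_norm]
      refine abs_le_of_sq_le_sq' ?_ (by positivity) |>.2
      rw [mul_pow, Real.sq_sqrt hq0]
      exact key v w
  set v := hcontr.fixedPoint Ψ with hv
  have hfix : Ψ v = v := hcontr.fixedPoint_isFixedPt
  refine ⟨unflat v, ?_⟩
  ext i k
  have h1 : v ⟨i, k⟩ - a * gameMap J (unflat v) i k = v ⟨i, k⟩ := by
    have := congrArg (fun u : EuclideanSpace ℝ (Agent n) => u ⟨i, k⟩) hfix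
    exact this
  have h2 : a * gameMap J (unflat v) i k = 0 := by linarith
  exact (mul_eq_zero.1 h2).resolve_left ha0.ne'

lemma eq_of_gameMap_eq (hχ : 0 < χ) (hF : StronglyMonotone J χ) {x x' : Profile n}
    (h : gameMap J x = gameMap J x') : x = x' := by
  have h1 := hF x x'
  simp only [h, sub_self, zero_mul, Finset.sum_const_zero] at h1
  have h2 : norm2 (flat x - flat x') ^ 2 = 0 :=
    le_antisymm (by nlinarith [sq_nonneg (norm2 (flat x - flat x'))]) (sq_nonneg _)
  rw [norm2_sq, Finset.sum_eq_zero_iff_of_nonneg fun _ _ => sq_nonneg _] at h2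
  ext i k
  have := h2 ⟨i, k⟩ (Finset.mem_univ _)
  simpa [flat, sub_eq_zero] using this

lemma existsUnique_isNash [Nonempty (Agent n)] (hn : ∀ i, 0 < n i)
    (hJ : RegularCosts J L) (hχ : 0 < χ) (hF : StronglyMonotone J χ) : ∃! x, IsNash J x := by
  obtain ⟨x, hx⟩ := exists_gameMap_eq_zero hn hJ hχ hF
  refine ⟨x, (isNash_iff hJ x).2 hx, fun y hy => eq_of_gameMap_eq hχ hF ?_⟩
  rw [hx, (isNash_iff hJ y).1 hy]

end Game

/-! ### One-step estimates -/

section Steps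

/-- Young's inequality with the weight that splits the gap between `σ²` and `1` in half. -/
lemma sq_le_of_le_mul_add {σ a b z : ℝ} (hσ0 : 0 ≤ σ) (hσ1 : σ < 1) (hz : 0 ≤ z)
    (h : z ≤ σ * a + b) :
    z ^ 2 ≤ (1 + σ ^ 2) / 2 * a ^ 2 + (1 + σ ^ 2) / (1 - σ ^ 2) * b ^ 2 := by
  have hs : 0 < 1 - σ ^ 2 := by nlinarith
  have h1 : z ^ 2 ≤ (σ * a + b) ^ 2 := pow_le_pow_left₀ hz h 2
  have h2 : (1 + σ ^ 2) / 2 * a ^ 2 + (1 + σ ^ 2) / (1 - σ ^ 2) * b ^ 2 - (σ * a + b) ^ 2 =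
      ((1 - σ ^ 2) * a - 2 * σ * b) ^ 2 / (2 * (1 - σ ^ 2)) := by
    field_simp
    ring
  have h3 : 0 ≤ ((1 - σ ^ 2) * a - 2 * σ * b) ^ 2 / (2 * (1 - σ ^ 2)) := by positivity
  linarith

lemma neg_two_mul_le {s a b : ℝ} (hs : 0 < s) : -2 * (a * b) ≤ s * a ^ 2 + b ^ 2 / s := by
  have h : s * a ^ 2 + b ^ 2 / s + 2 * (a * b) = (s * a + b) ^ 2 / s := by
    field_simp
    ring
  have : 0 ≤ (s * a + b) ^ 2 / s := by positivity
  linarith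

variable {α : Type} [Fintype α]

/-- One decision step. The update direction is `u + w (h + f)`, where `f` is the (strongly
monotone) gradient difference, `h` the gradient error due to estimation, and `u` the tracking
error; each of the two cross terms with `u` and `h` consumes a quarter of the monotonicity gain. -/
lemma decision_step {w Δ u h f γ : α → ℝ} {pmin χ L γM γa η D : ℝ}
    (hpmin : 0 < pmin) (hw : ∀ a, pmin ≤ w a) (hχ : 0 < χ) (hL : 0 ≤ L)
    (hγ0 : ∀ a, 0 ≤ γ a) (hγM : ∀ a, γ a ≤ γM) (hγa : 0 < γa)
    (hη : 0 ≤ η) (hη2 : ∑ a, (γ a - γa) ^ 2 = η ^ 2) (hD : ∑ a, Δ a ^ 2 = D)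
    (hmono : χ * D ≤ ∑ a, f a * Δ a) (hf : ∀ a, f a ^ 2 ≤ L ^ 2 * D) :
    ∑ a, (Δ a - γ a * (u a + w a * (h a + f a))) ^ 2 / w a ≤
      ∑ a, Δ a ^ 2 / w a - γa * χ * D + 2 * L * η * D
        + 2 * γM ^ 2 / (γa * χ) * ((∑ a, u a ^ 2 / w a) / pmin + ∑ a, h a ^ 2)
        + γM ^ 2 / pmin * ∑ a, (u a + w a * (h a + f a)) ^ 2 := by
  have hD0 : 0 ≤ D := hD ▸ Finset.sum_nonneg fun a _ => sq_nonneg _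
  set s := γa * χ / 2 with hs
  have hs0 : 0 < s := by positivity
  have hγsq : ∀ a, γ a ^ 2 ≤ γM ^ 2 := fun a => pow_le_pow_left₀ (hγ0 a) (hγM a) 2
  have hpt : ∀ a, (Δ a - γ a * (u a + w a * (h a + f a))) ^ 2 / w a ≤
      Δ a ^ 2 / w a + (s * Δ a ^ 2 + γM ^ 2 / s * (u a ^ 2 / w a / pmin))
        + (s * Δ a ^ 2 + γM ^ 2 / s * h a ^ 2) - 2 * γa * (f a * Δ a)
        - 2 * ((γ a - γa) * (Δ a * f a))
        + γM ^ 2 / pmin * (u a + w a * (h a + f a)) ^ 2 := by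
    intro a
    have hwa : 0 < w a := hpmin.trans_le (hw a)
    have e : (Δ a - γ a * (u a + w a * (h a + f a))) ^ 2 / w a =
        Δ a ^ 2 / w a + -2 * (Δ a * (γ a * u a / w a)) + -2 * (Δ a * (γ a * h a))
          - 2 * γa * (f a * Δ a) - 2 * ((γ a - γa) * (Δ a * f a))
          + γ a ^ 2 * (u a + w a * (h a + f a)) ^ 2 / w a := by
      field_simp
      ring
    have h1 := neg_two_mul_le (a := Δ a) (b := γ a * u a / w a) hs0
    have h2 := neg_two_mul_le (a := Δ a) (b := γ a * h a) hs0
    have h3 : (γ a * u a / w a) ^ 2 / s ≤ γM ^ 2 / s * (u a ^ 2 / w a / pmin) := by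
      have : (γ a * u a / w a) ^ 2 / s = γ a ^ 2 / s * (u a ^ 2 / w a / w a) := by
        field_simp
      rw [this]
      refine mul_le_mul (div_le_div_of_nonneg_right (hγsq a) hs0.le) ?_ (by positivity)
        (by positivity)
      exact div_le_div_of_nonneg_left (by positivity) hpmin (hw a)
    have h4 : (γ a * h a) ^ 2 / s ≤ γM ^ 2 / s * h a ^ 2 := by
      have : (γ a * h a) ^ 2 / s = γ a ^ 2 / s * h a ^ 2 := by ring
      rw [this]
      exact mul_le_mul_of_nonneg_right (div_le_div_of_nonneg_right (hγsq a) hs0.le) (sq_nonneg _)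
    have h5 : γ a ^ 2 * (u a + w a * (h a + f a)) ^ 2 / w a ≤
        γM ^ 2 / pmin * (u a + w a * (h a + f a)) ^ 2 := by
      rw [mul_div_right_comm]
      refine mul_le_mul_of_nonneg_right ?_ (sq_nonneg _)
      exact div_le_div₀ (sq_nonneg _) (hγsq a) hpmin (hw a)
    rw [e]
    linarith
  have hhet : -(∑ a, (γ a - γa) * (Δ a * f a)) ≤ η * (L * D) := by
    have h1 := Finset.sum_mul_sq_le_sq_mul_sq Finset.univ (fun a => γ a - γa)
      (fun a => Δ a * f a)
    have h2 : ∑ a, (Δ a * f a) ^ 2 ≤ (L * D) ^ 2 := by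
      calc ∑ a, (Δ a * f a) ^ 2 ≤ ∑ a, Δ a ^ 2 * (L ^ 2 * D) :=
            Finset.sum_le_sum fun a _ => by
              rw [mul_pow]; exact mul_le_mul_of_nonneg_left (hf a) (sq_nonneg _)
        _ = (L * D) ^ 2 := by rw [← Finset.sum_mul, hD]; ring
    have h3 : (∑ a, (γ a - γa) * (Δ a * f a)) ^ 2 ≤ (η * (L * D)) ^ 2 := by
      rw [mul_pow, ← hη2]
      exact h1.trans (mul_le_mul_of_nonneg_left h2 (Finset.sum_nonneg fun a _ => sq_nonneg _))
    have := (abs_le.1 (abs_le_of_sq_le_sq h3 (by positivity))).1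
    linarith
  refine (Finset.sum_le_sum fun a _ => hpt a).trans ?_
  simp only [Finset.sum_add_distrib, Finset.sum_sub_distrib, ← Finset.mul_sum, ← Finset.sum_div, hD]
  have e2 : γM ^ 2 / s = 2 * γM ^ 2 / (γa * χ) := by
    rw [hs]; field_simp
  rw [e2]
  have h6 := mul_le_mul_of_nonneg_left hmono (by positivity : 0 ≤ 2 * γa)
  have h7 : s * D = γa * χ * D / 2 := by rw [hs]; ring
  rw [h7]
  linarith

lemma sum_sq_three_terms_le {w u h f : α → ℝ} :
    ∑ a, (u a + w a * (h a + f a)) ^ 2 ≤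
      3 * (∑ a, u a ^ 2 + ∑ a, (w a * h a) ^ 2 + ∑ a, (w a * f a) ^ 2) := by
  rw [← Finset.sum_add_distrib, ← Finset.sum_add_distrib, Finset.mul_sum]
  refine Finset.sum_le_sum fun a _ => ?_
  nlinarith [sq_nonneg (u a - w a * h a), sq_nonneg (u a - w a * f a),
    sq_nonneg (w a * h a - w a * f a)]

/-- One gradient-tracking step for a column-stochastic matrix with Perron vector `π`. -/
lemma tracking_step {V : Type} [Fintype V] [DecidableEq V] {M : Matrix V V ℝ}
    (hcol : ∀ k, ∑ j, M j k = 1) {π : V → ℝ} (hπ : IsPerronVector M π) (hpos : ∀ j, 0 < π j)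
    {c : ℝ} (hc : 0 < c) {g g' h : V → ℝ} (hg : g' = M.mulVec g + h) :
    wnorm (fun j => c * π j) (g' - (Matrix.of fun j (_ : V) => π j).mulVec g') ≤
      wmatNorm (fun j => c * π j) (M - Matrix.of fun j _ => π j) *
        wnorm (fun j => c * π j) (g - (Matrix.of fun j (_ : V) => π j).mulVec g)
      + wnorm (fun j => c * π j) h := by
  set P : Matrix V V ℝ := Matrix.of fun j _ => π j with hP
  have hw : ∀ j, 0 < (fun j => c * π j) j := fun j => mul_pos hc (hpos j)
  have e : g' - P.mulVec g' = (M - P).mulVec (g - P.mulVec g) + (h - P.mulVec h) := by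
    have hPg : ∀ v, P.mulVec v = (∑ k, v k) • π := fun v => rankOne_mulVec π v
    have hs : ∑ k, (g - (∑ k, g k) • π) k = 0 := by
      simp [Finset.sum_sub_distrib, ← Finset.mul_sum, hπ.2]
    rw [Matrix.sub_mulVec, hPg, hPg g, hPg (g - _), hs, hPg, Matrix.mulVec_sub, Matrix.mulVec_smul,
      hπ.1, hg]
    have : ∑ k, (M.mulVec g + h) k = ∑ k, g k + ∑ k, h k := by
      simp [Finset.sum_add_distrib, sum_mulVec_of_col hcol]
    rw [this, add_smul, zero_smul]
    abel
  have hadd : ∀ v v' : V → ℝ, wnorm (fun j => c * π j) (v + v') ≤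
      wnorm (fun j => c * π j) v + wnorm (fun j => c * π j) v' := by
    intro v v'
    refine le_trans (le_of_eq ?_) (norm2_add_le _ _)
    unfold wnorm
    congr 1
    ext a
    simp [mul_add]
  rw [e]
  refine (hadd _ _).trans (add_le_add (wnorm_mulVec_le hw _ _) ?_)
  refine (sq_le_sq₀ (wnorm_nonneg _ _) (wnorm_nonneg _ _)).1 ?_
  rw [wnorm_sq hw, wnorm_sq hw]
  have e2 : ∀ v : V → ℝ, ∑ j, v j ^ 2 / (c * π j) = c⁻¹ * ∑ j, v j ^ 2 / π j := by
    intro v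
    rw [Finset.mul_sum]
    refine Finset.sum_congr rfl fun j _ => ?_
    have := (hpos j).ne'
    field_simp
  rw [e2, e2]
  refine mul_le_mul_of_nonneg_left ?_ (inv_pos.2 hc).le
  rw [show P.mulVec h = fun j => (∑ k, h k) * π j from rankOne_mulVec π h]
  have := sum_sq_div_sub_smul hpos hπ.2 h
  simp only [Pi.sub_apply]
  linarith [sq_nonneg (∑ k, h k)]

end Steps

/-! ### The comparison matrix -/

namespace Param

/-- The sign and range conditions on the parameters that the recursion needs. -/
structure Admissible (c : Param) : Prop where
  one_le_n : 1 ≤ c.n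
  S_pos : 0 < c.S
  pmin_pos : 0 < c.pmin
  pmin_le : c.pmin ≤ c.pmax
  iota_pos : 0 < c.iota
  L_pos : 0 < c.L
  chi_pos : 0 < c.chi
  Clow_pos : 0 < c.Clow
  Cup_pos : 0 < c.Cup
  sigma1_nonneg : 0 ≤ c.sigma1
  sigma1_lt : c.sigma1 < 1
  vs1_pos : 0 < c.vs1
  sigma2_nonneg : 0 ≤ c.sigma2
  sigma2_lt : c.sigma2 < 1
  vs2_pos : 0 < c.vs2

namespace Admissible

variable {c : Param}

lemma pmax_pos (hc : c.Admissible) : 0 < c.pmax := hc.pmin_pos.trans_le hc.pmin_le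

lemma n_pos (hc : c.Admissible) : 0 < c.n := one_pos.trans_le hc.one_le_n

lemma k1_pos (hc : c.Admissible) : 0 < c.k1 := mul_pos hc.pmin_pos hc.chi_pos

lemma k2_pos (hc : c.Admissible) : 0 < c.k2 := by
  have := hc.pmin_pos; have := hc.pmax_pos; have := hc.iota_pos; have := hc.L_pos
  have := hc.S_pos
  unfold k2; positivity

lemma k3_pos (hc : c.Admissible) : 0 < c.k3 := by
  have := hc.pmax_pos; have := hc.n_pos; have := hc.L_pos
  unfold k3; positivity

lemma k4_pos (hc : c.Admissible) : 0 < c.k4 := by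
  have := hc.pmin_pos; have := hc.pmax_pos
  unfold k4; positivity

lemma k5_pos (hc : c.Admissible) : 0 < c.k5 := by
  have := hc.pmin_pos; have := hc.chi_pos
  unfold k5; positivity

lemma k6_pos (hc : c.Admissible) : 0 < c.k6 := by
  have := hc.pmin_pos; have := hc.n_pos; have := hc.iota_pos; have := hc.L_pos
  have := hc.Clow_pos
  unfold k6; positivity

lemma k7_pos (hc : c.Admissible) : 0 < c.k7 := by
  have := hc.pmin_pos; have := hc.pmax_pos; have := hc.n_pos; have := hc.L_pos
  have := hc.Clow_pos; have := hc.chi_pos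
  unfold k7; positivity

lemma k8_pos (hc : c.Admissible) : 0 < c.k8 := by
  have := hc.pmin_pos; have := hc.pmax_pos; have := hc.n_pos; have := hc.L_pos
  have := hc.vs1_pos; have := hc.vs2_pos; have := hc.iota_pos; have := hc.S_pos
  unfold k8; positivity

lemma k9_pos (hc : c.Admissible) : 0 < c.k9 := by
  have := hc.pmin_pos; have := hc.pmax_pos; have := hc.n_pos; have := hc.L_pos
  have := hc.vs1_pos; have := hc.vs2_pos; have := hc.S_pos
  unfold k9; positivity

lemma k10_pos (hc : c.Admissible) : 0 < c.k10 := by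
  have := hc.sigma1_nonneg; have := hc.sigma1_lt
  unfold k10; nlinarith

lemma k10_lt_one (c : Param) : c.k10 < 1 := by
  unfold k10; nlinarith [sq_nonneg c.sigma1]

lemma k11_pos (hc : c.Admissible) : 0 < c.k11 := by
  have := hc.pmin_pos; have := hc.n_pos; have := hc.L_pos
  have := hc.vs1_pos; have := hc.Clow_pos
  unfold k11; positivity

lemma k12_pos (hc : c.Admissible) : 0 < c.k12 := by
  have := hc.pmin_pos; have := hc.n_pos; have := hc.L_pos
  have := hc.vs1_pos; have := hc.vs2_pos; have := hc.iota_pos; have := hc.Clow_pos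
  unfold k12; positivity

lemma k13_pos (hc : c.Admissible) : 0 < c.k13 := by
  have := hc.pmax_pos; have := hc.n_pos; have := hc.L_pos; have := hc.Cup_pos
  have := hc.vs2_pos; have := hc.iota_pos; have := hc.S_pos
  unfold k13; positivity

lemma k14_pos (hc : c.Admissible) : 0 < c.k14 := by
  have := hc.pmax_pos; have := hc.n_pos; have := hc.Cup_pos; have := hc.vs2_pos
  unfold k14; positivity

lemma k15_pos (hc : c.Admissible) : 0 < c.k15 := by
  have := hc.n_pos; have := hc.L_pos; have := hc.Cup_pos
  have := hc.vs2_pos; have := hc.iota_pos; have := hc.Clow_pos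
  unfold k15; positivity

lemma k16_pos (hc : c.Admissible) : 0 < c.k16 := by
  have := hc.sigma2_nonneg; have := hc.sigma2_lt
  unfold k16; nlinarith

lemma k16_lt_one (c : Param) : c.k16 < 1 := by
  unfold k16; nlinarith [sq_nonneg c.sigma2]

lemma T_pos (hc : c.Admissible) {γM γa ε : ℝ} (hγa : 0 < γa) (hle : γa ≤ γM) (hε : 0 ≤ ε)
    (h1 : γM < 1 / c.k1) (i j : Fin 3) : 0 < c.T γM γa ε i j := by
  have := hc.k2_pos; have := hc.k3_pos; have := hc.k4_pos; have := hc.k5_pos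
  have := hc.k6_pos; have := hc.k7_pos; have := hc.k8_pos; have := hc.k9_pos
  have := hc.k11_pos; have := hc.k12_pos; have := hc.k13_pos; have := hc.k14_pos
  have := hc.k15_pos; have hk10 := k10_lt_one c; have hk16 := k16_lt_one c
  have hγM : 0 < γM := hγa.trans_le hle
  rw [lt_div_iff₀ hc.k1_pos] at h1
  have h00 : 0 < 1 - c.k1 * γa := by nlinarith [mul_le_mul_of_nonneg_left hle hc.k1_pos.le]
  have h11 : 0 < 1 - c.k10 := by linarith
  have h22 : 0 < 1 - c.k16 := by linarith
  fin_cases i <;> fin_cases j <;> simp [T] <;> positivity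

/-- Under the step-size conditions `T` strictly decreases an explicit positive vector. -/
lemma exists_T_mulVec_lt (hc : c.Admissible) {γM γa ε : ℝ} (hγa : 0 < γa) (hle : γa ≤ γM)
    (hMa : γM ≤ c.n * γa) (hε : ε < c.k1 / c.k3) (h1 : γM < c.gamma1 ε)
    (h2 : γM < c.gamma2 ε) (h3 : γM < c.gamma3 ε) :
    ∃ w : Fin 3 → ℝ, (∀ i, 0 < w i) ∧ ∀ i, (c.T γM γa ε).mulVec w i < w i := by
  have hk2 := hc.k2_pos; have hk4 := hc.k4_pos; have hk5 := hc.k5_pos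
  have hk6 := hc.k6_pos; have hk7 := hc.k7_pos; have hk8 := hc.k8_pos; have hk9 := hc.k9_pos
  have hk10 := hc.k10_pos
  have hk11 := hc.k11_pos; have hk12 := hc.k12_pos; have hk13 := hc.k13_pos
  have hk14 := hc.k14_pos; have hk15 := hc.k15_pos; have hk16 := hc.k16_pos
  have hn := hc.n_pos
  have hγM : 0 < γM := hγa.trans_le hle
  have hd : 0 < c.k1 - c.k3 * ε := by
    rw [lt_div_iff₀ hc.k3_pos] at hε
    linarith
  set d := c.k1 - c.k3 * ε with hd'
  have hq1 : 0 < c.q1 ε := by unfold q1; rw [← hd']; positivity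
  have hq2 : 0 < c.q2 ε := by unfold q2; rw [← hd']; positivity
  have hq3 : 0 < c.q3 ε := by unfold q3; rw [← hd']; positivity
  have e1 : γM * c.q1 ε < c.k7 * c.k10 * d := by
    unfold gamma1 at h1
    rwa [lt_div_iff₀ hq1] at h1
  have e2 : γM ^ 2 * c.q2 ε < c.k10 * c.k11 * d := by
    unfold gamma2 at h2
    rwa [Real.lt_sqrt hγM.le, lt_div_iff₀ hq2] at h2
  have e3 : γM ^ 2 * c.q3 ε < c.k10 * c.k16 * d := by
    unfold gamma3 at h3
    rwa [Real.lt_sqrt hγM.le, lt_div_iff₀ hq3] at h3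
  refine ⟨![2 * c.n ^ 2 * (c.k5 * c.k11 + c.k7 * c.k10), 2 * c.k11 * d, c.k10 * d], ?_, ?_⟩
  · intro i
    fin_cases i <;> simp <;> positivity
  · have hfrac : γM ^ 2 / γa ≤ c.n ^ 2 * γa := by
      rw [div_le_iff₀ hγa]
      calc γM ^ 2 ≤ (c.n * γa) ^ 2 := pow_le_pow_left₀ hγM.le hMa 2
        _ = c.n ^ 2 * γa * γa := by ring
    have hMa2 : γM ≤ c.n ^ 2 * γa := by
      refine hMa.trans (mul_le_mul_of_nonneg_right ?_ hγa.le)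
      nlinarith [hc.one_le_n]
    intro i
    fin_cases i
    · simp only [T, Matrix.mulVec, dotProduct, Fin.sum_univ_three]
      simp
      have f1 := mul_lt_mul_of_pos_left e1 hγM
      have f2 := mul_le_mul_of_nonneg_right hMa2 (by positivity : 0 ≤ c.k7 * c.k10 * d)
      have f3 := mul_le_mul_of_nonneg_right hfrac
        (by positivity : 0 ≤ (2 * c.k5 * c.k11 + c.k7 * c.k10) * d)
      unfold q1 at f1
      rw [← hd'] at f1
      have e4 : c.k5 * γM ^ 2 / γa = c.k5 * (γM ^ 2 / γa) := by ring
      have e5 : c.k7 * γM ^ 2 / γa = c.k7 * (γM ^ 2 / γa) := by ring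
      have e6 : c.k3 * ε = c.k1 - d := by rw [hd']; ring
      rw [e4, e5, e6]
      linarith
    · simp only [T, Matrix.mulVec, dotProduct, Fin.sum_univ_three]
      simp
      unfold q2 at e2
      rw [← hd'] at e2
      linarith
    · simp only [T, Matrix.mulVec, dotProduct, Fin.sum_univ_three]
      simp
      unfold q3 at e3
      rw [← hd'] at e3
      linarith

lemma decision_row (hc : c.Admissible) {γM γa ε X X' G E D E2 U H Q η : ℝ} (hγa : 0 < γa)
    (hη : η = ε * γa * Real.sqrt c.n) (hε : 0 ≤ ε)
    (hX : X' ≤ X - γa * c.chi * D + 2 * c.L * η * D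
      + 2 * γM ^ 2 / (γa * c.chi) * (U / c.pmin + H) + γM ^ 2 / c.pmin * Q)
    (hU : U ≤ G) (hG : 0 ≤ G) (hH : H ≤ c.L ^ 2 * E2)
    (hQ : Q ≤ 3 * (c.pmax * G + c.n ^ 2 * c.iota ^ 2 * c.L ^ 2 * E2
      + c.iota ^ 2 * c.S * c.L ^ 2 * D))
    (hD : D ≤ c.pmax * X) (hD' : c.pmin * X ≤ D) (hE2 : 0 ≤ E2) (hE : c.Clow ^ 2 * E2 ≤ E) :
    X' ≤ (1 - c.k1 * γa + c.k2 * γM ^ 2 + c.k3 * ε * γa) * X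
      + (c.k4 * γM ^ 2 + c.k5 * γM ^ 2 / γa) * G + (c.k6 * γM ^ 2 + c.k7 * γM ^ 2 / γa) * E := by
  have hpmin := hc.pmin_pos; have hpmax := hc.pmax_pos; have hn := hc.n_pos; have hL := hc.L_pos
  have hCl := hc.Clow_pos; have hχ := hc.chi_pos; have hS := hc.S_pos; have hι := hc.iota_pos
  have hE0 : 0 ≤ E := (by positivity : 0 ≤ c.Clow ^ 2 * E2).trans hE
  have hE2' : E2 ≤ E / c.Clow ^ 2 := by rw [le_div_iff₀ (by positivity)]; linarith
  have a1 : c.k1 * γa * X ≤ γa * c.chi * D := by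
    unfold k1
    calc c.pmin * c.chi * γa * X = γa * c.chi * (c.pmin * X) := by ring
      _ ≤ γa * c.chi * D := mul_le_mul_of_nonneg_left hD' (by positivity)
  have a2 : 2 * c.L * η * D ≤ c.k3 * ε * γa * X := by
    unfold k3
    calc 2 * c.L * η * D ≤ 2 * c.L * η * (c.pmax * X) :=
          mul_le_mul_of_nonneg_left hD (by rw [hη]; positivity)
      _ = 2 * c.pmax * Real.sqrt c.n * c.L * ε * γa * X := by rw [hη]; ring
  have a3 : 2 * γM ^ 2 / (γa * c.chi) * (U / c.pmin + H) ≤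
      c.k5 * γM ^ 2 / γa * G + c.k7 * γM ^ 2 / γa * E := by
    have b1 : U / c.pmin + H ≤ G / c.pmin + c.L ^ 2 * (E / c.Clow ^ 2) :=
      add_le_add (div_le_div_of_nonneg_right hU hpmin.le)
        (hH.trans (mul_le_mul_of_nonneg_left hE2' (by positivity)))
    refine (mul_le_mul_of_nonneg_left b1 (by positivity)).trans ?_
    have b2 : c.k5 * γM ^ 2 / γa * G = 3 * γM ^ 2 / (γa * c.chi) * (G / c.pmin) := by
      unfold k5; field_simp
    have b3 : c.k7 * γM ^ 2 / γa * E = 3 * (c.pmax / c.pmin * c.n) * (γM ^ 2 / (γa * c.chi)) *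
        (c.L ^ 2 * (E / c.Clow ^ 2)) := by
      unfold k7; field_simp
    have b4 : 1 ≤ c.pmax / c.pmin * c.n :=
      one_le_mul_of_one_le_of_one_le ((one_le_div hpmin).2 hc.pmin_le) hc.one_le_n
    rw [b2, b3, mul_add]
    refine add_le_add (mul_le_mul_of_nonneg_right ?_ (by positivity))
      (mul_le_mul_of_nonneg_right ?_ (by positivity))
    · exact div_le_div_of_nonneg_right (by nlinarith [sq_nonneg γM]) (by positivity)
    · have : 0 ≤ γM ^ 2 / (γa * c.chi) := by positivity
      rw [mul_div_assoc]
      nlinarith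
  have a4 : γM ^ 2 / c.pmin * Q ≤
      c.k2 * γM ^ 2 * X + c.k4 * γM ^ 2 * G + c.k6 * γM ^ 2 * E := by
    have b1 : Q ≤ 3 * (c.pmax * G + c.n ^ 2 * c.iota ^ 2 * c.L ^ 2 * (E / c.Clow ^ 2)
        + c.iota ^ 2 * c.S * c.L ^ 2 * (c.pmax * X)) := by
      refine hQ.trans (mul_le_mul_of_nonneg_left (add_le_add (add_le_add_right ?_ _) ?_) (by norm_num))
      · exact mul_le_mul_of_nonneg_left hE2' (by positivity)
      · exact mul_le_mul_of_nonneg_left hD (by positivity)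
    refine (mul_le_mul_of_nonneg_left b1 (by positivity)).trans (le_of_eq ?_)
    unfold k2 k4 k6
    field_simp
    ring
  linarith

lemma tracking_row (hc : c.Admissible) {γM X G G' E : ℝ} (hX : 0 ≤ X) (hG : 0 ≤ G) (hE : 0 ≤ E)
    (h : G' ≤ (1 + c.sigma1 ^ 2) / 2 * G
      + c.vs1 * (c.n * c.L ^ 2 / c.pmin * ((1 + c.sigma2) ^ 2 * E / c.Clow ^ 2))) :
    G' ≤ c.k8 * γM ^ 2 * X + (1 - c.k10 + c.k9 * γM ^ 2) * G + (c.k11 + c.k12 * γM ^ 2) * E := by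
  have h8 := hc.k8_pos; have h9 := hc.k9_pos; have h12 := hc.k12_pos
  have hpmin := hc.pmin_pos; have hn := hc.n_pos; have hL := hc.L_pos
  have hCl := hc.Clow_pos; have hv := hc.vs1_pos
  have a1 : c.vs1 * (c.n * c.L ^ 2 / c.pmin * ((1 + c.sigma2) ^ 2 * E / c.Clow ^ 2)) ≤
      c.k11 * E := by
    have e1 : c.vs1 * (c.n * c.L ^ 2 / c.pmin * ((1 + c.sigma2) ^ 2 * E / c.Clow ^ 2)) =
        (1 + c.sigma2) ^ 2 * (c.vs1 * c.n * c.L ^ 2 * E / (c.pmin * c.Clow ^ 2)) := by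
      field_simp
    have e2 : c.k11 * E =
        3 * (3 + c.sigma2 ^ 2) / 2 * (c.vs1 * c.n * c.L ^ 2 * E / (c.pmin * c.Clow ^ 2)) := by
      unfold k11; field_simp
    rw [e1, e2]
    refine mul_le_mul_of_nonneg_right ?_ (by positivity)
    nlinarith [hc.sigma2_nonneg, hc.sigma2_lt]
  have a2 : 0 ≤ c.k8 * γM ^ 2 * X := by positivity
  have a3 : 0 ≤ c.k9 * γM ^ 2 * G := by positivity
  have a4 : 0 ≤ c.k12 * γM ^ 2 * E := by positivity
  have a5 : 1 - c.k10 = (1 + c.sigma1 ^ 2) / 2 := by unfold k10; ring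
  rw [add_mul, add_mul, a5]
  linarith

lemma estimation_row (hc : c.Admissible) {γM X G E E' D E2 Q : ℝ}
    (h : E' ≤ (1 + c.sigma2 ^ 2) / 2 * E + c.vs2 * (c.Cup ^ 2 * c.n ^ 2 * (γM ^ 2 * Q)))
    (hQ : Q ≤ 3 * (c.pmax * G + c.n ^ 2 * c.iota ^ 2 * c.L ^ 2 * E2
      + c.iota ^ 2 * c.S * c.L ^ 2 * D))
    (hD : D ≤ c.pmax * X) (hE : c.Clow ^ 2 * E2 ≤ E) :
    E' ≤ c.k13 * γM ^ 2 * X + c.k14 * γM ^ 2 * G + (1 - c.k16 + c.k15 * γM ^ 2) * E := by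
  have hn := hc.n_pos; have hL := hc.L_pos; have hCl := hc.Clow_pos; have hS := hc.S_pos
  have hι := hc.iota_pos; have hv := hc.vs2_pos; have hCu := hc.Cup_pos
  have hE2' : E2 ≤ E / c.Clow ^ 2 := by rw [le_div_iff₀ (by positivity)]; linarith
  have b1 : Q ≤ 3 * (c.pmax * G + c.n ^ 2 * c.iota ^ 2 * c.L ^ 2 * (E / c.Clow ^ 2)
      + c.iota ^ 2 * c.S * c.L ^ 2 * (c.pmax * X)) := by
    refine hQ.trans (mul_le_mul_of_nonneg_left (add_le_add (add_le_add_right ?_ _) ?_) (by norm_num))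
    · exact mul_le_mul_of_nonneg_left hE2' (by positivity)
    · exact mul_le_mul_of_nonneg_left hD (by positivity)
  have b2 : c.vs2 * (c.Cup ^ 2 * c.n ^ 2 * (γM ^ 2 * Q)) ≤
      c.k13 * γM ^ 2 * X + c.k14 * γM ^ 2 * G + c.k15 * γM ^ 2 * E := by
    have b3 := mul_le_mul_of_nonneg_left b1
      (by positivity : 0 ≤ c.vs2 * (c.Cup ^ 2 * c.n ^ 2 * γM ^ 2))
    calc c.vs2 * (c.Cup ^ 2 * c.n ^ 2 * (γM ^ 2 * Q))
        = c.vs2 * (c.Cup ^ 2 * c.n ^ 2 * γM ^ 2) * Q := by ring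
      _ ≤ _ := b3
      _ = _ := by
        unfold k13 k14 k15
        field_simp
        ring
  have a5 : 1 - c.k16 = (1 + c.sigma2 ^ 2) / 2 := by unfold k16; ring
  rw [add_mul, a5]
  linarith

end Admissible

end Param

/-! ### The algorithm along one step -/

section Run

variable {N : ℕ} {n : Fin N → ℕ} {J : (i : Fin N) → Fin (n i) → Profile n → ℝ} {L χ : ℝ}
  {A : (i : Fin N) → Matrix (Fin (n i)) (Fin (n i)) ℝ} {Abar : Matrix (Agent n) (Agent n) ℝ}
  {δ : Agent n → ℝ} {γ : Profile n} {x : ℕ → Profile n}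
  {g : ℕ → (i : Fin N) → Fin (n i) → Fin (n i) → ℝ} {y : ℕ → Agent n → Profile n}

/-- Gradient tracking preserves the sum of the trackers: it is the sum of the local gradients. -/
lemma IsRun.sum_tracker (h : IsRun J A Abar δ γ x g y) (hcol : ∀ i k, ∑ j, A i j k = 1) (t : ℕ)
    (i : Fin N) (k : Fin (n i)) :
    ∑ j, g t i j k = ∑ j, partialGrad i k (J i j) (y t ⟨i, j⟩) := by
  induction t with
  | zero => exact Finset.sum_congr rfl fun j _ => h.init i j k
  | succ t ih =>
    simp only [h.tracker, Finset.sum_add_distrib, Finset.sum_sub_distrib]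
    have : ∑ j, ∑ l, A i j l * g t i l k = ∑ l, g t i l k :=
      sum_mulVec_of_col (hcol i) fun l => g t i l k
    rw [this, ih]
    ring

/-- The cluster gradients, evaluated by every agent at its own estimate. -/
noncomputable def estGrad (J : (i : Fin N) → Fin (n i) → Profile n → ℝ) (y : Agent n → Profile n) :
    Profile n :=
  fun i k => (1 / (n i : ℝ)) * ∑ l, partialGrad i k (J i l) (y ⟨i, l⟩)

/-- Total squared Euclidean estimation error. -/
noncomputable def estDist (x : Profile n) (y : Agent n → Profile n) : ℝ :=
  ∑ p, norm2 (flat (y p) - flat x) ^ 2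

lemma estDist_nonneg (x : Profile n) (y : Agent n → Profile n) : 0 ≤ estDist x y :=
  Finset.sum_nonneg fun _ _ => sq_nonneg _

lemma estDist_eq (x : Profile n) (y : Agent n → Profile n) :
    estDist x y = ∑ q, norm2 (fun p => flat (y p) q - flat x q) ^ 2 := by
  unfold estDist
  simp only [norm2_sq, Pi.sub_apply]
  exact Finset.sum_comm

lemma sq_sum_partialGrad_le (hJ : RegularCosts J L) (x : Profile n) (y : Agent n → Profile n)
    (i : Fin N) (k : Fin (n i)) :
    (∑ l, (partialGrad i k (J i l) (y ⟨i, l⟩) - partialGrad i k (J i l) x)) ^ 2 ≤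
      n i * (L ^ 2 * ∑ l, norm2 (flat (y ⟨i, l⟩) - flat x) ^ 2) := by
  refine sq_sum_le_card_mul_sum_sq.trans ?_
  rw [Finset.card_univ, Fintype.card_fin, Finset.mul_sum _ _ (L ^ 2)]
  refine mul_le_mul_of_nonneg_left (Finset.sum_le_sum fun l _ => ?_) (Nat.cast_nonneg _)
  rw [← mul_pow, ← sq_abs]
  exact pow_le_pow_left₀ (abs_nonneg _) (hJ.lipschitz i l k _ _) 2

lemma natCast_le_card (i : Fin N) : (n i : ℝ) ≤ Fintype.card (Agent n) := by
  rw [Fintype.card_sigma]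
  simp only [Fintype.card_fin]
  exact_mod_cast Finset.single_le_sum (f := n) (fun _ _ => Nat.zero_le _) (Finset.mem_univ i)

lemma estGrad_sub_gameMap (hJ : RegularCosts J L) (x : Profile n) (y : Agent n → Profile n)
    (i : Fin N) (k : Fin (n i)) :
    estGrad J y i k - gameMap J x i k =
      (1 / (n i : ℝ)) * ∑ l, (partialGrad i k (J i l) (y ⟨i, l⟩) - partialGrad i k (J i l) x) := by
  rw [gameMap_eq hJ, estGrad, ← mul_sub, ← Finset.sum_sub_distrib]

lemma sum_gradError_sq_le (hn : ∀ i, 0 < n i) (hJ : RegularCosts J L) (x : Profile n)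
    (y : Agent n → Profile n) :
    ∑ a, (flat (estGrad J y) a - flat (gameMap J x) a) ^ 2 ≤ L ^ 2 * estDist x y := by
  rw [Fintype.sum_sigma, estDist, Fintype.sum_sigma, Finset.mul_sum]
  refine Finset.sum_le_sum fun i _ => ?_
  have hni : (0 : ℝ) < n i := by exact_mod_cast hn i
  set R := ∑ l, norm2 (flat (y ⟨i, l⟩) - flat x) ^ 2 with hR
  have : ∀ k : Fin (n i), (flat (estGrad J y) ⟨i, k⟩ - flat (gameMap J x) ⟨i, k⟩) ^ 2 ≤
      1 / (n i : ℝ) * (L ^ 2 * R) := by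
    intro k
    have h1 := sq_sum_partialGrad_le hJ x y i k
    have h2 : (flat (estGrad J y) ⟨i, k⟩ - flat (gameMap J x) ⟨i, k⟩) ^ 2 = _ :=
      congrArg (· ^ 2) (estGrad_sub_gameMap hJ x y i k)
    rw [h2, mul_pow]
    calc (1 / (n i : ℝ)) ^ 2 * _ ≤ (1 / (n i : ℝ)) ^ 2 * (n i * (L ^ 2 * R)) :=
          mul_le_mul_of_nonneg_left h1 (sq_nonneg _)
      _ = 1 / (n i : ℝ) * (L ^ 2 * R) := by field_simp
  refine (Finset.sum_le_sum fun k _ => this k).trans (le_of_eq ?_)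
  rw [Finset.sum_const, Finset.card_univ, Fintype.card_fin, nsmul_eq_mul]
  field_simp

lemma sum_scaled_gradError_sq_le (hn : ∀ i, 0 < n i) (hJ : RegularCosts J L) {π : Profile n}
    {ι : ℝ} (hι : ∀ i, ∑ j, π i j ^ 2 ≤ ι ^ 2) (x : Profile n) (y : Agent n → Profile n) :
    ∑ a, (flat (scaledPerron π) a * (flat (estGrad J y) a - flat (gameMap J x) a)) ^ 2 ≤
      (Fintype.card (Agent n) : ℝ) * ι ^ 2 * L ^ 2 * estDist x y := by
  rw [Fintype.sum_sigma, estDist, Fintype.sum_sigma, Finset.mul_sum]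
  refine Finset.sum_le_sum fun i _ => ?_
  have hni : (0 : ℝ) < n i := by exact_mod_cast hn i
  set R := ∑ l, norm2 (flat (y ⟨i, l⟩) - flat x) ^ 2 with hR
  have hR0 : 0 ≤ R := Finset.sum_nonneg fun _ _ => sq_nonneg _
  have : ∀ k : Fin (n i), (flat (scaledPerron π) ⟨i, k⟩ *
      (flat (estGrad J y) ⟨i, k⟩ - flat (gameMap J x) ⟨i, k⟩)) ^ 2 ≤
      π i k ^ 2 * (n i * (L ^ 2 * R)) := by
    intro k
    have h1 := sq_sum_partialGrad_le hJ x y i k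
    have h2 : flat (scaledPerron π) ⟨i, k⟩ *
        (flat (estGrad J y) ⟨i, k⟩ - flat (gameMap J x) ⟨i, k⟩) =
        π i k * ∑ l, (partialGrad i k (J i l) (y ⟨i, l⟩) - partialGrad i k (J i l) x) := by
      have h3 : flat (estGrad J y) ⟨i, k⟩ - flat (gameMap J x) ⟨i, k⟩ = _ :=
        estGrad_sub_gameMap hJ x y i k
      rw [h3]
      simp only [flat, scaledPerron]
      field_simp
    rw [h2, mul_pow]
    exact mul_le_mul_of_nonneg_left h1 (sq_nonneg _)
  refine (Finset.sum_le_sum fun k _ => this k).trans ?_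
  rw [← Finset.sum_mul]
  calc (∑ k, π i k ^ 2) * (n i * (L ^ 2 * R)) ≤
        ι ^ 2 * ((Fintype.card (Agent n) : ℝ) * (L ^ 2 * R)) :=
        mul_le_mul (hι i) (mul_le_mul_of_nonneg_right (natCast_le_card i) (by positivity))
          (by positivity) (sq_nonneg _)
    _ = _ := by ring

lemma sum_scaled_gameMap_sq_le (hn : ∀ i, 0 < n i) (hJ : RegularCosts J L) {π : Profile n}
    {ι : ℝ} (hι : ∀ i, ∑ j, π i j ^ 2 ≤ ι ^ 2) (x x' : Profile n) :
    ∑ a, (flat (scaledPerron π) a * (flat (gameMap J x) a - flat (gameMap J x') a)) ^ 2 ≤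
      ι ^ 2 * (∑ i, (n i : ℝ) ^ 3) * L ^ 2 * norm2 (flat x - flat x') ^ 2 := by
  set D := norm2 (flat x - flat x') ^ 2 with hD
  have hD0 : 0 ≤ D := sq_nonneg _
  rw [Fintype.sum_sigma, Finset.mul_sum, Finset.sum_mul, Finset.sum_mul]
  refine Finset.sum_le_sum fun i _ => ?_
  have hni : (1 : ℝ) ≤ n i := by exact_mod_cast hn i
  have : ∀ k : Fin (n i), (flat (scaledPerron π) ⟨i, k⟩ *
      (flat (gameMap J x) ⟨i, k⟩ - flat (gameMap J x') ⟨i, k⟩)) ^ 2 ≤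
      π i k ^ 2 * ((n i : ℝ) ^ 2 * (L ^ 2 * D)) := by
    intro k
    have h1 : (gameMap J x i k - gameMap J x' i k) ^ 2 ≤ L ^ 2 * D := by
      rw [hD, ← mul_pow, ← sq_abs]
      exact pow_le_pow_left₀ (abs_nonneg _) (gameMap_lipschitz hn hJ x x' i k) 2
    calc (flat (scaledPerron π) ⟨i, k⟩ *
          (flat (gameMap J x) ⟨i, k⟩ - flat (gameMap J x') ⟨i, k⟩)) ^ 2 =
          π i k ^ 2 * ((n i : ℝ) ^ 2 * (gameMap J x i k - gameMap J x' i k) ^ 2) := by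
          simp only [flat, scaledPerron]; ring
      _ ≤ _ := by gcongr
  refine (Finset.sum_le_sum fun k _ => this k).trans ?_
  rw [← Finset.sum_mul]
  calc (∑ k, π i k ^ 2) * ((n i : ℝ) ^ 2 * (L ^ 2 * D)) ≤
        ι ^ 2 * ((n i : ℝ) ^ 3 * (L ^ 2 * D)) :=
        mul_le_mul (hι i) (mul_le_mul_of_nonneg_right
          (pow_le_pow_right₀ hni (by norm_num)) (by positivity)) (by positivity) (sq_nonneg _)
    _ = _ := by ring

/-- The tracking error of the agents in their own components. -/
def selfTracking (π : Profile n) (g : (i : Fin N) → Fin (n i) → Fin (n i) → ℝ) : Agent n → ℝ :=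
  fun a => g a.1 a.2 a.2 - (∑ l, g a.1 l a.2) * π a.1 a.2

lemma sum_selfTracking_le {π : Profile n} (hn : ∀ i, 0 < n i) (hπ : ∀ i j, 0 < π i j)
    (hA : ∀ i, infPower (A i) = Matrix.of fun j _ => π i j)
    (g : (i : Fin N) → Fin (n i) → Fin (n i) → ℝ) :
    ∑ a, selfTracking π g a ^ 2 / flat (scaledPerron π) a ≤ trackingError π A g := by
  have hw : ∀ i j, 0 < scaledPerron π i j := fun i j =>
    mul_pos (by exact_mod_cast hn i) (hπ i j)
  rw [Fintype.sum_sigma, trackingError]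
  refine Finset.sum_le_sum fun i _ => Finset.sum_le_sum fun k _ => ?_
  rw [hA, wnorm_sq (hw i), rankOne_mulVec]
  exact Finset.single_le_sum (f := fun j => ((fun j => g i j k) - fun j => (∑ l, g i l k) * π i j) j ^ 2
    / scaledPerron π i j) (fun j _ => div_nonneg (sq_nonneg _) (hw i j).le) (Finset.mem_univ k)

lemma IsRun.direction_eq (h : IsRun J A Abar δ γ x g y) (hn : ∀ i, 0 < n i)
    (hcol : ∀ i k, ∑ j, A i j k = 1) {π xs : Profile n} (hxs : gameMap J xs = 0) (t : ℕ)
    (a : Agent n) :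
    g t a.1 a.2 a.2 = selfTracking π (g t) a + flat (scaledPerron π) a *
      ((flat (estGrad J (y t)) a - flat (gameMap J (x t)) a)
        + (flat (gameMap J (x t)) a - flat (gameMap J xs) a)) := by
  have hni : (n a.1 : ℝ) ≠ 0 := by exact_mod_cast (hn a.1).ne'
  rw [hxs]
  simp only [selfTracking, flat, scaledPerron, estGrad, h.sum_tracker hcol, Pi.zero_apply]
  field_simp
  ring

lemma IsRun.estimationVec_succ (h : IsRun J A Abar δ γ x g y) (hrow : ∀ p, ∑ q, Abar p q = 1)
    (t : ℕ) (q : Agent n) :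
    (fun p => flat (y (t + 1) p) q - flat (x (t + 1)) q) =
      (estDynamics Abar δ q).mulVec (fun p => flat (y t p) q - flat (x t) q)
        + fun _ => flat (x t) q - flat (x (t + 1)) q := by
  ext p
  rw [Pi.add_apply, estDynamics_mulVec, h.estimate]
  simp only [mul_sub, Finset.sum_sub_distrib, ← Finset.sum_mul, hrow]
  ring

lemma IsRun.estimate_sub (h : IsRun J A Abar δ γ x g y) (hrow : ∀ p, ∑ q, Abar p q = 1)
    (t : ℕ) (q : Agent n) :
    (fun p => flat (y (t + 1) p) q - flat (y t p) q) =
      (estDynamics Abar δ q).mulVec (fun p => flat (y t p) q - flat (x t) q)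
        + -(fun p => flat (y t p) q - flat (x t) q) := by
  ext p
  rw [Pi.add_apply, estDynamics_mulVec, h.estimate]
  simp only [mul_sub, Finset.sum_sub_distrib, ← Finset.sum_mul, hrow, Pi.neg_apply]
  ring

end Run

/-! ### Step-sizes and parameters -/

section Parameters

variable {N : ℕ} {n : Fin N → ℕ}

lemma flat_le_stepMax (γ : Profile n) (a : Agent n) : flat γ a ≤ stepMax γ :=
  le_ciSup (Set.finite_range _).bddAbove a

lemma card_mul_stepAvg [Nonempty (Agent n)] (γ : Profile n) :
    (Fintype.card (Agent n) : ℝ) * stepAvg γ = ∑ a, flat γ a := by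
  have : (Fintype.card (Agent n) : ℝ) ≠ 0 := by exact_mod_cast Fintype.card_ne_zero
  unfold stepAvg
  field_simp

lemma card_agent_pos [Nonempty (Agent n)] : (0 : ℝ) < Fintype.card (Agent n) :=
  Nat.cast_pos.2 Fintype.card_pos

lemma stepAvg_pos [Nonempty (Agent n)] {γ : Profile n} (hγ : ∀ i j, 0 < γ i j) :
    0 < stepAvg γ := by
  have h1 : 0 < ∑ a, flat γ a := Finset.sum_pos (fun a _ => hγ a.1 a.2) Finset.univ_nonempty
  rw [← card_mul_stepAvg] at h1
  exact pos_of_mul_pos_right h1 (Nat.cast_nonneg _)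

lemma stepAvg_le_stepMax [Nonempty (Agent n)] (γ : Profile n) : stepAvg γ ≤ stepMax γ := by
  refine le_of_mul_le_mul_left ?_ (card_agent_pos (n := n))
  rw [card_mul_stepAvg]
  exact (Finset.sum_le_sum fun a _ => flat_le_stepMax γ a).trans (by simp)

lemma stepMax_le_card_mul [Nonempty (Agent n)] {γ : Profile n} (hγ : ∀ i j, 0 < γ i j) :
    stepMax γ ≤ (Fintype.card (Agent n) : ℝ) * stepAvg γ := by
  rw [card_mul_stepAvg]
  exact ciSup_le fun a => Finset.single_le_sum (f := flat γ) (fun b _ => (hγ b.1 b.2).le)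
    (Finset.mem_univ a)

lemma stepHet_nonneg (γ : Profile n) : 0 ≤ stepHet γ :=
  div_nonneg (norm2_nonneg _) (norm2_nonneg _)

lemma norm2_const {ι : Type} [Fintype ι] (r : ℝ) :
    norm2 (fun _ : ι => r) = Real.sqrt (Fintype.card ι) * |r| := by
  rw [← Real.sqrt_sq (norm2_nonneg _), norm2_sq]
  simp [Real.sqrt_sq_eq_abs]

lemma norm2_sub_stepAvg [Nonempty (Agent n)] {γ : Profile n} (hγ : ∀ i j, 0 < γ i j) :
    norm2 (fun a : Agent n => flat γ a - stepAvg γ) =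
      stepHet γ * stepAvg γ * Real.sqrt (Fintype.card (Agent n)) := by
  have h1 := stepAvg_pos hγ
  have h2 := Real.sqrt_pos.2 (card_agent_pos (n := n))
  unfold stepHet
  rw [norm2_const, abs_of_pos h1]
  field_simp

lemma div_one_sub_sq_pos {s : ℝ} (h0 : 0 ≤ s) (h1 : s < 1) : 0 < (1 + s ^ 2) / (1 - s ^ 2) :=
  div_pos (by positivity) (by nlinarith)

lemma param_admissible (hN : 0 < N) [Nonempty (Agent n)] (hn : ∀ i, 0 < n i)
    {A : (i : Fin N) → Matrix (Fin (n i)) (Fin (n i)) ℝ}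
    {Abar : Matrix (Agent n) (Agent n) ℝ} {δ : Agent n → ℝ} {π : Profile n}
    {ν : CompatibleNorms (Agent n)} {L χ Clow Cup : ℝ} (hπ : ∀ i j, 0 < π i j)
    (hσ : ∀ i, wmatNorm (scaledPerron π i) (A i - infPower (A i)) < 1)
    (hν : ∀ q, ν.mat (estMatrix Abar δ q) < 1) (hL : 0 < L) (hχ : 0 < χ) (hlow : 0 < Clow)
    (hup : 0 < Cup) : (param A Abar δ π ν L χ Clow Cup).Admissible := by
  have : Nonempty (Fin N) := ⟨⟨0, hN⟩⟩
  have hni : ∀ i, (0 : ℝ) < n i := fun i => by exact_mod_cast hn i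
  have hw : ∀ a, 0 < flat (scaledPerron π) a := fun a => mul_pos (hni a.1) (hπ a.1 a.2)
  have a0 : Agent n := Classical.arbitrary _
  have i0 : Fin N := ⟨0, hN⟩
  refine ⟨?_, ?_, ?_, ?_, ?_, hL, hχ, hlow, hup, ?_, ?_, ?_, ?_, ?_, ?_⟩
  · exact Nat.one_le_cast.2 Fintype.card_pos
  · exact Finset.sum_pos (fun i _ => pow_pos (hni i) 3) Finset.univ_nonempty
  · obtain ⟨a, ha⟩ := exists_eq_ciInf_of_finite (f := flat (scaledPerron π))
    exact (hw a).trans_le ha.le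
  · exact (ciInf_le (Set.finite_range _).bddBelow a0).trans
      (le_ciSup (f := flat (scaledPerron π)) (Set.finite_range _).bddAbove a0)
  · refine lt_of_lt_of_le ?_ (le_ciSup (f := fun i => norm2 (π i)) (Set.finite_range _).bddAbove a0.1)
    refine lt_of_le_of_ne (norm2_nonneg _) fun h => ?_
    have h1 := norm2_sq (π a0.1)
    rw [← h] at h1
    have : 0 < ∑ j, π a0.1 j ^ 2 :=
      Finset.sum_pos (fun j _ => pow_pos (hπ a0.1 j) 2) ⟨a0.2, Finset.mem_univ _⟩
    linarith
  · exact Real.iSup_nonneg fun i => wmatNorm_nonneg _ _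
  · obtain ⟨i, hi⟩ := exists_eq_ciSup_of_finite
      (f := fun i => wmatNorm (scaledPerron π i) (A i - infPower (A i)))
    exact hi.ge.trans_lt (hσ i)
  · exact lt_of_lt_of_le (div_one_sub_sq_pos (wmatNorm_nonneg _ _) (hσ i0))
      (le_ciSup (f := fun i => (1 + wmatNorm (scaledPerron π i) (A i - infPower (A i)) ^ 2) /
        (1 - wmatNorm (scaledPerron π i) (A i - infPower (A i)) ^ 2))
        (Set.finite_range _).bddAbove i0)
  · exact Real.iSup_nonneg fun i => apply_nonneg _ _
  · obtain ⟨q, hq⟩ := exists_eq_ciSup_of_finite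
      (f := fun q => ν.mat (estMatrix Abar δ q))
    exact hq.ge.trans_lt (hν q)
  · exact lt_of_lt_of_le (div_one_sub_sq_pos (apply_nonneg _ _) (hν a0))
      (le_ciSup (f := fun q => (1 + ν.mat (estMatrix Abar δ q) ^ 2) /
        (1 - ν.mat (estMatrix Abar δ q) ^ 2)) (Set.finite_range _).bddAbove a0)

end Parameters

/-! ### The coupled error recursion -/

section Recursion

variable {N : ℕ} {n : Fin N → ℕ} {J : (i : Fin N) → Fin (n i) → Profile n → ℝ}
  {A : (i : Fin N) → Matrix (Fin (n i)) (Fin (n i)) ℝ} {Abar : Matrix (Agent n) (Agent n) ℝ}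
  {δ : Agent n → ℝ} {γ : Profile n} {x : ℕ → Profile n}
  {g : ℕ → (i : Fin N) → Fin (n i) → Fin (n i) → ℝ} {y : ℕ → Agent n → Profile n}
  {π xs : Profile n} {c : Param}

/-- The parameters `c` carry the cluster sizes, and bounds on the Perron vectors `π`. -/
structure Param.Bounds (c : Param) (π : Profile n) : Prop where
  n_eq : c.n = Fintype.card (Agent n)
  S_eq : c.S = ∑ i, (n i : ℝ) ^ 3
  pmin_le : ∀ a, c.pmin ≤ flat (scaledPerron π) a
  le_pmax : ∀ a, flat (scaledPerron π) a ≤ c.pmax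
  iota : ∀ i, ∑ j, π i j ^ 2 ≤ c.iota ^ 2

lemma nashGap_eq (hw : ∀ a, 0 < flat (scaledPerron π) a) (z : Profile n) :
    nashGap π xs z = ∑ a, (flat z a - flat xs a) ^ 2 / flat (scaledPerron π) a := by
  rw [nashGap, wnorm_sq hw]
  rfl

lemma norm2_sq_le_nashGap (hc : c.Admissible) (hb : c.Bounds π) (z : Profile n) :
    norm2 (flat z - flat xs) ^ 2 ≤ c.pmax * nashGap π xs z := by
  have hw : ∀ a, 0 < flat (scaledPerron π) a := fun a => hc.pmin_pos.trans_le (hb.pmin_le a)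
  rw [nashGap_eq hw, norm2_sq, Finset.mul_sum]
  refine Finset.sum_le_sum fun a _ => ?_
  rw [mul_div_assoc', le_div_iff₀ (hw a), mul_comm]
  exact mul_le_mul_of_nonneg_right (hb.le_pmax a) (sq_nonneg _)

lemma nashGap_le_norm2_sq (hc : c.Admissible) (hb : c.Bounds π) (z : Profile n) :
    c.pmin * nashGap π xs z ≤ norm2 (flat z - flat xs) ^ 2 := by
  have hw : ∀ a, 0 < flat (scaledPerron π) a := fun a => hc.pmin_pos.trans_le (hb.pmin_le a)
  rw [nashGap_eq hw, norm2_sq, Finset.mul_sum]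
  refine Finset.sum_le_sum fun a _ => ?_
  rw [mul_div_assoc', div_le_iff₀ (hw a), mul_comm]
  exact mul_le_mul_of_nonneg_left (hb.pmin_le a) (sq_nonneg _)

lemma trackingError_nonneg (π : Profile n) (A : (i : Fin N) → Matrix (Fin (n i)) (Fin (n i)) ℝ)
    (g : (i : Fin N) → Fin (n i) → Fin (n i) → ℝ) : 0 ≤ trackingError π A g :=
  Finset.sum_nonneg fun _ _ => Finset.sum_nonneg fun _ _ => sq_nonneg _

/-- Bound on the step directions of all agents in terms of the three errors. -/
lemma IsRun.sum_direction_sq_le (h : IsRun J A Abar δ γ x g y) (hn : ∀ i, 0 < n i)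
    (hcol : ∀ i k, ∑ j, A i j k = 1) (hJ : RegularCosts J c.L) (hπ : ∀ i j, 0 < π i j)
    (hA : ∀ i, infPower (A i) = Matrix.of fun j _ => π i j) (hc : c.Admissible)
    (hb : c.Bounds π) (hxs : gameMap J xs = 0) (t : ℕ) :
    ∑ a : Agent n, g t a.1 a.2 a.2 ^ 2 ≤ 3 * (c.pmax * trackingError π A (g t)
      + c.n ^ 2 * c.iota ^ 2 * c.L ^ 2 * estDist (x t) (y t)
      + c.iota ^ 2 * c.S * c.L ^ 2 * norm2 (flat (x t) - flat xs) ^ 2) := by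
  have hw : ∀ a, 0 < flat (scaledPerron π) a := fun a => hc.pmin_pos.trans_le (hb.pmin_le a)
  rw [Finset.sum_congr rfl fun a _ => congrArg (· ^ 2) (h.direction_eq hn hcol (π := π) hxs t a)]
  refine sum_sq_three_terms_le.trans (mul_le_mul_of_nonneg_left
    (add_le_add (add_le_add ?_ ?_) ?_) (by norm_num))
  · refine le_trans ?_ (mul_le_mul_of_nonneg_left (sum_selfTracking_le hn hπ hA (g t))
      hc.pmax_pos.le)
    rw [Finset.mul_sum]
    refine Finset.sum_le_sum fun a _ => ?_
    rw [mul_div_assoc', le_div_iff₀ (hw a), mul_comm]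
    exact mul_le_mul_of_nonneg_right (hb.le_pmax a) (sq_nonneg _)
  · refine (sum_scaled_gradError_sq_le hn hJ hb.iota (x t) (y t)).trans ?_
    rw [← hb.n_eq]
    have h1 : c.n ≤ c.n ^ 2 := by nlinarith [hc.one_le_n]
    have h2 := estDist_nonneg (x t) (y t)
    gcongr
  · rw [hb.S_eq]
    exact sum_scaled_gameMap_sq_le hn hJ hb.iota (x t) xs

lemma IsRun.nashGap_succ_le [Nonempty (Agent n)] (h : IsRun J A Abar δ γ x g y)
    (hn : ∀ i, 0 < n i) (hcol : ∀ i k, ∑ j, A i j k = 1) (hJ : RegularCosts J c.L)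
    (hF : StronglyMonotone J c.chi) (hπ : ∀ i j, 0 < π i j)
    (hA : ∀ i, infPower (A i) = Matrix.of fun j _ => π i j) (hc : c.Admissible)
    (hb : c.Bounds π) (hxs : gameMap J xs = 0) (hγ : ∀ i j, 0 < γ i j) {E : ℝ} (t : ℕ)
    (hE : c.Clow ^ 2 * estDist (x t) (y t) ≤ E) :
    nashGap π xs (x (t + 1)) ≤
      (1 - c.k1 * stepAvg γ + c.k2 * stepMax γ ^ 2 + c.k3 * stepHet γ * stepAvg γ)
        * nashGap π xs (x t)
      + (c.k4 * stepMax γ ^ 2 + c.k5 * stepMax γ ^ 2 / stepAvg γ) * trackingError π A (g t)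
      + (c.k6 * stepMax γ ^ 2 + c.k7 * stepMax γ ^ 2 / stepAvg γ) * E := by
  have hw : ∀ a, 0 < flat (scaledPerron π) a := fun a => hc.pmin_pos.trans_le (hb.pmin_le a)
  have hγa := stepAvg_pos hγ
  have hstep : ∀ a : Agent n, flat (x (t + 1)) a - flat xs a = (flat (x t) a - flat xs a)
      - flat γ a * (selfTracking π (g t) a + flat (scaledPerron π) a *
      ((flat (estGrad J (y t)) a - flat (gameMap J (x t)) a)
        + (flat (gameMap J (x t)) a - flat (gameMap J xs) a))) := by
    intro a
    rw [← h.direction_eq hn hcol hxs t a]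
    simp only [flat, h.decision]
    ring
  have key := decision_step (w := flat (scaledPerron π)) (Δ := fun a => flat (x t) a - flat xs a)
    (u := selfTracking π (g t))
    (h := fun a => flat (estGrad J (y t)) a - flat (gameMap J (x t)) a)
    (f := fun a => flat (gameMap J (x t)) a - flat (gameMap J xs) a) (γ := flat γ)
    (γM := stepMax γ) (γa := stepAvg γ)
    (η := norm2 (fun a : Agent n => flat γ a - stepAvg γ))
    (D := norm2 (flat (x t) - flat xs) ^ 2)
    hc.pmin_pos hb.pmin_le hc.chi_pos hc.L_pos.le (fun a => (hγ a.1 a.2).le)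
    (flat_le_stepMax γ) hγa (norm2_nonneg _) (norm2_sq _).symm (norm2_sq _).symm
    (by
      have := hF (x t) xs
      rw [Fintype.sum_sigma]
      exact this)
    (fun a => by
      rw [← mul_pow, ← sq_abs]
      exact pow_le_pow_left₀ (abs_nonneg _) (gameMap_lipschitz hn hJ (x t) xs a.1 a.2) 2)
  refine Param.Admissible.decision_row hc (D := norm2 (flat (x t) - flat xs) ^ 2)
    (E2 := estDist (x t) (y t)) hγa (η := norm2 (fun a : Agent n => flat γ a - stepAvg γ))
    (by rw [norm2_sub_stepAvg hγ, hb.n_eq]) (stepHet_nonneg γ) ?_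
    (sum_selfTracking_le hn hπ hA (g t)) (trackingError_nonneg _ _ _)
    (sum_gradError_sq_le hn hJ (x t) (y t))
    (h.sum_direction_sq_le hn hcol hJ hπ hA hc hb hxs t)
    (norm2_sq_le_nashGap hc hb (x t)) (nashGap_le_norm2_sq hc hb (x t)) (estDist_nonneg _ _) hE
  rw [nashGap_eq hw, nashGap_eq hw, Finset.sum_congr rfl fun a _ =>
    congrArg (· ^ 2 / flat (scaledPerron π) a) (hstep a)]
  rw [Finset.sum_congr rfl fun a _ => congrArg (· ^ 2) (h.direction_eq hn hcol (π := π) hxs t a)]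
  exact key

/-- The estimates move by `(M_q - 1) e_q`, whatever the decisions do. -/
lemma IsRun.sum_estimate_sub_le (h : IsRun J A Abar δ γ x g y) (hrow : ∀ p, ∑ q, Abar p q = 1)
    (hc : c.Admissible) {W : Agent n → (Agent n → ℝ) → ℝ} {τ : Agent n → ℝ}
    (hτ : ∀ q, τ q ≤ c.sigma2) (hlow : ∀ q v, c.Clow * norm2 v ≤ W q v)
    (hmul : ∀ q v, W q ((estDynamics Abar δ q).mulVec v) ≤ τ q * W q v) (t : ℕ) :
    ∑ p, norm2 (flat (y (t + 1) p) - flat (y t p)) ^ 2 ≤ (1 + c.sigma2) ^ 2 *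
      (∑ q, W q (fun p => flat (y t p) q - flat (x t) q) ^ 2) / c.Clow ^ 2 := by
  have hCl := hc.Clow_pos
  have e : ∑ p, norm2 (flat (y (t + 1) p) - flat (y t p)) ^ 2 =
      ∑ q, norm2 (fun p => flat (y (t + 1) p) q - flat (y t p) q) ^ 2 := by
    simp only [norm2_sq, Pi.sub_apply]
    exact Finset.sum_comm
  rw [e, le_div_iff₀ (by positivity), mul_comm, Finset.mul_sum, Finset.mul_sum]
  refine Finset.sum_le_sum fun q _ => ?_
  rw [← mul_pow, ← mul_pow, h.estimate_sub hrow]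
  set v : Agent n → ℝ := fun p => flat (y t p) q - flat (x t) q
  have hW0 : 0 ≤ W q v := (mul_nonneg hCl.le (norm2_nonneg _)).trans (hlow q v)
  refine pow_le_pow_left₀ (mul_nonneg hCl.le (norm2_nonneg _)) ?_ 2
  have h1 := mul_le_mul_of_nonneg_left
    (norm2_add_le ((estDynamics Abar δ q).mulVec v) (-v)) hCl.le
  rw [norm2_neg] at h1
  have h2 := (hlow q ((estDynamics Abar δ q).mulVec v)).trans (hmul q v)
  have h3 := hlow q v
  have h4 := mul_le_mul_of_nonneg_right (hτ q) hW0
  linarith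

lemma IsRun.trackingError_succ_le (h : IsRun J A Abar δ γ x g y) (hn : ∀ i, 0 < n i)
    (hcol : ∀ i k, ∑ j, A i j k = 1) (hJ : RegularCosts J c.L)
    (hπP : ∀ i, IsPerronVector (A i) (π i)) (hπ : ∀ i j, 0 < π i j)
    (hA : ∀ i, infPower (A i) = Matrix.of fun j _ => π i j)
    (hσ : ∀ i, wmatNorm (scaledPerron π i) (A i - infPower (A i)) < 1)
    (hσ1 : ∀ i, wmatNorm (scaledPerron π i) (A i - infPower (A i)) ≤ c.sigma1)
    (hvs : ∀ i, (1 + wmatNorm (scaledPerron π i) (A i - infPower (A i)) ^ 2) /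
      (1 - wmatNorm (scaledPerron π i) (A i - infPower (A i)) ^ 2) ≤ c.vs1)
    (hc : c.Admissible) (hb : c.Bounds π) {R : ℝ} (t : ℕ)
    (hR : ∑ p, norm2 (flat (y (t + 1) p) - flat (y t p)) ^ 2 ≤ R) :
    trackingError π A (g (t + 1)) ≤ (1 + c.sigma1 ^ 2) / 2 * trackingError π A (g t)
      + c.vs1 * (c.n * c.L ^ 2 / c.pmin * R) := by
  have hpm := hc.pmin_pos
  set d : (i : Fin N) → Fin (n i) → Fin (n i) → ℝ := fun i k j =>
    partialGrad i k (J i j) (y (t + 1) ⟨i, j⟩) - partialGrad i k (J i j) (y t ⟨i, j⟩) with hd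
  have hni : ∀ i, (0 : ℝ) < n i := fun i => by exact_mod_cast hn i
  have hw : ∀ i j, 0 < scaledPerron π i j := fun i j => mul_pos (hni i) (hπ i j)
  have hstep : ∀ i k, wnorm (scaledPerron π i) ((fun j => g (t + 1) i j k)
        - (infPower (A i)).mulVec (fun j => g (t + 1) i j k)) ^ 2 ≤
      (1 + c.sigma1 ^ 2) / 2 * wnorm (scaledPerron π i) ((fun j => g t i j k)
        - (infPower (A i)).mulVec (fun j => g t i j k)) ^ 2
      + c.vs1 * wnorm (scaledPerron π i) (d i k) ^ 2 := by
    intro i k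
    have h1 := tracking_step (hcol i) (hπP i) (hπ i) (hni i) (g := fun j => g t i j k)
      (g' := fun j => g (t + 1) i j k) (h := d i k) (by
        ext j
        simp only [h.tracker, hd, Pi.add_apply, Matrix.mulVec, dotProduct]
        ring)
    rw [← hA i] at h1
    refine (sq_le_of_le_mul_add (wmatNorm_nonneg _ _) (hσ i) (wnorm_nonneg _ _) h1).trans
      (add_le_add ?_ ?_)
    · refine mul_le_mul_of_nonneg_right ?_ (sq_nonneg _)
      have := pow_le_pow_left₀ (wmatNorm_nonneg _ _) (hσ1 i) 2
      exact div_le_div_of_nonneg_right (by linarith) (by norm_num)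
    · exact mul_le_mul_of_nonneg_right (hvs i) (sq_nonneg _)
  have hdsum : ∑ i, ∑ k, wnorm (scaledPerron π i) (d i k) ^ 2 ≤ c.n * c.L ^ 2 / c.pmin * R := by
    have h1 : ∀ i k, wnorm (scaledPerron π i) (d i k) ^ 2 ≤
        c.L ^ 2 / c.pmin * ∑ j, norm2 (flat (y (t + 1) ⟨i, j⟩) - flat (y t ⟨i, j⟩)) ^ 2 := by
      intro i k
      rw [wnorm_sq (hw i), Finset.mul_sum]
      refine Finset.sum_le_sum fun j _ => ?_
      have h2 : d i k j ^ 2 ≤ c.L ^ 2 * norm2 (flat (y (t + 1) ⟨i, j⟩) - flat (y t ⟨i, j⟩)) ^ 2 := by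
        rw [← mul_pow, ← sq_abs]
        exact pow_le_pow_left₀ (abs_nonneg _) (hJ.lipschitz i j k _ _) 2
      calc d i k j ^ 2 / scaledPerron π i j ≤
            c.L ^ 2 * norm2 (flat (y (t + 1) ⟨i, j⟩) - flat (y t ⟨i, j⟩)) ^ 2 / c.pmin :=
            div_le_div₀ (by positivity) h2 hpm (hb.pmin_le ⟨i, j⟩)
        _ = _ := by ring
    calc ∑ i, ∑ k, wnorm (scaledPerron π i) (d i k) ^ 2
        ≤ ∑ i, c.n * (c.L ^ 2 / c.pmin *
          ∑ j, norm2 (flat (y (t + 1) ⟨i, j⟩) - flat (y t ⟨i, j⟩)) ^ 2) := by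
          refine Finset.sum_le_sum fun i _ => (Finset.sum_le_sum fun k _ => h1 i k).trans ?_
          rw [Finset.sum_const, Finset.card_univ, Fintype.card_fin, nsmul_eq_mul, hb.n_eq]
          exact mul_le_mul_of_nonneg_right (natCast_le_card i) (by positivity)
      _ = c.n * c.L ^ 2 / c.pmin * ∑ p, norm2 (flat (y (t + 1) p) - flat (y t p)) ^ 2 := by
          rw [← Finset.mul_sum, ← Finset.mul_sum, Fintype.sum_sigma]
          ring
      _ ≤ _ := by
          have := hc.n_pos
          exact mul_le_mul_of_nonneg_left hR (by positivity)
  unfold trackingError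
  refine (Finset.sum_le_sum fun i _ => Finset.sum_le_sum fun k _ => hstep i k).trans ?_
  simp only [Finset.sum_add_distrib, ← Finset.mul_sum]
  exact add_le_add le_rfl (mul_le_mul_of_nonneg_left hdsum hc.vs1_pos.le)

lemma IsRun.estimation_succ_le (h : IsRun J A Abar δ γ x g y)
    (hrow : ∀ p, ∑ q, Abar p q = 1) (hγ : ∀ i j, 0 < γ i j)
    (hc : c.Admissible) (hb : c.Bounds π) {W : Agent n → (Agent n → ℝ) → ℝ} {τ : Agent n → ℝ}
    (hτ0 : ∀ q, 0 ≤ τ q) (hτ1 : ∀ q, τ q < 1) (hτ : ∀ q, τ q ≤ c.sigma2)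
    (hvs : ∀ q, (1 + τ q ^ 2) / (1 - τ q ^ 2) ≤ c.vs2)
    (hlow : ∀ q v, c.Clow * norm2 v ≤ W q v) (hup : ∀ q v, W q v ≤ c.Cup * norm2 v)
    (hadd : ∀ q v w, W q (v + w) ≤ W q v + W q w)
    (hmul : ∀ q v, W q ((estDynamics Abar δ q).mulVec v) ≤ τ q * W q v) (t : ℕ) :
    ∑ q, W q (fun p => flat (y (t + 1) p) q - flat (x (t + 1)) q) ^ 2 ≤
      (1 + c.sigma2 ^ 2) / 2 * ∑ q, W q (fun p => flat (y t p) q - flat (x t) q) ^ 2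
      + c.vs2 * (c.Cup ^ 2 * c.n ^ 2 * (stepMax γ ^ 2 * ∑ a : Agent n, g t a.1 a.2 a.2 ^ 2)) := by
  have hW0 : ∀ q v, 0 ≤ W q v := fun q v =>
    (mul_nonneg hc.Clow_pos.le (norm2_nonneg _)).trans (hlow q v)
  simp only [Finset.mul_sum]
  rw [← Finset.sum_add_distrib]
  refine Finset.sum_le_sum fun q _ => ?_
  rw [h.estimationVec_succ hrow]
  set v : Agent n → ℝ := fun p => flat (y t p) q - flat (x t) q
  set b : Agent n → ℝ := fun _ => flat (x t) q - flat (x (t + 1)) q with hbdef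
  have h1 : W q ((estDynamics Abar δ q).mulVec v + b) ≤ τ q * W q v + W q b :=
    (hadd _ _ _).trans (add_le_add (hmul q v) le_rfl)
  refine (sq_le_of_le_mul_add (hτ0 q) (hτ1 q) (hW0 _ _) h1).trans (add_le_add ?_ ?_)
  · refine mul_le_mul_of_nonneg_right ?_ (sq_nonneg _)
    have := pow_le_pow_left₀ (hτ0 q) (hτ q) 2
    exact div_le_div_of_nonneg_right (by linarith) (by norm_num)
  · have hd : flat (x t) q - flat (x (t + 1)) q = flat γ q * g t q.1 q.2 q.2 := by
      simp only [flat, h.decision]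
      ring
    have h2 : W q b ^ 2 ≤ c.Cup ^ 2 * c.n ^ 2 * (stepMax γ ^ 2 * g t q.1 q.2 q.2 ^ 2) := by
      have h3 : norm2 b ^ 2 = c.n * (flat γ q ^ 2 * g t q.1 q.2 q.2 ^ 2) := by
        rw [norm2_sq, hbdef]
        simp only [hd, Finset.sum_const, Finset.card_univ, nsmul_eq_mul, hb.n_eq, mul_pow]
      have h4 : flat γ q ^ 2 ≤ stepMax γ ^ 2 :=
        pow_le_pow_left₀ (hγ q.1 q.2).le (flat_le_stepMax γ q) 2
      have h5 : c.n ≤ c.n ^ 2 := by nlinarith [hc.one_le_n]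
      have hn0 := hc.n_pos
      calc W q b ^ 2 ≤ (c.Cup * norm2 b) ^ 2 := pow_le_pow_left₀ (hW0 _ _) (hup q b) 2
        _ = c.Cup ^ 2 * c.n * (flat γ q ^ 2 * g t q.1 q.2 q.2 ^ 2) := by rw [mul_pow, h3]; ring
        _ ≤ c.Cup ^ 2 * c.n ^ 2 * (stepMax γ ^ 2 * g t q.1 q.2 q.2 ^ 2) := by gcongr
    exact mul_le_mul (hvs q) h2 (sq_nonneg _) hc.vs2_pos.le

end Recursion

lemma param_bounds {N : ℕ} {n : Fin N → ℕ} (A : (i : Fin N) → Matrix (Fin (n i)) (Fin (n i)) ℝ)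
    (Abar : Matrix (Agent n) (Agent n) ℝ) (δ : Agent n → ℝ) (π : Profile n)
    (ν : CompatibleNorms (Agent n)) (L χ Clow Cup : ℝ) :
    (param A Abar δ π ν L χ Clow Cup).Bounds π := by
  refine ⟨rfl, rfl, fun a => ?_, fun a => ?_, fun i => ?_⟩
  · exact ciInf_le (f := flat (scaledPerron π)) (Set.finite_range _).bddBelow a
  · exact le_ciSup (f := flat (scaledPerron π)) (Set.finite_range _).bddAbove a
  · rw [← norm2_sq]
    exact pow_le_pow_left₀ (norm2_nonneg _)
      (le_ciSup (f := fun i => norm2 (π i)) (Set.finite_range _).bddAbove i) 2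

end ClusterGame

theorem theorem1 {N : ℕ} (hN : 0 < N) {n : Fin N → ℕ} (hn : ∀ i, 0 < n i)
    -- intra-cluster networks: strongly connected, column-stochastic weights
    (G : (i : Fin N) → Digraph (Fin (n i))) (A : (i : Fin N) → Matrix (Fin (n i)) (Fin (n i)) ℝ)
    (hA : ∀ i, IsAdjacencyMatrix (G i) (A i)) (hG : ∀ i, StronglyConnected (G i))
    (hcol : ∀ i k, ∑ j, A i j k = 1)
    -- inter-cluster network: strongly connected, row-stochastic weights
    (Gbar : Digraph (Agent n)) (Abar : Matrix (Agent n) (Agent n) ℝ)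
    (hAbar : IsAdjacencyMatrix Gbar Abar) (hGbar : StronglyConnected Gbar)
    (hrow : ∀ p, ∑ q, Abar p q = 1)
    -- local costs and game mapping
    (J : (i : Fin N) → Fin (n i) → Profile n → ℝ) (L : ℝ) (hJ : RegularCosts J L)
    (χ : ℝ) (hχ : 0 < χ) (hF : StronglyMonotone J χ)
    -- leader-following gains
    (δ : Agent n → ℝ) (hδ : ∀ p, 0 < δ p) (hδ' : ∀ p q, δ p * Abar p q < 2 * Abar p p) :
    -- the objects in terms of which the result is expressed exist
    (∀ i, ∃! v, IsPerronVector (A i) v) ∧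
    (∃! xs, IsNash J xs) ∧
    (∃ ν : CompatibleNorms (Agent n), ∀ q, ν.mat (estMatrix Abar δ q) < 1) ∧
    -- and the result holds for them
    ∀ (π : Profile n), (∀ i, IsPerronVector (A i) (π i)) →
    ∀ (xs : Profile n), IsNash J xs →
    ∀ (ν : CompatibleNorms (Agent n)), (∀ q, ν.mat (estMatrix Abar δ q) < 1) →
    ∀ (Clow Cup : ℝ), 0 < Clow → 0 < Cup →
      (∀ v, Clow * norm2 v ≤ ν.vec v ∧ ν.vec v ≤ Cup * norm2 v) →
    ∀ (c : Param), c = param A Abar δ π ν L χ Clow Cup →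
    ∀ (γ : Profile n), (∀ i j, 0 < γ i j) →
      stepHet γ < c.k1 / c.k3 →
      stepMax γ < 1 / c.k1 → stepMax γ < c.gamma1 (stepHet γ) →
      stepMax γ < c.gamma2 (stepHet γ) → stepMax γ < c.gamma3 (stepHet γ) →
    specRadius (c.T (stepMax γ) (stepAvg γ) (stepHet γ)) < 1 ∧
    ∀ (x : ℕ → Profile n) (g : ℕ → (i : Fin N) → Fin (n i) → Fin (n i) → ℝ)
      (y : ℕ → Agent n → Profile n), IsRun J A Abar δ γ x g y →
      SupConvergesLinearly (fun t => nashGap π xs (x t))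
        (specRadius (c.T (stepMax γ) (stepAvg γ) (stepHet γ))).toReal ∧
      SupConvergesLinearly (fun t => trackingError π A (g t))
        (specRadius (c.T (stepMax γ) (stepAvg γ) (stepHet γ))).toReal ∧
      SupConvergesLinearly (fun t => estimationError ν (x t) (y t))
        (specRadius (c.T (stepMax γ) (stepAvg γ) (stepHet γ))).toReal := by
  have : Nonempty (Agent n) := ⟨⟨⟨0, hN⟩, ⟨0, hn _⟩⟩⟩
  have hne : ∀ i, Nonempty (Fin (n i)) := fun i => ⟨⟨0, hn i⟩⟩
  have hni : ∀ i, (0 : ℝ) < n i := fun i => by exact_mod_cast hn i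
  have hL : 0 < L := hF.lipschitz_pos hn hJ hχ
  refine ⟨fun i => existsUnique_perronVector (hA i) (hG i) (hcol i),
    existsUnique_isNash hn hJ hχ hF, exists_compatibleNorms_estMatrix hAbar hGbar hrow hδ hδ', ?_⟩
  intro π hπP xs hxs ν hν Clow Cup hClow hCup heq c hcdef γ hγ hhet hM1 hMg1 hMg2 hMg3
  have hπ : ∀ i j, 0 < π i j := fun i j => (hπP i).pos (hA i) (hG i) (hcol i) j
  have hinf : ∀ i, infPower (A i) = Matrix.of fun j _ => π i j := fun i =>
    infPower_eq (hA i) (hG i) (hcol i) (hπP i)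
  have hσ : ∀ i, wmatNorm (scaledPerron π i) (A i - infPower (A i)) < 1 := fun i => by
    rw [hinf]
    exact wmatNorm_sub_rankOne_lt_one (hA i) (hG i) (hcol i) (hπP i) (hni i)
  have hadm : c.Admissible := hcdef ▸ param_admissible hN hn hπ hσ hν hL hχ hClow hCup
  have hb : c.Bounds π := hcdef ▸ param_bounds A Abar δ π ν L χ Clow Cup
  have hcL : c.L = L := by rw [hcdef]; rfl
  have hcχ : c.chi = χ := by rw [hcdef]; rfl
  have hcCl : c.Clow = Clow := by rw [hcdef]; rfl
  have hcCu : c.Cup = Cup := by rw [hcdef]; rfl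
  have hσ1 : ∀ i, wmatNorm (scaledPerron π i) (A i - infPower (A i)) ≤ c.sigma1 := fun i => by
    rw [hcdef]
    exact le_ciSup (f := fun i => wmatNorm (scaledPerron π i) (A i - infPower (A i)))
      (Set.finite_range _).bddAbove i
  have hvs1 : ∀ i, (1 + wmatNorm (scaledPerron π i) (A i - infPower (A i)) ^ 2) /
      (1 - wmatNorm (scaledPerron π i) (A i - infPower (A i)) ^ 2) ≤ c.vs1 := fun i => by
    rw [hcdef]
    exact le_ciSup (f := fun i => (1 + wmatNorm (scaledPerron π i) (A i - infPower (A i)) ^ 2) /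
      (1 - wmatNorm (scaledPerron π i) (A i - infPower (A i)) ^ 2))
      (Set.finite_range _).bddAbove i
  have hτ : ∀ q, ν.mat (estMatrix Abar δ q) ≤ c.sigma2 := fun q => by
    rw [hcdef]
    exact le_ciSup (f := fun q => ν.mat (estMatrix Abar δ q)) (Set.finite_range _).bddAbove q
  have hvs2 : ∀ q, (1 + ν.mat (estMatrix Abar δ q) ^ 2) /
      (1 - ν.mat (estMatrix Abar δ q) ^ 2) ≤ c.vs2 := fun q => by
    rw [hcdef]
    exact le_ciSup (f := fun q => (1 + ν.mat (estMatrix Abar δ q) ^ 2) /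
      (1 - ν.mat (estMatrix Abar δ q) ^ 2)) (Set.finite_range _).bddAbove q
  have hγa := stepAvg_pos hγ
  have hle := stepAvg_le_stepMax γ
  have hTpos := hadm.T_pos (γM := stepMax γ) (ε := stepHet γ) hγa hle (stepHet_nonneg γ) hM1
  set T := c.T (stepMax γ) (stepAvg γ) (stepHet γ) with hT
  obtain ⟨r, hr, u, hu, hTu⟩ := exists_pos_eigenvector hTpos
  have hspec : specRadius T = ENNReal.ofReal r :=
    specRadius_eq_of_pos_eigenvector (fun i j => (hTpos i j).le) hr.le hu hTu
  have hr1 : r < 1 := by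
    obtain ⟨w, hw, hTw⟩ := hadm.exists_T_mulVec_lt hγa hle
      (by rw [hb.n_eq]; exact stepMax_le_card_mul hγ) hhet hMg1 hMg2 hMg3
    exact eigenvalue_lt_one (fun i j => (hTpos i j).le) hu hTu hw hTw
  refine ⟨?_, ?_⟩
  · rw [hspec]
    exact ENNReal.ofReal_lt_one.2 hr1
  intro x g y hrun
  rw [hspec, ENNReal.toReal_ofReal hr.le]
  subst hcL hcχ hcCl hcCu
  choose W hWlow hWup hWadd hWmul using fun q =>
    exists_monotone_gauge ν (abs_estDynamics hAbar δ q) hClow heq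
  set E : ℕ → ℝ := fun t => ∑ q, W q (fun p => flat (y t p) q - flat (x t) q) ^ 2 with hEdef
  have hxs0 := (isNash_iff hJ xs).1 hxs
  have hE0 : ∀ t, 0 ≤ E t := fun t => Finset.sum_nonneg fun _ _ => sq_nonneg _
  have hX0 : ∀ t, 0 ≤ nashGap π xs (x t) := fun t => sq_nonneg _
  have hG0 : ∀ t, 0 ≤ trackingError π A (g t) := fun t => trackingError_nonneg _ _ _
  have hE : ∀ t, c.Clow ^ 2 * estDist (x t) (y t) ≤ E t := by
    intro t
    rw [estDist_eq, Finset.mul_sum]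
    refine Finset.sum_le_sum fun q _ => ?_
    rw [← mul_pow]
    exact pow_le_pow_left₀ (mul_nonneg hClow.le (norm2_nonneg _)) (hWlow q _) 2
  have hrec : ∀ t i, (![nashGap π xs (x (t + 1)), trackingError π A (g (t + 1)), E (t + 1)] :
      Fin 3 → ℝ) i ≤
      T.mulVec ![nashGap π xs (x t), trackingError π A (g t), E t] i := by
    intro t i
    have h1 := hrun.nashGap_succ_le hn hcol hJ hF hπ hinf hadm hb hxs0 hγ t (hE t)
    have h2 := Param.Admissible.tracking_row hadm (γM := stepMax γ) (hX0 t) (hG0 t) (hE0 t)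
      (hrun.trackingError_succ_le hn hcol hJ hπP hπ hinf hσ hσ1 hvs1 hadm hb t
        (hrun.sum_estimate_sub_le hrow hadm hτ hWlow hWmul t))
    have h3 := Param.Admissible.estimation_row hadm
      (hrun.estimation_succ_le hrow hγ hadm hb (fun q => apply_nonneg _ _) hν hτ hvs2 hWlow hWup
        hWadd hWmul t)
      (hrun.sum_direction_sq_le hn hcol hJ hπ hinf hadm hb hxs0 t)
      (norm2_sq_le_nashGap hadm hb (x t)) (hE t)
    rw [hT]
    fin_cases i
    · simpa [Param.T, Matrix.mulVec, dotProduct, Fin.sum_univ_three] using h1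
    · simpa [Param.T, Matrix.mulVec, dotProduct, Fin.sum_univ_three] using h2
    · simpa [Param.T, Matrix.mulVec, dotProduct, Fin.sum_univ_three] using h3
  have hdecay := exists_forall_le_mul_pow (fun i j => (hTpos i j).le) hu hTu
    (v := fun t => ![nashGap π xs (x t), trackingError π A (g t), E t]) hrec
  obtain ⟨C0, hC0⟩ := hdecay 0
  obtain ⟨C1, hC1⟩ := hdecay 1
  obtain ⟨C2, hC2⟩ := hdecay 2
  refine ⟨supConvergesLinearly_of_le hX0 hr.le hr1 hC0,
    supConvergesLinearly_of_le hG0 hr.le hr1 hC1,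
    supConvergesLinearly_of_le (C := c.Cup ^ 2 / c.Clow ^ 2 * C2)
      (fun t => Finset.sum_nonneg fun _ _ => sq_nonneg _) hr.le hr1 fun t => ?_⟩
  -- the norm `ν.vec` is dominated by the gauges up to the ratio of the equivalence constants
  have hνE : estimationError ν (x t) (y t) ≤ c.Cup ^ 2 / c.Clow ^ 2 * E t := by
    rw [estimationError, hEdef, Finset.mul_sum]
    refine Finset.sum_le_sum fun q _ => ?_
    rw [div_mul_eq_mul_div, le_div_iff₀ (by positivity), ← mul_pow, ← mul_pow]
    refine pow_le_pow_left₀ (mul_nonneg (apply_nonneg _ _) hClow.le) ?_ 2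
    have h1 := mul_le_mul_of_nonneg_right (heq fun p => flat (y t p) q - flat (x t) q).2 hClow.le
    have h2 := mul_le_mul_of_nonneg_left (hWlow q fun p => flat (y t p) q - flat (x t) q) hCup.le
    linarith
  have h4 : E t ≤ C2 * r ^ t := hC2 t
  rw [mul_assoc]
  exact hνE.trans (mul_le_mul_of_nonneg_left h4 (by positivity))
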